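/- Let $\mathbb Y$ be the set of Young diagrams, $\varnothing$ the empty diagram, and $|\nu|$ the number of boxes of $\nu$. The content of a box $\square=(i,j)$ (row $i$, column $j$) is $c(\square)=j-i$. For $\mu\subseteq\nu$ and $z\in\mathbb C$ put $(z)_{\nu/\mu}=\prod_{\square\in\nu/\mu}(z+c(\square))$ and $(z)_\nu=(z)_{\nu/\varnothing}$, and let $\dim\nu/\mu$ be the number of standard tableaux of skew shape $\nu/\mu$. Let $\mathrm{Sym}_{\mathbb C}$ be the algebra of symmetric functions over $\mathbb C$, with power sums $p_k$ and Schur functions $S_\nu$. For each $N$ at least the number of rows of $\nu$, let $$S^*_{\nu|N}(y_1,\dots,y_N)=\frac{\det[x_j(x_j-1)\cdots(x_j-n_i+1)]_{i,j=1}^N}{\prod_{i<j}(x_i-x_j)},\qquad x_i=y_i+N-i,\quad n_i=\nu_i+N-i,$$ be the shifted Schur polynomial. The polynomials $S^*_{\nu|N}$ are compatible with $y_N=0$ (with $S^*_{\nu|N}=0$ if $\nu$ has more than $N$ rows) and define the shifted Schur function $S^*_\nu$. The Frobenius–Schur function $FS_\nu\in\mathrm{Sym}_{\mathbb C}$ is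 the image of $S^*_\nu$ under the algebra isomorphism from shifted symmetric functions to symmetric functions that takes $p^*_k=\sum_{i}\big[(y_i-i+\tfrac12)^k-(-i+\tfrac12)^k\big]$ to $p_k$ for all $k\ge1$. Let $z,z',\xi\in\mathbb C$ with $\xi\neq1$. The Laguerre and Meixner symmetric functions are $$L_\nu=\sum_{\mu\subseteq\nu}(-1)^{|\nu|-|\mu|}\frac{\dim\nu/\mu}{(|\nu|-|\mu|)!}(z)_{\nu/\mu}(z')_{\nu/\mu}\,S_\mu,$$ $$M_\nu=\sum_{\mu\subseteq\nu}(-1)^{|\nu|-|\mu|}\Big(\frac{\xi}{1-\xi}\Big)^{|\nu|-|\mu|}\frac{\dim\nu/\mu}{(|\nu|-|\mu|)!}(z)_{\nu/\mu}(z')_{\nu/\mu}\,FS_\mu .$$ **Theorem.** There are unique linear functionals $\varphi^{La},\varphi^{Me}:\mathrm{Sym}_{\mathbb C}\to\mathbb C$ with $\varphi^{La}(L_\nu)=\delta_{\nu\varnothing}$ and $\varphi^{Me}(M_\nu)=\delta_{\nu\varnothing}$ for all $\nu\in\mathbb Y$, and for all $\mu,\nu\in\mathbb Y$ $$\varphi^{La}(L_\mu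 L_\nu)=\delta_{\mu\nu}\,(z)_\nu(z')_\nu,\qquad \varphi^{Me}(M_\mu M_\nu)=\delta_{\mu\nu}\,\frac{\xi^{|\nu|}}{(1-\xi)^{2|\nu|}}\,(z)_\nu(z')_\nu .$$ -/

import Mathlib

namespace SymFun

open MvPolynomial

/-! ### Multivariate polynomials built from a sequence of univariate polynomials -/

/-- The Vandermonde polynomial `V_N = ∏_{i<j} (x_i - x_j)`. -/
noncomputable def vdm (N : ℕ) : MvPolynomial (Fin N) ℂ :=
  ∏ i : Fin N, ∏ j ∈ Finset.Ioi i, (X i - X j)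

/-- The determinant `det [φ_{ν_i + N - i}(x_j)]` (with `i`, `j` counted from `0` in the code). -/
noncomputable def alternant (φ : ℕ → Polynomial ℂ) (ν : YoungDiagram) (N : ℕ) :
    MvPolynomial (Fin N) ℂ :=
  Matrix.det (Matrix.of fun i j : Fin N =>
    Polynomial.aeval (X j : MvPolynomial (Fin N) ℂ) (φ (ν.rowLen i + (N - 1 - i))))

theorem vdm_ne_zero (N : ℕ) : vdm N ≠ 0 := by
  unfold vdm
  refine Finset.prod_ne_zero_iff.2 fun i _ => Finset.prod_ne_zero_iff.2 fun j hj => ?_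
  rw [sub_ne_zero]
  intro h
  have := X_injective h
  simp [this] at hj

theorem irreducible_X_sub_X {N : ℕ} {i j : Fin N} (h : i ≠ j) :
    Irreducible (X i - X j : MvPolynomial (Fin N) ℂ) := by
  have := irreducible_mul_X_add (R := ℂ) (1 : MvPolynomial (Fin N) ℂ) (-X j) i one_ne_zero
    (by simp) (by simp [vars_neg, h]) isRelPrime_one_left
  simpa [sub_eq_add_neg] using this

theorem isRelPrime_X_sub_X {N : ℕ} {i j k l : Fin N} (h : i < j) (h' : k < l)
    (hne : (i, j) ≠ (k, l)) :
    IsRelPrime (X i - X j : MvPolynomial (Fin N) ℂ) (X k - X l) := by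
  rw [(irreducible_X_sub_X h.ne).isRelPrime_iff_not_dvd]
  rintro ⟨q, hq⟩
  have := congrArg (eval fun m : Fin N => if m = i then ((j : ℕ) : ℂ) else ((m : ℕ) : ℂ)) hq
  simp only [map_sub, eval_X, map_mul, if_true, if_neg h.ne', sub_self, zero_mul] at this
  rw [sub_eq_zero] at this
  simp only [ne_eq, Prod.mk.injEq] at hne
  split_ifs at this <;> norm_cast at this <;> simp only [← Fin.ext_iff] at this <;> grind

theorem X_sub_X_dvd_alternant (φ : ℕ → Polynomial ℂ) (ν : YoungDiagram) {N : ℕ} {i j : Fin N}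
    (h : i ≠ j) : (X i - X j : MvPolynomial (Fin N) ℂ) ∣ alternant φ ν N := by
  unfold alternant
  rw [← Matrix.det_updateCol_add_smul_self _ h (-1)]
  have : ∀ k : Fin N, ∃ c : MvPolynomial (Fin N) ℂ,
      Polynomial.aeval (X i) (φ (ν.rowLen k + (N - 1 - k)))
        - Polynomial.aeval (X j) (φ (ν.rowLen k + (N - 1 - k))) = (X i - X j) * c := by
    intro k
    simp only [Polynomial.aeval_def, ← Polynomial.eval_map]
    exact Polynomial.sub_dvd_eval_sub _ _ _
  choose c hc using this
  refine ⟨(Matrix.updateCol (Matrix.of fun i j : Fin N =>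
    Polynomial.aeval (X j : MvPolynomial (Fin N) ℂ) (φ (ν.rowLen i + (N - 1 - i)))) i c).det, ?_⟩
  rw [← Matrix.det_updateCol_smul]
  congr 2
  ext1 k
  simpa [sub_eq_add_neg] using hc k

theorem vdm_dvd_alternant (φ : ℕ → Polynomial ℂ) (ν : YoungDiagram) (N : ℕ) :
    vdm N ∣ alternant φ ν N := by
  unfold vdm
  rw [Finset.prod_sigma']
  refine Finset.prod_dvd_of_isRelPrime ?_ ?_
  · rintro ⟨i, j⟩ hij ⟨k, l⟩ hkl hne
    simp at hij hkl
    exact isRelPrime_X_sub_X hij hkl (by simpa using hne)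
  · rintro ⟨i, j⟩ hij
    simp at hij
    exact X_sub_X_dvd_alternant φ ν hij.ne

/-- The polynomial `φ_{ν|N} = det [φ_{ν_i + N - i}(x_j)] / V_N` for a diagram `ν` with at most `N`
rows; it is `0` by convention if `ν` has more than `N` rows. -/
noncomputable def multivariate (φ : ℕ → Polynomial ℂ) (ν : YoungDiagram) (N : ℕ) :
    MvPolynomial (Fin N) ℂ :=
  if ν.colLen 0 ≤ N then (vdm_dvd_alternant φ ν N).choose else 0

theorem vdm_mul_multivariate (φ : ℕ → Polynomial ℂ) {ν : YoungDiagram} {N : ℕ}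
    (h : ν.colLen 0 ≤ N) : vdm N * multivariate φ ν N = alternant φ ν N := by
  rw [multivariate, if_pos h]
  exact (vdm_dvd_alternant φ ν N).choose_spec.symm

/-! ### The algebra of symmetric functions -/

/-- Specialization of the last variable to `0`. -/
noncomputable def killLast (N : ℕ) : MvPolynomial (Fin (N + 1)) ℂ →ₐ[ℂ] MvPolynomial (Fin N) ℂ :=
  aeval (Fin.snoc (α := fun _ => MvPolynomial (Fin N) ℂ) X 0)

/-- The (complexified) algebra of symmetric functions: sequences `(f_N)` of symmetric polynomials
in `N` variables, compatible with specializing the last variable to `0`, of bounded degree. -/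
noncomputable def Sym : Subalgebra ℂ (∀ N : ℕ, MvPolynomial (Fin N) ℂ) where
  carrier := {f | (∀ N, (f N).IsSymmetric) ∧ (∀ N, killLast N (f (N + 1)) = f N) ∧
    ∃ d : ℕ, ∀ N, (f N).totalDegree ≤ d}
  mul_mem' := by
    rintro f g ⟨h1, h2, d, h3⟩ ⟨h1', h2', d', h3'⟩
    exact ⟨fun N => (h1 N).mul (h1' N), fun N => by simp [h2, h2'], d + d', fun N =>
      (totalDegree_mul _ _).trans (add_le_add (h3 N) (h3' N))⟩
  add_mem' := by
    rintro f g ⟨h1, h2, d, h3⟩ ⟨h1', h2', d', h3'⟩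
    exact ⟨fun N => (h1 N).add (h1' N), fun N => by simp [h2, h2'], max d d', fun N =>
      (totalDegree_add _ _).trans (max_le_max (h3 N) (h3' N))⟩
  algebraMap_mem' r := ⟨fun N => IsSymmetric.C r, fun N => by simp [Pi.algebraMap_apply], 0,
    fun N => by simp [Pi.algebraMap_apply, algebraMap_eq]⟩

theorem powerSum_mem (k : ℕ) : (fun N => psum (Fin N) ℂ (k + 1)) ∈ Sym := by
  refine ⟨fun N => psum_isSymmetric _ _ _, fun N => ?_, k + 1, fun N => ?_⟩
  · simp [psum, killLast, Fin.sum_univ_castSucc]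
  · exact totalDegree_finsetSum_le fun i _ => by simp

/-- The Newton power sum `p_{k+1}`. -/
noncomputable def powerSum (k : ℕ) : Sym := ⟨_, powerSum_mem k⟩

theorem alternant_rename (ν : YoungDiagram) (N : ℕ) (φ : ℕ → Polynomial ℂ)
    (σ : Equiv.Perm (Fin N)) :
    rename σ (alternant φ ν N) = (Equiv.Perm.sign σ : ℤ) * alternant φ ν N := by
  unfold alternant
  rw [← Matrix.det_permute', AlgHom.map_det]
  congr 1
  ext1 i j
  simp [← Polynomial.aeval_algHom_apply]

theorem vdm_rename (N : ℕ) (σ : Equiv.Perm (Fin N)) :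
    rename σ (vdm N) = (Equiv.Perm.sign σ : ℤ) * vdm N := by
  obtain ⟨s, hs⟩ : ∃ s : ℤ, vdm N =
      s * (Matrix.vandermonde (X : Fin N → MvPolynomial (Fin N) ℂ)).det := by
    refine ⟨∏ i : Fin N, ∏ j ∈ Finset.Ioi i, (-1), ?_⟩
    rw [Matrix.det_vandermonde]
    push_cast
    simp only [← Finset.prod_mul_distrib, vdm]
    simp
  rw [hs, map_mul, map_intCast, mul_left_comm, ← Matrix.det_permute, AlgHom.map_det]
  congr 2
  ext1 i j
  simp [Matrix.vandermonde]

theorem multivariate_isSymmetric (φ : ℕ → Polynomial ℂ) (ν : YoungDiagram) (N : ℕ) :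
    (multivariate φ ν N).IsSymmetric := by
  intro σ
  by_cases h : ν.colLen 0 ≤ N
  · have h1 := vdm_mul_multivariate φ h
    have h2 := congrArg (rename σ) h1
    rw [alternant_rename, map_mul, vdm_rename, ← h1, mul_assoc] at h2
    have h3 : ((Equiv.Perm.sign σ : ℤ) : MvPolynomial (Fin N) ℂ) ≠ 0 := by simp
    exact mul_left_cancel₀ (vdm_ne_zero N) (mul_left_cancel₀ h3 h2)
  · simp [multivariate, h]

theorem killLast_vdm (N : ℕ) : killLast N (vdm (N + 1)) = vdm N * ∏ i, X i := by
  unfold vdm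
  rw [Fin.prod_univ_castSucc, ← Finset.prod_mul_distrib]
  have : Finset.Ioi (Fin.last N) = ∅ := by ext; simp [Fin.le_last]
  rw [this, Finset.prod_empty, mul_one, map_prod]
  refine Finset.prod_congr rfl fun i _ => ?_
  have : Finset.Ioi i.castSucc = insert (Fin.last N) ((Finset.Ioi i).map Fin.castSuccEmb) := by
    ext k
    cases k using Fin.lastCases with
    | last => simp [Fin.castSucc_lt_last]
    | cast k => simp [Fin.le_last]
  rw [this, Finset.prod_insert (by simp), map_mul, map_prod,
    Finset.prod_map, mul_comm]
  simp [killLast]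

theorem colLen_zero_le_iff (ν : YoungDiagram) (N : ℕ) : ν.colLen 0 ≤ N ↔ ν.rowLen N = 0 := by
  have h1 := ν.mem_iff_lt_colLen (i := N) (j := 0)
  have h2 := ν.mem_iff_lt_rowLen (i := N) (j := 0)
  have := h1.symm.trans h2
  omega

theorem killLast_alternant (ν : YoungDiagram) (N : ℕ) :
    killLast N (alternant (fun n => Polynomial.X ^ n) ν (N + 1)) =
      if ν.colLen 0 ≤ N then (∏ i, X i) * alternant (fun n => Polynomial.X ^ n) ν N else 0 := by
  unfold alternant
  rw [AlgHom.map_det, Matrix.det_succ_column _ (Fin.last N), Fin.sum_univ_castSucc,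
    Finset.sum_eq_zero, zero_add]
  · simp only [colLen_zero_le_iff]
    split_ifs with h
    · rw [← Matrix.det_mul_row]
      have : (-1 : MvPolynomial (Fin N) ℂ) ^ (N + N) = 1 := Even.neg_one_pow ⟨N, rfl⟩
      simp [killLast, h, this]
      congr 1
      ext1 i j
      simp [← pow_succ']
      congr 1
      omega
    · simp [killLast, h]
  · intro i _
    have : ν.rowLen i + (N - i) ≠ 0 := by omega
    simp [killLast]
    left
    omega

theorem killLast_schur (ν : YoungDiagram) (N : ℕ) :
    killLast N (multivariate (fun n => Polynomial.X ^ n) ν (N + 1)) =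
      multivariate (fun n => Polynomial.X ^ n) ν N := by
  have hP : (∏ i, X i : MvPolynomial (Fin N) ℂ) ≠ 0 :=
    Finset.prod_ne_zero_iff.2 fun i _ => X_ne_zero i
  by_cases h : ν.colLen 0 ≤ N + 1
  · have h1 := congrArg (killLast N) (vdm_mul_multivariate (fun n => Polynomial.X ^ n) h)
    rw [map_mul, killLast_vdm, killLast_alternant] at h1
    split_ifs at h1 with h'
    · rw [← vdm_mul_multivariate _ h', mul_comm (vdm N), mul_assoc] at h1
      exact mul_left_cancel₀ (vdm_ne_zero N) (mul_left_cancel₀ hP h1)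
    · have h2 : multivariate (fun n => Polynomial.X ^ n) ν N = 0 := by simp [multivariate, h']
      rw [h2]
      exact (mul_eq_zero.1 h1).resolve_left (mul_ne_zero (vdm_ne_zero N) hP)
  · have h' : ¬ ν.colLen 0 ≤ N := by omega
    simp [multivariate, h, h']

theorem vdm_totalDegree (N : ℕ) : (vdm N).totalDegree = ∑ i : Fin N, (N - 1 - i) := by
  refine IsHomogeneous.totalDegree ?_ (vdm_ne_zero N)
  refine IsHomogeneous.prod _ _ _ fun i _ => ?_
  have := IsHomogeneous.prod (Finset.Ioi i) (fun j => (X i - X j : MvPolynomial (Fin N) ℂ))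
    (fun _ => 1) fun j _ => (isHomogeneous_X _ _).sub (isHomogeneous_X _ _)
  simpa using this

theorem sum_rowLen_le (ν : YoungDiagram) (N : ℕ) : ∑ i : Fin N, ν.rowLen i ≤ ν.card := by
  rw [Fin.sum_univ_eq_sum_range fun i => ν.rowLen i]
  simp only [ν.rowLen_eq_card]
  rw [← Finset.card_biUnion]
  · refine Finset.card_le_card fun c hc => ?_
    simp [YoungDiagram.mem_row_iff] at hc
    exact hc.2
  · intro i _ j _ hij
    rw [Function.onFun, Finset.disjoint_left]
    intro c hc hc'
    rw [YoungDiagram.mem_row_iff] at hc hc'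
    exact hij (hc.2.symm.trans hc'.2)

theorem schur_totalDegree_le (ν : YoungDiagram) (N : ℕ) :
    (multivariate (fun n => Polynomial.X ^ n) ν N).totalDegree ≤ ν.card := by
  by_cases h0 : multivariate (fun n => Polynomial.X ^ n) ν N = 0
  · simp [h0]
  have h : ν.colLen 0 ≤ N := by
    by_contra h
    exact h0 (by simp [multivariate, h])
  have h1 := congrArg totalDegree (vdm_mul_multivariate (fun n => Polynomial.X ^ n) h)
  rw [totalDegree_mul_of_isDomain (vdm_ne_zero N) h0, vdm_totalDegree] at h1
  have h2 : (alternant (fun n => Polynomial.X ^ n) ν N).totalDegree ≤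
      ∑ i : Fin N, (ν.rowLen i + (N - 1 - i)) := by
    unfold alternant
    rw [← Matrix.det_transpose, Matrix.det_apply]
    refine totalDegree_finsetSum_le fun σ _ => ?_
    rw [Units.smul_def]
    refine (totalDegree_smul_le _ _).trans ((totalDegree_finsetProd _ _).trans ?_)
    refine Finset.sum_le_sum fun i _ => ?_
    simp
  have h3 := sum_rowLen_le ν N
  rw [Finset.sum_add_distrib] at h2
  omega

/-- The Schur symmetric function `S_ν = lim S_{ν|N}`. -/
noncomputable def schur (ν : YoungDiagram) : Sym :=
  ⟨fun N => multivariate (fun n => Polynomial.X ^ n) ν N, fun N => multivariate_isSymmetric _ ν N,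
    killLast_schur ν, ν.card, schur_totalDegree_le ν⟩

/-! ### Frobenius–Schur functions -/

/-- The shifted Schur polynomial
`S*_{ν|N}(y_1, …, y_N) = Sᶠ_{ν|N}(y_1 + N - 1, y_2 + N - 2, …, y_N)`, where `Sᶠ_{ν|N}` is the
factorial Schur polynomial, attached to the falling factorials `x (x - 1) ⋯ (x - n + 1)`. -/
noncomputable def shiftedSchur (ν : YoungDiagram) (N : ℕ) : MvPolynomial (Fin N) ℂ :=
  aeval (fun i : Fin N => (X i + C ((N - 1 - i : ℕ) : ℂ) : MvPolynomial (Fin N) ℂ))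
    (multivariate (fun n => descPochhammer ℂ n) ν N)

/-- The shifted power sum `p*_k(y_1, …, y_N) = ∑_{i=1}^N [(y_i - i + 1/2)^k - (-i + 1/2)^k]`
with `k` replaced by `k + 1` (and `i` counted from `0` in the code). -/
noncomputable def shiftedPowerSum (k : ℕ) (N : ℕ) : MvPolynomial (Fin N) ℂ :=
  ∑ i : Fin N, ((X i + C (-((i : ℕ) + 1 : ℂ) + 1 / 2)) ^ (k + 1)
    - C ((-((i : ℕ) + 1 : ℂ) + 1 / 2) ^ (k + 1)))

/-- `G = (G_N)` and `F` correspond to each other under the algebra isomorphism from shifted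
symmetric functions to symmetric functions which takes `p*_k` to `p_k` for all `k ≥ 1`: some
polynomial expression `P` in the `p*_k` is equal to `G` and the same expression in the `p_k` is
equal to `F`. -/
def Corresponds (G : ∀ N : ℕ, MvPolynomial (Fin N) ℂ) (F : Sym) : Prop :=
  ∃ P : MvPolynomial ℕ ℂ, aeval shiftedPowerSum P = G ∧ aeval powerSum P = F

/-- The Frobenius–Schur function `FS_ν`: the image of the shifted Schur function `S*_ν` under the
isomorphism taking `p*_k` to `p_k`. (Exactly one `F` corresponds to `S*_ν`, because the algebra of
shifted symmetric functions is freely generated by the `p*_k`.) -/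
noncomputable def frobeniusSchur (ν : YoungDiagram) : Sym :=
  Classical.epsilon fun F : Sym => Corresponds (shiftedSchur ν) F

/-! ### Laguerre and Meixner symmetric functions -/

instance : DecidableEq YoungDiagram := fun μ ν =>
  decidable_of_iff (μ.cells = ν.cells) YoungDiagram.ext_iff.symm

theorem finite_subdiagrams (ν : YoungDiagram) : {μ : YoungDiagram | μ ≤ ν}.Finite := by
  refine Set.Finite.of_finite_image (f := YoungDiagram.cells)
    ((ν.cells.powerset.finite_toSet).subset ?_) fun a _ b _ h => YoungDiagram.ext h
  rintro _ ⟨μ, hμ, rfl⟩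
  simpa using YoungDiagram.cells_subset_iff.2 hμ

/-- The finite set of all diagrams `μ ⊆ ν`. -/
noncomputable def subdiagrams (ν : YoungDiagram) : Finset YoungDiagram :=
  (finite_subdiagrams ν).toFinset

/-- The boxes of the skew diagram `ν/μ`; a box is a pair (row, column). -/
def skewCells (ν μ : YoungDiagram) : Finset (ℕ × ℕ) := ν.cells \ μ.cells

/-- A filling of the skew diagram `ν/μ` by `0, 1, …, n - 1`, each used once, is a standard tableau
if the entries strictly increase along the rows and down the columns. -/
def IsStandardTableau {ν μ : YoungDiagram}
    (T : skewCells ν μ ≃ Fin (skewCells ν μ).card) : Prop :=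
  (∀ a b : skewCells ν μ, a.1.1 = b.1.1 → a.1.2 < b.1.2 → T a < T b) ∧
  (∀ a b : skewCells ν μ, a.1.2 = b.1.2 → a.1.1 < b.1.1 → T a < T b)

/-- `dim ν/μ`, the number of standard tableaux of skew shape `ν/μ`. -/
noncomputable def skewDim (ν μ : YoungDiagram) : ℕ :=
  Nat.card {T : skewCells ν μ ≃ Fin (skewCells ν μ).card // IsStandardTableau T}

/-- The generalized Pochhammer symbol `(z)_{ν/μ} = ∏ (z + c(□))` over the boxes `□` of `ν/μ`,
where the content `c(□)` is the column number minus the row number. -/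
def skewPoch (z : ℂ) (ν μ : YoungDiagram) : ℂ :=
  ∏ c ∈ skewCells ν μ, (z + ((c.2 : ℂ) - (c.1 : ℂ)))

/-- `(z)_ν = (z)_{ν/∅}`. -/
def poch (z : ℂ) (ν : YoungDiagram) : ℂ := skewPoch z ν ⊥

/-- The Laguerre symmetric function with index `ν` and parameters `(z, z')`. -/
noncomputable def laguerre (z z' : ℂ) (ν : YoungDiagram) : Sym :=
  ∑ μ ∈ subdiagrams ν,
    ((-1) ^ (skewCells ν μ).card * ((skewDim ν μ : ℂ) / ((skewCells ν μ).card.factorial : ℂ)) *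
      (skewPoch z ν μ * skewPoch z' ν μ)) • schur μ

/-- The Meixner symmetric function with index `ν` and parameters `(z, z', ξ)`, `ξ ≠ 1`. -/
noncomputable def meixner (z z' ξ : ℂ) (ν : YoungDiagram) : Sym :=
  ∑ μ ∈ subdiagrams ν,
    ((-1) ^ (skewCells ν μ).card * (ξ / (1 - ξ)) ^ (skewCells ν μ).card *
      ((skewDim ν μ : ℂ) / ((skewCells ν μ).card.factorial : ℂ)) *
      (skewPoch z ν μ * skewPoch z' ν μ)) • frobeniusSchur μ

/-- `φ` is the formal moment functional of the family `(B_ν)`: the linear functional with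
`φ(B_ν) = 1` for `ν = ∅` and `φ(B_ν) = 0` otherwise. -/
def IsMomentFunctional (B : YoungDiagram → Sym) (φ : Sym →ₗ[ℂ] ℂ) : Prop :=
  ∀ ν : YoungDiagram, φ (B ν) = if ν = ⊥ then 1 else 0

end SymFun

/-! Both families have the form `∑ c_t(ν,μ) B_μ`, where `c_t` is `expansionCoeff`: `B` is the Schur
basis with `t = 1`, or the Frobenius–Schur basis with `t = ξ/(1-ξ)`. By the branching rule for `dim
ν/μ`, differentiating in `t` removes a corner of `ν` with weight `-(z+c)(z'+c)`, `c` being its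
content. So the expansion is `exp(-tD) B_ν`, with `D` the weighted corner-removal operator.

Put `z = N` and `z' = N+b-1` and specialize to `N` variables. Then `B_ν` becomes a ratio of
alternants in `φ_n = x^n`, or in the falling factorials. For row exponent `n = ν_i+N-i` the corner
weight is `n(n-1+b)`, so `D` is the row-by-row action of the univariate operator `φ_n ↦ n(n-1+b)
φ_{n-1}`. Hence the expansion becomes a ratio of alternants in `P_n = exp(-tD) φ_n`, the monic
Laguerre or Meixner polynomials (`sum_expansionCoeff_smul_multivariate`). These are orthogonal for
an explicit functional `ψ` (`functional_lowered_mul_lowered`), and multiplying out two determinants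
makes the multivariate polynomials orthogonal for `V_N²` times the tensor power of `ψ`
(`tensorFunctional_alternant_mul`). The ratio for the empty diagram is `1`, so the normalized
functional, pulled back to `Sym`, is the moment functional. Its norms come from removing boxes one
at a time (`prod_normSq_beads`).

For a fixed pair of diagrams both sides of the orthogonality relation are polynomials in `(z, z')`.
The points `z = N`, `z' = n + 1/2` form a product of infinite sets, where `b` is a half-integer and
all norms needed for normalization are nonzero; so the identity holds everywhere (`moment_mul`). The
case `t = 0` is separate.

The Meixner case also needs the `FS_ν` to be a basis, and an algebra homomorphism from `Sym` to
`N`-variable polynomials taking them to factorial Schur polynomials. Both follow from `p_k` and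
`p*_k` being free generators, and from `FS_ν` and `S_ν` agreeing in top degree
(`exists_corresponds`, `exists_algHom_frobeniusSchur`). -/

namespace SymFun

open MvPolynomial

/-! ### Standard fillings and the branching rule for skew dimensions -/

/-- Standard fillings of a finite set of boxes, encoded as functions vanishing outside it. -/
def standardFillings (S : Finset (ℕ × ℕ)) : Set (ℕ × ℕ → ℕ) :=
  {f | Set.BijOn f S (Finset.range S.card) ∧ (∀ a ∉ S, f a = 0) ∧
    (∀ a ∈ S, ∀ b ∈ S, a.1 = b.1 → a.2 < b.2 → f a < f b) ∧
    (∀ a ∈ S, ∀ b ∈ S, a.2 = b.2 → a.1 < b.1 → f a < f b)}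

/-- The boxes of `S` that are last in their row and in their column. -/
def outerBoxes (S : Finset (ℕ × ℕ)) : Finset (ℕ × ℕ) :=
  S.filter fun c => ∀ a ∈ S, (a.1 = c.1 → a.2 ≤ c.2) ∧ (a.2 = c.2 → a.1 ≤ c.1)

/-- Extending tableaux by zero puts the fillings of all shapes into one function type, so that
erasing a box needs no transport between subtypes. -/
theorem skewDim_eq_card_standardFillings (ν μ : YoungDiagram) :
    skewDim ν μ = Nat.card (standardFillings (skewCells ν μ)) := by
  refine Nat.card_congr (Equiv.ofBijective (fun T => ⟨fun x => if h : x ∈ skewCells ν μ then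
    (T.1 ⟨x, h⟩ : ℕ) else 0, ⟨?_, ?_, ?_⟩, ?_, ?_, ?_⟩) ⟨?_, ?_⟩)
  · intro x hx
    simp only [Finset.mem_coe] at hx
    simp [hx]
  · intro x hx y hy hxy
    simp only [Finset.mem_coe] at hx hy
    simp only [hx, hy, dif_pos] at hxy
    simpa using T.1.injective (Fin.ext hxy)
  · intro k hk
    simp only [Finset.coe_range, Set.mem_Iio] at hk
    refine ⟨(T.1.symm ⟨k, hk⟩).1, (T.1.symm ⟨k, hk⟩).2, ?_⟩
    simp
  · intro a ha
    simp [ha]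
  · intro a ha b hb h1 h2
    simpa [ha, hb] using T.2.1 ⟨a, ha⟩ ⟨b, hb⟩ h1 h2
  · intro a ha b hb h1 h2
    simpa [ha, hb] using T.2.2 ⟨a, ha⟩ ⟨b, hb⟩ h1 h2
  · intro T T' h
    ext x
    have := congrFun (congrArg Subtype.val h) x.1
    simpa using this
  · rintro ⟨f, h1, h2, h3, h4⟩
    refine ⟨⟨Equiv.ofBijective (fun x => ⟨f x.1, by simpa using h1.mapsTo x.2⟩) ⟨?_, ?_⟩,
      ?_, ?_⟩, ?_⟩
    · intro x y hxy
      exact Subtype.ext (h1.injOn x.2 y.2 (by simpa using hxy))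
    · intro k
      obtain ⟨x, hx, hk⟩ := h1.surjOn (show (k : ℕ) ∈ _ by simp)
      exact ⟨⟨x, hx⟩, Fin.ext hk⟩
    · intro a b h h'
      exact h3 a a.2 b b.2 h h'
    · intro a b h h'
      exact h4 a a.2 b b.2 h h'
    · ext x
      by_cases hx : x ∈ skewCells ν μ
      · simp only [hx, dif_pos]
        rfl
      · simp [hx, h2 x hx]

theorem finite_standardFillings (S : Finset (ℕ × ℕ)) : Finite (standardFillings S) := by
  refine Finite.of_injective (β := S → Fin S.card)
    (fun f x => ⟨f.1 x.1, by simpa using f.2.1.mapsTo x.2⟩) ?_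
  rintro ⟨f, hf⟩ ⟨g, hg⟩ h
  ext x
  by_cases hx : x ∈ S
  · simpa using congrFun h ⟨x, hx⟩
  · simp [hf.2.1 x hx, hg.2.1 x hx]

theorem update_mem_standardFillings {S : Finset (ℕ × ℕ)} {c : ℕ × ℕ} (hc : c ∈ outerBoxes S)
    {f : ℕ × ℕ → ℕ} (hf : f ∈ standardFillings (S.erase c)) :
    Function.update f c (S.card - 1) ∈ standardFillings S := by
  obtain ⟨hcS, hc⟩ := Finset.mem_filter.1 hc
  obtain ⟨h1, h2, h3, h4⟩ := hf
  rw [Finset.card_erase_of_mem hcS] at h1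
  have hpos : 0 < S.card := Finset.card_pos.2 ⟨c, hcS⟩
  have hlt : ∀ a ∈ S, a ≠ c → f a < S.card - 1 := fun a ha hac => by
    simpa using h1.mapsTo (show a ∈ (S.erase c : Finset _) by simp [ha, hac])
  refine ⟨⟨?_, ?_, ?_⟩, ?_, ?_, ?_⟩
  · intro a ha
    by_cases hac : a = c
    · subst hac; simp [hpos]
    · have := hlt a ha hac
      simp [hac]; omega
  · intro a ha b hb hab
    by_cases hac : a = c <;> by_cases hbc : b = c
    · rw [hac, hbc]
    · have := hlt b hb hbc
      simp [hac, hbc] at hab; omega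
    · have := hlt a ha hac
      simp [hac, hbc] at hab; omega
    · simp [hac, hbc] at hab
      exact h1.injOn (by simp at ha; simp [ha, hac]) (by simp at hb; simp [hb, hbc]) hab
  · intro k hk
    simp only [Finset.coe_range, Set.mem_Iio] at hk
    by_cases hk' : k = S.card - 1
    · exact ⟨c, hcS, by simp [hk']⟩
    · obtain ⟨a, ha, hak⟩ := h1.surjOn (show k ∈ _ by simp; omega)
      simp at ha
      exact ⟨a, ha.1, by simp [ha.2, hak]⟩
  · intro a ha
    have : a ≠ c := by rintro rfl; exact ha hcS
    simp [this, h2 a (by simp [ha])]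
  · intro a ha b hb hab hab'
    by_cases hac : a = c
    · subst hac
      have := (hc b hb).1 hab.symm
      omega
    · by_cases hbc : b = c
      · have := hlt a ha hac
        simp [hac, hbc]; omega
      · simp [hac, hbc]
        exact h3 a (by simp [ha, hac]) b (by simp [hb, hbc]) hab hab'
  · intro a ha b hb hab hab'
    by_cases hac : a = c
    · subst hac
      have := (hc b hb).2 hab.symm
      omega
    · by_cases hbc : b = c
      · have := hlt a ha hac
        simp [hac, hbc]; omega
      · simp [hac, hbc]
        exact h4 a (by simp [ha, hac]) b (by simp [hb, hbc]) hab hab'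

/-- The largest entry must sit in a box that is last in its row and column. Erasing it leaves a
standard filling of the other boxes, and `Function.update` inverts this. No convexity of `S` is
needed. -/
theorem card_standardFillings {S : Finset (ℕ × ℕ)} (hS : S.Nonempty) :
    Nat.card (standardFillings S) =
      ∑ c ∈ outerBoxes S, Nat.card (standardFillings (S.erase c)) := by
  have : ∀ S, Finite (standardFillings S) := finite_standardFillings
  rw [← Finset.sum_coe_sort, ← Nat.card_sigma]
  have hpos := Finset.card_pos.2 hS
  refine (Nat.card_congr (Equiv.ofBijective (fun p => ⟨Function.update p.2.1 p.1 (S.card - 1),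
    update_mem_standardFillings p.1.2 p.2.2⟩) ⟨?_, ?_⟩)).symm
  · rintro ⟨⟨c, hc⟩, ⟨f, hf⟩⟩ ⟨⟨d, hd⟩, ⟨g, hg⟩⟩ h
    simp only [Subtype.mk.injEq] at h
    have hcS := (Finset.mem_filter.1 hc).1
    have hdS := (Finset.mem_filter.1 hd).1
    -- If `c ≠ d`, the right-hand filling has an entry below `S.card - 1` at `c`, where the
    -- left-hand one has exactly that value.
    have hcd : c = d := by
      by_contra hcd
      have h1 := congrFun h c
      have h2 := hg.1.mapsTo (show c ∈ (S.erase d : Finset _) by simp [hcS, hcd])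
      simp [hcd, Finset.card_erase_of_mem hdS] at h1 h2
      omega
    subst hcd
    have : f = g := by
      ext x
      by_cases hx : x = c
      · rw [hx, hf.2.1 c (by simp), hg.2.1 c (by simp)]
      · simpa [hx] using congrFun h x
    subst this
    rfl
  · rintro ⟨f, h1, h2, h3, h4⟩
    obtain ⟨c, hcS, hc⟩ := h1.surjOn (show S.card - 1 ∈ _ by simpa using hpos)
    have hle : ∀ a ∈ S, f a ≤ S.card - 1 := fun a ha => by
      have : f a < S.card := by simpa using h1.mapsTo ha
      omega
    have hlt : ∀ a ∈ S, a ≠ c → f a < S.card - 1 := fun a ha hac =>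
      lt_of_le_of_ne (hle a ha) fun h => hac (h1.injOn ha hcS (h.trans hc.symm))
    have hco : c ∈ outerBoxes S := by
      refine Finset.mem_filter.2 ⟨hcS, fun a ha => ⟨fun h => ?_, fun h => ?_⟩⟩
      · by_contra! h'
        have := h3 c hcS a ha h.symm h'
        have := hle a ha
        omega
      · by_contra! h'
        have := h4 c hcS a ha h.symm h'
        have := hle a ha
        omega
    refine ⟨⟨⟨c, hco⟩, ⟨Function.update f c 0, ⟨?_, ?_, ?_⟩, ?_, ?_, ?_⟩⟩, ?_⟩
    · intro a ha
      simp at ha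
      simpa [ha.2, Finset.card_erase_of_mem hcS] using hlt a ha.1 ha.2
    · intro a ha b hb hab
      simp at ha hb
      simp [ha.2, hb.2] at hab
      exact h1.injOn ha.1 hb.1 hab
    · intro k hk
      simp [Finset.card_erase_of_mem hcS] at hk
      obtain ⟨a, ha, hak⟩ := h1.surjOn (show k ∈ _ by simp; omega)
      have hac : a ≠ c := by rintro rfl; omega
      exact ⟨a, by simp at ha; simp [hac, ha], by simp [hac, hak]⟩
    · intro a ha
      by_cases hac : a = c
      · simp [hac]
      · simp [hac] at ha
        simp [hac, h2 a ha]
    · intro a ha b hb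
      simp at ha hb
      simpa [ha.1, hb.1] using h3 a ha.2 b hb.2
    · intro a ha b hb
      simp at ha hb
      simpa [ha.1, hb.1] using h4 a ha.2 b hb.2
    · ext x
      by_cases hx : x = c
      · simp [hx, hc]
      · simp [hx]

theorem skewDim_self (ν : YoungDiagram) : skewDim ν ν = 1 := by
  rw [skewDim_eq_card_standardFillings]
  have : skewCells ν ν = ∅ := by simp [skewCells]
  rw [this, Nat.card_eq_one_iff_unique]
  refine ⟨⟨?_⟩, ⟨⟨0, ?_⟩⟩⟩
  · rintro ⟨f, hf⟩ ⟨g, hg⟩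
    ext x
    simp [hf.2.1 x (by simp), hg.2.1 x (by simp)]
  · simp [standardFillings]

/-! ### Removing corners -/

/-- The rows of `ν` whose last box can be removed. -/
def cornerRows (ν : YoungDiagram) : Finset ℕ :=
  (Finset.range (ν.colLen 0)).filter fun i => ν.rowLen (i + 1) < ν.rowLen i

theorem mem_cornerRows {ν : YoungDiagram} {i : ℕ} :
    i ∈ cornerRows ν ↔ ν.rowLen (i + 1) < ν.rowLen i := by
  rw [cornerRows, Finset.mem_filter, Finset.mem_range, and_iff_right_iff_imp]
  intro h
  rw [← ν.mem_iff_lt_colLen, ν.mem_iff_lt_rowLen]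
  omega

/-- The diagram obtained from `ν` by removing the last box of row `i`, if that is a corner. -/
def removeCorner (ν : YoungDiagram) (i : ℕ) : YoungDiagram :=
  if h : ν.rowLen (i + 1) < ν.rowLen i then
    { cells := ν.cells.erase (i, ν.rowLen i - 1)
      isLowerSet := by
        rintro ⟨a, b⟩ ⟨c, d⟩ hcd hab
        have hcd1 : c ≤ a := hcd.1
        have hcd2 : d ≤ b := hcd.2
        simp only [Finset.coe_erase, Set.mem_sdiff, Finset.mem_coe, YoungDiagram.mem_cells,
          Set.mem_singleton_iff, Prod.mk.injEq, YoungDiagram.mem_iff_lt_rowLen] at hab ⊢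
        have h1 := ν.rowLen_anti c a hcd1
        refine ⟨by omega, ?_⟩
        rintro ⟨rfl, rfl⟩
        rcases hcd1.eq_or_lt with h2 | h2
        · subst h2
          omega
        · have h3 := ν.rowLen_anti (c + 1) a h2
          omega }
  else ν

theorem cells_removeCorner {ν : YoungDiagram} {i : ℕ} (h : i ∈ cornerRows ν) :
    (removeCorner ν i).cells = ν.cells.erase (i, ν.rowLen i - 1) := by
  rw [removeCorner, dif_pos (mem_cornerRows.1 h)]

theorem mem_of_mem_cornerRows {ν : YoungDiagram} {i : ℕ} (h : i ∈ cornerRows ν) :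
    (i, ν.rowLen i - 1) ∈ ν := by
  rw [ν.mem_iff_lt_rowLen]
  have := mem_cornerRows.1 h
  omega

theorem card_removeCorner {ν : YoungDiagram} {i : ℕ} (h : i ∈ cornerRows ν) :
    (removeCorner ν i).card + 1 = ν.card := by
  rw [YoungDiagram.card, cells_removeCorner h]
  exact Finset.card_erase_add_one (mem_of_mem_cornerRows h)

theorem rowLen_removeCorner {ν : YoungDiagram} {i : ℕ} (h : i ∈ cornerRows ν) (j : ℕ) :
    (removeCorner ν i).rowLen j = if j = i then ν.rowLen i - 1 else ν.rowLen j := by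
  have h1 : ∀ k, k < (removeCorner ν i).rowLen j ↔ k < if j = i then ν.rowLen i - 1
      else ν.rowLen j := by
    intro k
    rw [← YoungDiagram.mem_iff_lt_rowLen, ← YoungDiagram.mem_cells, cells_removeCorner h,
      Finset.mem_erase, YoungDiagram.mem_cells, YoungDiagram.mem_iff_lt_rowLen]
    have := mem_cornerRows.1 h
    split_ifs with hj
    · subst hj
      simp
      omega
    · simp [hj]
  exact eq_of_forall_lt_iff h1

theorem le_iff_rowLen_le {μ ν : YoungDiagram} : μ ≤ ν ↔ ∀ i, μ.rowLen i ≤ ν.rowLen i := by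
  constructor
  · intro h i
    by_contra! h'
    have h1 : (i, ν.rowLen i) ∈ μ := YoungDiagram.mem_iff_lt_rowLen.2 h'
    have h2 : (i, ν.rowLen i) ∈ ν := h h1
    simp [YoungDiagram.mem_iff_lt_rowLen] at h2
  · rintro h ⟨i, j⟩ hij
    exact YoungDiagram.mem_iff_lt_rowLen.2 ((YoungDiagram.mem_iff_lt_rowLen.1 hij).trans_le (h i))

theorem eq_of_rowLen_eq {μ ν : YoungDiagram} (h : ∀ i, μ.rowLen i = ν.rowLen i) : μ = ν :=
  le_antisymm (le_iff_rowLen_le.2 fun i => (h i).le) (le_iff_rowLen_le.2 fun i => (h i).ge)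

theorem le_removeCorner_iff {μ ν : YoungDiagram} {i : ℕ} (h : i ∈ cornerRows ν) :
    μ ≤ removeCorner ν i ↔ μ ≤ ν ∧ μ.rowLen i < ν.rowLen i := by
  have := mem_cornerRows.1 h
  simp only [le_iff_rowLen_le, rowLen_removeCorner h]
  constructor
  · intro h1
    have h2 := h1 i
    rw [if_pos rfl] at h2
    refine ⟨fun j => ?_, by omega⟩
    have h3 := h1 j
    split_ifs at h3 with hj
    · subst hj; omega
    · exact h3
  · rintro ⟨h1, h2⟩ j
    split_ifs with hj
    · subst hj; omega
    · exact h1 j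

theorem mem_subdiagrams {μ ν : YoungDiagram} : μ ∈ subdiagrams ν ↔ μ ≤ ν := by
  simp [subdiagrams]

theorem card_skewCells {μ ν : YoungDiagram} (h : μ ≤ ν) :
    (skewCells ν μ).card + μ.card = ν.card :=
  Finset.card_sdiff_add_card_eq_card (YoungDiagram.cells_subset_iff.2 h)

theorem skewCells_removeCorner {μ ν : YoungDiagram} {i : ℕ} (h : i ∈ cornerRows ν) :
    skewCells (removeCorner ν i) μ = (skewCells ν μ).erase (i, ν.rowLen i - 1) := by
  rw [skewCells, skewCells, cells_removeCorner h, Finset.erase_sdiff_comm]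

theorem corner_mem_skewCells {μ ν : YoungDiagram} {i : ℕ} (h : i ∈ cornerRows ν)
    (h' : μ ≤ removeCorner ν i) : (i, ν.rowLen i - 1) ∈ skewCells ν μ := by
  rw [skewCells, Finset.mem_sdiff, YoungDiagram.mem_cells, YoungDiagram.mem_cells]
  refine ⟨mem_of_mem_cornerRows h, ?_⟩
  rw [YoungDiagram.mem_iff_lt_rowLen]
  have := ((le_removeCorner_iff h).1 h').2
  omega

-- If `(i, j)` lies in `ν/μ`, a neighbour to the right or below can be missing only by leaving `ν`,
-- since row lengths of `μ` decrease. So the outer boxes are the corners of `ν` not in `μ`.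
open scoped Classical in
theorem outerBoxes_skewCells {μ ν : YoungDiagram} (hμ : μ ≤ ν) :
    outerBoxes (skewCells ν μ) = ((cornerRows ν).filter fun i => μ ≤ removeCorner ν i).image
      fun i => (i, ν.rowLen i - 1) := by
  ext ⟨i, j⟩
  simp only [outerBoxes, Finset.mem_filter, Finset.mem_image, Prod.mk.injEq]
  have key : ∀ a b, (a, b) ∈ skewCells ν μ ↔ b < ν.rowLen a ∧ μ.rowLen a ≤ b := fun a b => by
    simp [skewCells, YoungDiagram.mem_iff_lt_rowLen]
  constructor
  · rintro ⟨h1, h2⟩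
    rw [key] at h1
    have h3 : ν.rowLen (i + 1) ≤ j := by
      by_contra! h
      have := (h2 (i + 1, j) ((key _ _).2 ⟨h, (μ.rowLen_anti i (i + 1) (by omega)).trans h1.2⟩)).2
        rfl
      simp at this
    have h4 : ν.rowLen i ≤ j + 1 := by
      by_contra! h
      have := (h2 (i, j + 1) ((key _ _).2 ⟨h, by omega⟩)).1 rfl
      simp at this
    have hi : i ∈ cornerRows ν := mem_cornerRows.2 (by omega)
    exact ⟨i, ⟨hi, (le_removeCorner_iff hi).2 ⟨hμ, by omega⟩⟩, rfl, by omega⟩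
  · rintro ⟨i, ⟨hi, h⟩, rfl, rfl⟩
    have h1 := ((le_removeCorner_iff hi).1 h).2
    have h2 := mem_cornerRows.1 hi
    refine ⟨(key _ _).2 ⟨by omega, by omega⟩, ?_⟩
    rintro ⟨a, b⟩ hab
    rw [key] at hab
    refine ⟨fun h => ?_, fun h => ?_⟩
    · simp only at h; subst h; simp only; omega
    · simp only at h ⊢
      by_contra! h'
      have := ν.rowLen_anti (i + 1) a h'
      omega

open scoped Classical in
/-- The branching rule for the number of standard tableaux. -/
theorem skewDim_eq_sum {μ ν : YoungDiagram} (h : μ ≤ ν) (hne : μ ≠ ν) :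
    skewDim ν μ = ∑ i ∈ (cornerRows ν).filter (fun i => μ ≤ removeCorner ν i),
      skewDim (removeCorner ν i) μ := by
  have hS : (skewCells ν μ).Nonempty := by
    have h1 := YoungDiagram.cells_ssubset_iff.2 (lt_of_le_of_ne h hne)
    exact Finset.sdiff_nonempty.2 h1.2
  rw [skewDim_eq_card_standardFillings, card_standardFillings hS, outerBoxes_skewCells h,
    Finset.sum_image]
  · refine Finset.sum_congr rfl fun i hi => ?_
    rw [skewDim_eq_card_standardFillings, skewCells_removeCorner (Finset.mem_filter.1 hi).1]
  · intro i _ j _ hij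
    exact (Prod.mk.inj hij).1

theorem skewPoch_removeCorner {μ ν : YoungDiagram} {i : ℕ} (h : i ∈ cornerRows ν)
    (h' : μ ≤ removeCorner ν i) (z : ℂ) :
    skewPoch z ν μ = (z + (ν.rowLen i - 1 - i)) * skewPoch z (removeCorner ν i) μ := by
  rw [skewPoch, skewPoch, skewCells_removeCorner h,
    ← Finset.mul_prod_erase _ _ (corner_mem_skewCells h h')]
  have := mem_cornerRows.1 h
  rw [Nat.cast_sub (by omega)]
  simp

theorem skewPoch_self (z : ℂ) (ν : YoungDiagram) : skewPoch z ν ν = 1 := by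
  simp [skewPoch, skewCells]

/-! ### Expansion of determinants of lowered polynomials -/

/-- The coefficient of the Laguerre and Meixner functions, with `t = 1` and `t = ξ / (1 - ξ)`. -/
noncomputable def expansionCoeff (z z' t : ℂ) (ν μ : YoungDiagram) : ℂ :=
  (-t) ^ (skewCells ν μ).card * ((skewDim ν μ : ℂ) / ((skewCells ν μ).card.factorial : ℂ)) *
    (skewPoch z ν μ * skewPoch z' ν μ)

theorem expansionCoeff_self (z z' t : ℂ) (ν : YoungDiagram) :
    expansionCoeff z z' t ν ν = 1 := by
  have : skewCells ν ν = ∅ := by simp [skewCells]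
  simp [expansionCoeff, skewDim_self, skewPoch_self, this]

/-- The value at the content of the last box of row `i` of the polynomial `(z + c) (z' + c)`. -/
noncomputable def cornerWeight (z z' : ℂ) (ν : YoungDiagram) (i : ℕ) : ℂ :=
  (z + (ν.rowLen i - 1 - i)) * (z' + (ν.rowLen i - 1 - i))

-- Differentiating `(-t)^(k+1)/(k+1)!` gives `-(-t)^k/k!`. The branching rule splits the dimension
-- over corners, and each corner takes its content factors out of the two Pochhammer products.
open scoped Classical in
theorem hasDerivAt_expansionCoeff (z z' t : ℂ) {μ ν : YoungDiagram} (h : μ ≤ ν) :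
    HasDerivAt (fun t => expansionCoeff z z' t ν μ)
      (-∑ i ∈ (cornerRows ν).filter (fun i => μ ≤ removeCorner ν i),
        cornerWeight z z' ν i * expansionCoeff z z' t (removeCorner ν i) μ) t := by
  by_cases hne : μ = ν
  · subst hne
    simp only [expansionCoeff_self]
    rw [Finset.filter_false_of_mem, Finset.sum_empty, neg_zero]
    · exact hasDerivAt_const _ _
    · intro i hi h'
      have := ((le_removeCorner_iff hi).1 h').2
      omega
  · obtain ⟨k, hk⟩ : ∃ k, (skewCells ν μ).card = k + 1 := by
      refine Nat.exists_eq_succ_of_ne_zero (Finset.card_ne_zero.2 ?_)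
      exact Finset.sdiff_nonempty.2 (YoungDiagram.cells_ssubset_iff.2 (lt_of_le_of_ne h hne)).2
    have h1 : HasDerivAt (fun t : ℂ => (-t) ^ (k + 1)) (-((k + 1 : ℕ) * (-t) ^ k)) t := by
      simpa using (hasDerivAt_neg t).fun_pow (k + 1)
    simp only [expansionCoeff, hk, mul_assoc]
    refine (h1.mul_const _).congr_deriv ?_
    symm
    rw [skewDim_eq_sum h hne, neg_mul, neg_inj]
    push_cast
    rw [Finset.sum_div, Finset.sum_mul, Finset.mul_sum]
    refine Finset.sum_congr rfl fun i hi => ?_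
    obtain ⟨hi, hi'⟩ := Finset.mem_filter.1 hi
    have hk' : (skewCells (removeCorner ν i) μ).card = k := by
      rw [skewCells_removeCorner hi, Finset.card_erase_of_mem (corner_mem_skewCells hi hi'), hk]
      simp
    rw [hk', skewPoch_removeCorner hi hi', skewPoch_removeCorner hi hi', Nat.factorial_succ,
      cornerWeight]
    have : (k + 1 : ℂ) ≠ 0 := by exact_mod_cast Nat.succ_ne_zero k
    have : (k.factorial : ℂ) ≠ 0 := by exact_mod_cast k.factorial_ne_zero
    push_cast
    field_simp

/-- This is the differential system over diagrams that the expansion satisfies;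
`sum_expansionCoeff_zero` supplies its initial value. The coefficients `a` are arbitrary and later
become values of alternants. -/
theorem hasDerivAt_sum_expansionCoeff (z z' t : ℂ) (ν : YoungDiagram) (a : YoungDiagram → ℂ) :
    HasDerivAt (fun t => ∑ μ ∈ subdiagrams ν, expansionCoeff z z' t ν μ * a μ)
      (-∑ i ∈ cornerRows ν, cornerWeight z z' ν i * ∑ μ ∈ subdiagrams (removeCorner ν i),
        expansionCoeff z z' t (removeCorner ν i) μ * a μ) t := by
  classical
  have h1 := HasDerivAt.fun_sum fun μ (hμ : μ ∈ subdiagrams ν) =>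
    (hasDerivAt_expansionCoeff z z' t (mem_subdiagrams.1 hμ)).mul_const (a μ)
  refine h1.congr_deriv ?_
  symm
  simp only [neg_mul, Finset.sum_neg_distrib, neg_inj, Finset.mul_sum, Finset.sum_mul]
  simp only [← mul_assoc]
  rw [Finset.sum_comm' (s' := fun μ => (cornerRows ν).filter fun i => μ ≤ removeCorner ν i)
    (t' := subdiagrams ν)]
  intro i μ
  simp only [mem_subdiagrams, Finset.mem_filter]
  constructor
  · rintro ⟨hi, h⟩
    exact ⟨⟨hi, h⟩, ((le_removeCorner_iff hi).1 h).1⟩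
  · rintro ⟨⟨hi, h⟩, _⟩
    exact ⟨hi, h⟩

theorem sum_expansionCoeff_zero (z z' : ℂ) (ν : YoungDiagram) (a : YoungDiagram → ℂ) :
    ∑ μ ∈ subdiagrams ν, expansionCoeff z z' 0 ν μ * a μ = a ν := by
  rw [Finset.sum_eq_single ν, expansionCoeff_self, one_mul]
  · intro μ hμ hne
    have : (skewCells ν μ).card ≠ 0 := Finset.card_ne_zero.2 (Finset.sdiff_nonempty.2
      (YoungDiagram.cells_ssubset_iff.2 (lt_of_le_of_ne (mem_subdiagrams.1 hμ) hne)).2)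
    simp [expansionCoeff, this]
  · intro h
    exact absurd (mem_subdiagrams.2 le_rfl) h

/-- The polynomial `exp(-t D) φ_n`, where `D` takes `φ_n` to `n (n - 1 + b) φ_{n-1}`. -/
noncomputable def lowered (φ : ℕ → Polynomial ℂ) (b t : ℂ) (n : ℕ) : Polynomial ℂ :=
  ∑ m ∈ Finset.range (n + 1),
    ((-t) ^ (n - m) * n.choose m * (ascPochhammer ℂ (n - m)).eval (b + m)) • φ m

theorem lowered_zero_right (φ : ℕ → Polynomial ℂ) (b : ℂ) (n : ℕ) : lowered φ b 0 n = φ n := by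
  rw [lowered, Finset.sum_range_succ, Finset.sum_eq_zero]
  · simp
  · intro m hm
    have : n - m ≠ 0 := by simp at hm; omega
    simp [this]

/-- The univariate analogue of the corner-removal equation rests on `(n+1 choose m)(n+1-m) = (n
choose m)(n+1)`. The truncated `n - 1` at `n = 0` is harmless because its factor `n` vanishes. -/
theorem hasDerivAt_eval_lowered (φ : ℕ → Polynomial ℂ) (b t x : ℂ) (n : ℕ) :
    HasDerivAt (fun t => (lowered φ b t n).eval x)
      (-(n * (n - 1 + b)) * (lowered φ b t (n - 1)).eval x) t := by
  simp only [lowered, Polynomial.eval_finsetSum, Polynomial.eval_smul, smul_eq_mul]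
  cases n with
  | zero => simpa using hasDerivAt_const t _
  | succ n =>
    have h1 := HasDerivAt.fun_sum fun m (_ : m ∈ Finset.range (n + 1 + 1)) =>
      ((((hasDerivAt_neg t).fun_pow (n + 1 - m)).mul_const ((n + 1).choose m : ℂ)).mul_const
        ((ascPochhammer ℂ (n + 1 - m)).eval (b + m))).mul_const ((φ m).eval x)
    refine HasDerivAt.congr_deriv h1 ?_
    rw [Finset.sum_range_succ]
    simp only [Nat.sub_self, Nat.cast_zero, zero_mul, add_zero, Nat.add_sub_cancel]
    rw [Finset.mul_sum]
    refine Finset.sum_congr rfl fun m hm => ?_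
    obtain ⟨k, rfl⟩ := Nat.exists_eq_add_of_le (Nat.lt_succ_iff.1 (Finset.mem_range.1 hm))
    have e1 : m + k + 1 - m = k + 1 := by omega
    have e2 : m + k - m = k := by omega
    rw [e1, e2, ascPochhammer_succ_eval]
    have e3 : ((m + k + 1).choose m : ℂ) * (k + 1) = (m + k).choose m * (m + k + 1) := by
      have := Nat.choose_mul_succ_eq (m + k) m
      rw [e1] at this
      exact_mod_cast this.symm
    simp only [Nat.add_sub_cancel]
    push_cast
    linear_combination (-(-t) ^ k * (ascPochhammer ℂ k).eval (b + m) * (b + m + k) *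
      (φ m).eval x) * e3

theorem hasDerivAt_det {n : Type*} [Fintype n] [DecidableEq n] {M : ℂ → Matrix n n ℂ}
    {M' : Matrix n n ℂ} {t : ℂ} (h : ∀ i j, HasDerivAt (fun t => M t i j) (M' i j) t) :
    HasDerivAt (fun t => (M t).det) (∑ i, ((M t).updateRow i (M' i)).det) t := by
  have h1 := HasDerivAt.fun_sum fun (σ : Equiv.Perm n) (_ : σ ∈ Finset.univ) =>
    (HasDerivAt.fun_finsetProd fun i (_ : i ∈ Finset.univ) => h i (σ i)).const_mul
      ((Equiv.Perm.sign σ : ℤ) : ℂ)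
  have h2 : ∀ A : Matrix n n ℂ, A.det = ∑ σ : Equiv.Perm n, ((Equiv.Perm.sign σ : ℤ) : ℂ) *
      ∏ i, A i (σ i) := fun A => by rw [← Matrix.det_transpose, Matrix.det_apply']; rfl
  simp only [h2]
  refine h1.congr_deriv ?_
  symm
  rw [Finset.sum_comm]
  refine Finset.sum_congr rfl fun σ _ => ?_
  rw [← Finset.mul_sum]
  congr 1
  refine Finset.sum_congr rfl fun i _ => ?_
  rw [← Finset.prod_erase_mul _ _ (Finset.mem_univ i), smul_eq_mul]
  congr 1
  · refine Finset.prod_congr rfl fun j hj => ?_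
    simp [Finset.ne_of_mem_erase hj]
  · simp

theorem eval_alternant (φ : ℕ → Polynomial ℂ) (ν : YoungDiagram) {N : ℕ} (x : Fin N → ℂ) :
    eval x (alternant φ ν N) =
      Matrix.det (Matrix.of fun i j : Fin N => (φ (ν.rowLen i + (N - 1 - i))).eval (x j)) := by
  rw [alternant, RingHom.map_det]
  congr 1
  ext i j
  simp only [RingHom.mapMatrix_apply, Matrix.map_apply, Matrix.of_apply]
  rw [Polynomial.aeval_def, Polynomial.hom_eval₂, eval_X]
  congr 1
  exact RingHom.ext fun c => by simp

/-- Differentiating a determinant lowers one row at a time. A corner row gives the alternant of the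
smaller diagram; lowering any other row produces two equal rows or a zero factor. So the alternant
obeys the same system as the expansion at `z = N`, `z' = N+b-1`. -/
theorem hasDerivAt_eval_alternant_lowered (φ : ℕ → Polynomial ℂ) (b t : ℂ) {ν : YoungDiagram}
    {N : ℕ} (h : ν.colLen 0 ≤ N) (x : Fin N → ℂ) :
    HasDerivAt (fun t => eval x (alternant (lowered φ b t) ν N))
      (-∑ i ∈ cornerRows ν, cornerWeight N (N + b - 1) ν i *
        eval x (alternant (lowered φ b t) (removeCorner ν i) N)) t := by
  simp only [eval_alternant]
  refine (hasDerivAt_det (M := fun t => Matrix.of fun i j : Fin N =>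
    (lowered φ b t (ν.rowLen i + (N - 1 - i))).eval (x j)) (M' := Matrix.of fun i j : Fin N =>
      -(((ν.rowLen i + (N - 1 - i) : ℕ) : ℂ) * ((ν.rowLen i + (N - 1 - i) : ℕ) - 1 + b)) *
      (lowered φ b t (ν.rowLen i + (N - 1 - i) - 1)).eval (x j)) fun i j =>
    hasDerivAt_eval_lowered φ b t (x j) (ν.rowLen i + (N - 1 - i))).congr_deriv ?_
  have hsub : cornerRows ν ⊆ Finset.range N := fun i hi => by
    have := (Finset.mem_filter.1 hi).1
    simp at this ⊢
    omega
  have hs : ∀ f : ℕ → ℂ, ∑ i ∈ cornerRows ν, f i =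
      ∑ i ∈ Finset.range N, if i ∈ cornerRows ν then f i else 0 := fun f => by
    rw [← Finset.sum_filter, Finset.filter_mem_eq_inter, Finset.inter_eq_right.2 hsub]
  rw [hs, ← Finset.sum_neg_distrib, Finset.sum_range]
  refine Finset.sum_congr rfl fun i _ => ?_
  -- This removes the truncated subtraction; with it `N + content` becomes the exponent of row `i`.
  have hN : (N : ℂ) = ((N - 1 - i : ℕ) : ℂ) + 1 + (i : ℕ) := by
    have : N = (N - 1 - i) + 1 + i := by omega
    exact_mod_cast this
  have e : (Matrix.of fun i j : Fin N =>
      -(((ν.rowLen i + (N - 1 - i) : ℕ) : ℂ) * ((ν.rowLen i + (N - 1 - i) : ℕ) - 1 + b)) *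
      (lowered φ b t (ν.rowLen i + (N - 1 - i) - 1)).eval (x j)) i =
      (-cornerWeight N (N + b - 1) ν i) • fun j =>
        (lowered φ b t (ν.rowLen i + (N - 1 - i) - 1)).eval (x j) := by
    ext j
    simp only [Matrix.of_apply, Pi.smul_apply, smul_eq_mul, cornerWeight]
    rw [hN]
    push_cast
    ring
  rw [e, Matrix.det_updateRow_smul]
  split_ifs with hi
  · rw [neg_mul]
    congr 3
    ext k j
    have := mem_cornerRows.1 hi
    by_cases hk : k = i
    · subst hk
      have : ν.rowLen k + (N - 1 - k) - 1 = ν.rowLen k - 1 + (N - 1 - k) := by omega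
      simp [rowLen_removeCorner hi, this]
    · have hk' : (k : ℕ) ≠ i := fun h => hk (Fin.ext h)
      simp [rowLen_removeCorner hi, hk, hk']
  · rw [mem_cornerRows, not_lt] at hi
    have hi := le_antisymm (ν.rowLen_anti i (i + 1) (by omega)) hi
    -- Rows `i` and `i+1` have equal length here, so lowering the exponent of row `i` makes it
    -- coincide with that of row `i+1`. In the last row the length is `0`, and the weight itself
    -- vanishes.
    by_cases hiN : (i : ℕ) + 1 < N
    · rw [Matrix.det_zero_of_row_eq (i := i) (j := ⟨i + 1, hiN⟩), mul_zero, neg_zero]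
      · simp [Fin.ext_iff]
      · ext j
        have h1 : (⟨i + 1, hiN⟩ : Fin N) ≠ i := by simp [Fin.ext_iff]
        have h2 : ν.rowLen i + (N - 1 - i) - 1 = ν.rowLen i + (N - 1 - (i + 1)) := by omega
        simp [h1, hi, h2]
    · have h1 : (i : ℕ) + 1 = N := by omega
      have h2 : ν.rowLen i = 0 := by rw [← hi, h1]; exact (colLen_zero_le_iff ν N).1 h
      have h3 : (N : ℂ) = i + 1 := by exact_mod_cast h1.symm
      rw [show cornerWeight N (N + b - 1) ν i = 0 by rw [cornerWeight, h2, h3]; push_cast; ring,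
        neg_zero, zero_mul]

theorem colLen_le_of_le {μ ν : YoungDiagram} (h : μ ≤ ν) {N : ℕ} (hν : ν.colLen 0 ≤ N) :
    μ.colLen 0 ≤ N := by
  rw [colLen_zero_le_iff] at hν ⊢
  have := le_iff_rowLen_le.1 h N
  omega

theorem removeCorner_le {ν : YoungDiagram} {i : ℕ} (hi : i ∈ cornerRows ν) :
    removeCorner ν i ≤ ν := ((le_removeCorner_iff hi).1 le_rfl).1

/-- Both sides satisfy the same linear differential system in `t` and agree at `t = 0`. By induction
on the number of boxes the right-hand sides of the equations coincide, so the difference is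
constant. -/
theorem eval_alternant_lowered (φ : ℕ → Polynomial ℂ) (b : ℂ) {N : ℕ} (x : Fin N → ℂ) (n : ℕ) :
    ∀ ν : YoungDiagram, ν.card = n → ν.colLen 0 ≤ N → ∀ t,
      eval x (alternant (lowered φ b t) ν N) = ∑ μ ∈ subdiagrams ν,
        expansionCoeff N (N + b - 1) t ν μ * eval x (alternant φ μ N) := by
  induction n with
  | zero | succ n ih =>
    intro ν hn hN t
    have h1 : ∀ t, HasDerivAt (fun t => eval x (alternant (lowered φ b t) ν N) -
        ∑ μ ∈ subdiagrams ν, expansionCoeff N (N + b - 1) t ν μ * eval x (alternant φ μ N))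
        0 t := fun t => by
      refine ((hasDerivAt_eval_alternant_lowered φ b t hN x).sub
        (hasDerivAt_sum_expansionCoeff _ _ t ν _)).congr_deriv ?_
      rw [sub_eq_zero, neg_inj]
      refine Finset.sum_congr rfl fun i hi => ?_
      have h2 := card_removeCorner hi
      -- With no boxes there are no corners and `h2` is contradictory; otherwise the induction
      -- hypothesis applies.
      first
        | omega
        | rw [ih _ (by omega) (colLen_le_of_le (removeCorner_le hi) hN) t]
    have h2 := is_const_of_deriv_eq_zero (fun t => (h1 t).differentiableAt)
      (fun t => (h1 t).deriv) t 0
    rw [sum_expansionCoeff_zero] at h2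
    rw [← sub_eq_zero, h2, sub_eq_zero]
    congr 2
    ext n
    rw [lowered_zero_right]

/-- The box in row `N`, column `0` has content `-N` and lies in `ν/μ`. -/
theorem skewPoch_eq_zero_of_colLen {μ ν : YoungDiagram} {N : ℕ} (hμ : μ.colLen 0 ≤ N)
    (hν : ¬ ν.colLen 0 ≤ N) : skewPoch N ν μ = 0 := by
  refine Finset.prod_eq_zero (i := (N, 0)) ?_ (by simp)
  rw [colLen_zero_le_iff] at hμ hν
  rw [skewCells, Finset.mem_sdiff, YoungDiagram.mem_cells, YoungDiagram.mem_cells,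
    YoungDiagram.mem_iff_lt_rowLen, YoungDiagram.mem_iff_lt_rowLen]
  omega

/-- The bridge to one variable: cancel `vdm N` in the alternant identity. If `ν` has more than `N`
rows, each term dies, either by the box of content `-N` or because `μ` too has more than `N` rows.
-/
theorem sum_expansionCoeff_smul_multivariate (φ : ℕ → Polynomial ℂ) (b t : ℂ) (N : ℕ)
    (ν : YoungDiagram) :
    ∑ μ ∈ subdiagrams ν, expansionCoeff N (N + b - 1) t ν μ • multivariate φ μ N =
      multivariate (lowered φ b t) ν N := by
  by_cases h : ν.colLen 0 ≤ N
  · refine mul_left_cancel₀ (vdm_ne_zero N) ?_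
    rw [vdm_mul_multivariate _ h, Finset.mul_sum]
    refine MvPolynomial.funext fun x => ?_
    rw [eval_alternant_lowered φ b x _ ν rfl h, map_sum]
    refine Finset.sum_congr rfl fun μ hμ => ?_
    rw [mul_smul_comm, vdm_mul_multivariate _ (colLen_le_of_le (mem_subdiagrams.1 hμ) h),
      smul_eval]
  · rw [multivariate, if_neg h]
    refine Finset.sum_eq_zero fun μ _ => ?_
    by_cases hμ : μ.colLen 0 ≤ N
    · simp [expansionCoeff, skewPoch_eq_zero_of_colLen hμ h]
    · simp [multivariate, hμ]

/-! ### Orthogonality in one variable -/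

theorem ascPochhammer_eval_add (b : ℂ) (m k : ℕ) : (ascPochhammer ℂ (m + k)).eval b =
    (ascPochhammer ℂ m).eval b * (ascPochhammer ℂ k).eval (b + m) := by
  rw [← ascPochhammer_mul, Polynomial.eval_mul, Polynomial.eval_comp]
  simp

/-- The sum is the `n`-th forward difference of a monic polynomial of degree `k ≤ n`. -/
theorem alternating_sum_ascPochhammer (b : ℂ) {n k : ℕ} (h : k ≤ n) :
    ∑ m ∈ Finset.range (n + 1), (-1) ^ (n - m) * (n.choose m : ℂ) *
      (ascPochhammer ℂ k).eval (b + m) = if k = n then (n.factorial : ℂ) else 0 := by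
  set P : Polynomial ℂ := (ascPochhammer ℂ k).comp (Polynomial.X + Polynomial.C b) with hP
  have hd : P.natDegree = k := by
    rw [hP, Polynomial.natDegree_comp, ascPochhammer_natDegree, Polynomial.natDegree_X_add_C,
      mul_one]
  have hl : P.leadingCoeff = 1 := by
    rw [hP]
    exact ((monic_ascPochhammer ℂ k).comp_X_add_C b).leadingCoeff
  have h1 := fwdDiff_iter_eq_sum_shift (1 : ℂ) P.eval n 0
  have h2 : ∑ m ∈ Finset.range (n + 1), (-1) ^ (n - m) * (n.choose m : ℂ) *
      (ascPochhammer ℂ k).eval (b + m) = (fwdDiff 1)^[n] P.eval 0 := by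
    rw [h1]
    refine Finset.sum_congr rfl fun m _ => ?_
    simp [hP, add_comm]
  rw [h2]
  split_ifs with hk
  · subst hk
    have := Polynomial.fwdDiff_iter_degree_eq_factorial P
    rw [hd, hl] at this
    rw [this]
    simp
  · rw [Polynomial.fwdDiff_iter_eq_zero_of_degree_lt (by omega)]
    rfl

theorem lowered_natDegree_monic {φ : ℕ → Polynomial ℂ} (hd : ∀ n, (φ n).natDegree = n)
    (hm : ∀ n, (φ n).Monic) (b t : ℂ) (n : ℕ) :
    (lowered φ b t n).natDegree = n ∧ (lowered φ b t n).Monic := by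
  have h0 : lowered φ b t n = (∑ m ∈ Finset.range n,
    ((-t) ^ (n - m) * n.choose m * (ascPochhammer ℂ (n - m)).eval (b + m)) • φ m) + φ n := by
    rw [lowered, Finset.sum_range_succ]
    simp
  have h1 : (∑ m ∈ Finset.range n, ((-t) ^ (n - m) * n.choose m *
      (ascPochhammer ℂ (n - m)).eval (b + m)) • φ m).degree < (φ n).degree := by
    rw [Polynomial.degree_eq_natDegree (hm n).ne_zero, hd]
    refine (Polynomial.degree_sum_le _ _).trans_lt ?_
    refine (Finset.sup_lt_iff (WithBot.bot_lt_coe n)).2 ?_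
    intro m hm'
    refine (Polynomial.degree_smul_le _ _).trans_lt ?_
    rw [Polynomial.degree_eq_natDegree (hm m).ne_zero, hd]
    exact WithBot.coe_lt_coe.2 (Finset.mem_range.1 hm')
  rw [h0]
  exact ⟨by rw [Polynomial.natDegree_add_eq_right_of_degree_lt h1, hd],
    (hm n).add_of_right h1⟩

section

variable {φ q : ℕ → Polynomial ℂ} {b s t : ℂ} {ψ : Polynomial ℂ →ₗ[ℂ] ℂ}

/-- Write `(b)_{m+k} = (b)_m (b+m)_k`. The factor `(b+m)_{n-m}` in `lowered` completes `(b)_m` to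
`(b)_n`, and the powers of `t` combine to `t^n`. What still depends on `m` is an `n`-th difference.
Testing against a second family `q` is what makes the sum this simple. -/
theorem functional_lowered_mul
    (hψ : ∀ m k, ψ (φ m * q k) = s ^ k * t ^ m * (ascPochhammer ℂ (m + k)).eval b)
    {n k : ℕ} (h : k ≤ n) : ψ (lowered φ b t n * q k) =
      if k = n then n.factorial * (ascPochhammer ℂ n).eval b * (s * t) ^ n else 0 := by
  have h1 : ψ (lowered φ b t n * q k) = t ^ n * s ^ k * (ascPochhammer ℂ n).eval b *
      ∑ m ∈ Finset.range (n + 1), (-1) ^ (n - m) * (n.choose m : ℂ) *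
      (ascPochhammer ℂ k).eval (b + m) := by
    rw [lowered, Finset.sum_mul, map_sum, Finset.mul_sum]
    refine Finset.sum_congr rfl fun m hm => ?_
    rw [smul_mul_assoc, map_smul, hψ, ascPochhammer_eval_add, smul_eq_mul]
    obtain ⟨j, rfl⟩ := Nat.exists_eq_add_of_le (Nat.lt_succ_iff.1 (Finset.mem_range.1 hm))
    rw [Nat.add_sub_cancel_left, ascPochhammer_eval_add b m j, neg_pow, pow_add]
    ring
  rw [h1, alternating_sum_ascPochhammer b h]
  split_ifs with hk
  · subst hk
    rw [mul_pow]
    ring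
  · simp

theorem functional_lowered_mul_of_degree_lt (hq : ∀ n, (q n).natDegree = n)
    (hq' : ∀ n, (q n).Monic)
    (hψ : ∀ m k, ψ (φ m * q k) = s ^ k * t ^ m * (ascPochhammer ℂ (m + k)).eval b)
    {n : ℕ} (d : ℕ) (hd : d ≤ n) : ∀ r : Polynomial ℂ, r.degree < d →
      ψ (lowered φ b t n * r) = 0 := by
  induction d with
  | zero =>
    intro r hr
    have : r = 0 := by simpa using hr
    simp [this]
  | succ d ih =>
    intro r hr
    have h1 : (r - Polynomial.C (r.coeff d) * q d).degree < d := by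
      rw [Polynomial.degree_lt_iff_coeff_zero] at hr ⊢
      intro m hm
      rcases hm.eq_or_lt with h | h
      · subst h
        have := (hq' d).coeff_natDegree
        rw [hq] at this
        simp [this]
      · have : (q d).coeff m = 0 := Polynomial.coeff_eq_zero_of_natDegree_lt (by rw [hq]; exact h)
        simp [this, hr m h]
    have h2 := ih (by omega) _ h1
    rw [mul_sub, map_sub, sub_eq_zero] at h2
    rw [h2, ← Polynomial.smul_eq_C_mul, mul_smul_comm, map_smul,
      functional_lowered_mul hψ (by omega), if_neg (by omega), smul_zero]

/-- Off the diagonal the lower-degree factor is a combination of `q_k` of smaller index. On it, one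
factor may be replaced by the monic `q n`, since their difference has smaller degree. -/
theorem functional_lowered_mul_lowered (hφ : ∀ n, (φ n).natDegree = n) (hφ' : ∀ n, (φ n).Monic)
    (hq : ∀ n, (q n).natDegree = n) (hq' : ∀ n, (q n).Monic)
    (hψ : ∀ m k, ψ (φ m * q k) = s ^ k * t ^ m * (ascPochhammer ℂ (m + k)).eval b) (n m : ℕ) :
    ψ (lowered φ b t n * lowered φ b t m) =
      if n = m then n.factorial * (ascPochhammer ℂ n).eval b * (s * t) ^ n else 0 := by
  have hd := fun n => (lowered_natDegree_monic hφ hφ' b t n).1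
  have hm := fun n => (lowered_natDegree_monic hφ hφ' b t n).2
  have hdeg : ∀ n, (lowered φ b t n).degree = n := fun n => by
    rw [Polynomial.degree_eq_natDegree (hm n).ne_zero, hd]
  split_ifs with h
  · subst h
    have h1 := functional_lowered_mul_of_degree_lt hq hq' hψ n le_rfl
      (lowered φ b t n - q n) (by
        refine (Polynomial.degree_sub_lt_left ?_ (hm n).ne_zero ?_).trans_eq (hdeg n)
        · rw [hdeg, Polynomial.degree_eq_natDegree (hq' n).ne_zero, hq]
        · rw [(hm n).leadingCoeff, (hq' n).leadingCoeff])
    rw [mul_sub, map_sub, sub_eq_zero] at h1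
    rw [h1, functional_lowered_mul hψ le_rfl, if_pos rfl]
  · rcases lt_or_gt_of_ne h with h | h
    · rw [mul_comm]
      exact functional_lowered_mul_of_degree_lt hq hq' hψ m le_rfl _
        (by rw [hdeg]; exact_mod_cast h)
    · exact functional_lowered_mul_of_degree_lt hq hq' hψ n le_rfl _
        (by rw [hdeg]; exact_mod_cast h)

end

/-- The moments `(b)_n` are those of the Gamma distribution, defined formally so that `b` is
arbitrary; `q_k = x^k`. -/
theorem exists_functional_X_pow (b : ℂ) : ∃ (ψ : Polynomial ℂ →ₗ[ℂ] ℂ) (q : ℕ → Polynomial ℂ),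
    (∀ n, (q n).natDegree = n) ∧ (∀ n, (q n).Monic) ∧
    ∀ m k, ψ (Polynomial.X ^ m * q k) = 1 ^ k * 1 ^ m * (ascPochhammer ℂ (m + k)).eval b := by
  refine ⟨(Polynomial.basisMonomials ℂ).constr ℂ fun n => (ascPochhammer ℂ n).eval b,
    fun n => Polynomial.X ^ n, by simp, fun n => Polynomial.monic_X_pow n, fun m k => ?_⟩
  have : Polynomial.X ^ m * Polynomial.X ^ k = Polynomial.basisMonomials ℂ (m + k) := by
    rw [← pow_add, Polynomial.X_pow_eq_monomial, Polynomial.coe_basisMonomials]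
  rw [this, Module.Basis.constr_basis]
  simp

theorem exists_basis_of_monic {φ : ℕ → Polynomial ℂ} (hd : ∀ n, (φ n).natDegree = n)
    (hm : ∀ n, (φ n).Monic) : ∃ B : Module.Basis ℕ ℂ (Polynomial ℂ), ⇑B = φ := by
  let S : Polynomial.Sequence ℂ := ⟨φ, fun n => by
    rw [Polynomial.degree_eq_natDegree (hm n).ne_zero, hd]⟩
  exact ⟨S.basis fun n => by simp [S, (hm n).leadingCoeff], by ext; simp [S]⟩

/-- Prescribe the factorial moments `t^n (b)_n` of the negative binomial distribution and take `q_k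
= (x+b)_k`. The mixed moments follow by induction on `k` from `x+b+k = (x-m) + (m+b+k)`. -/
theorem exists_functional_descPochhammer (b t : ℂ) :
    ∃ (ψ : Polynomial ℂ →ₗ[ℂ] ℂ) (q : ℕ → Polynomial ℂ),
    (∀ n, (q n).natDegree = n) ∧ (∀ n, (q n).Monic) ∧
    ∀ m k, ψ (descPochhammer ℂ m * q k) =
      (1 + t) ^ k * t ^ m * (ascPochhammer ℂ (m + k)).eval b := by
  obtain ⟨B, hB⟩ := exists_basis_of_monic (φ := fun n => descPochhammer ℂ n)
    (fun n => descPochhammer_natDegree ℂ n) (fun n => monic_descPochhammer ℂ n)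
  refine ⟨B.constr ℂ fun n => t ^ n * (ascPochhammer ℂ n).eval b,
    fun n => (ascPochhammer ℂ n).comp (Polynomial.X + Polynomial.C b), fun n => ?_,
    fun n => (monic_ascPochhammer ℂ n).comp_X_add_C b, fun m k => ?_⟩
  · rw [Polynomial.natDegree_comp, ascPochhammer_natDegree, Polynomial.natDegree_X_add_C, mul_one]
  · induction k generalizing m with
    | zero =>
      have : descPochhammer ℂ m = B m := by rw [hB]
      simp [this]
    | succ k ih =>
      have e : descPochhammer ℂ m * (ascPochhammer ℂ (k + 1)).comp (Polynomial.X + Polynomial.C b)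
          = descPochhammer ℂ (m + 1) * (ascPochhammer ℂ k).comp (Polynomial.X + Polynomial.C b) +
          (m + b + k : ℂ) • (descPochhammer ℂ m *
            (ascPochhammer ℂ k).comp (Polynomial.X + Polynomial.C b)) := by
        rw [ascPochhammer_succ_right, descPochhammer_succ_right, Polynomial.smul_eq_C_mul]
        simp only [Polynomial.mul_comp, Polynomial.add_comp, Polynomial.X_comp,
          Polynomial.natCast_comp, map_add, map_natCast]
        ring
      rw [e, map_add, map_smul, ih, ih, ← add_assoc, show m + 1 + k = m + k + 1 by ring,
        ascPochhammer_succ_eval]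
      push_cast
      rw [smul_eq_mul]
      ring

/-! ### Tensor powers of functionals on univariate polynomials -/

/-- The tensor power of a linear functional on univariate polynomials. -/
noncomputable def tensorFunctional (ψ : Polynomial ℂ →ₗ[ℂ] ℂ) (N : ℕ) :
    MvPolynomial (Fin N) ℂ →ₗ[ℂ] ℂ :=
  (basisMonomials (Fin N) ℂ).constr ℂ fun m => ∏ j, ψ (Polynomial.X ^ m j)

theorem tensorFunctional_prod (ψ : Polynomial ℂ →ₗ[ℂ] ℂ) {N : ℕ} (f : Fin N → Polynomial ℂ) :
    tensorFunctional ψ N (∏ j, Polynomial.aeval (X j) (f j)) = ∏ j, ψ (f j) := by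
  have h1 : ∀ j, ψ (f j) = ∑ n ∈ (f j).support, (f j).coeff n * ψ (Polynomial.X ^ n) := fun j => by
    conv_lhs => rw [(f j).as_sum_support]
    rw [map_sum]
    refine Finset.sum_congr rfl fun n _ => ?_
    rw [← Polynomial.smul_X_eq_monomial, map_smul, smul_eq_mul]
  have h2 : ∀ j, Polynomial.aeval (X j : MvPolynomial (Fin N) ℂ) (f j) =
      ∑ n ∈ (f j).support, C ((f j).coeff n) * X j ^ n := fun j => by
    rw [Polynomial.aeval_def, Polynomial.eval₂_eq_sum, Polynomial.sum, algebraMap_eq]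
  simp only [h1, h2, Finset.prod_univ_sum, map_sum]
  refine Finset.sum_congr rfl fun p _ => ?_
  rw [Finset.prod_mul_distrib, Finset.prod_mul_distrib, ← map_prod, ← smul_eq_C_mul, map_smul,
    smul_eq_mul]
  congr 1
  have : ∏ j, X j ^ p j = basisMonomials (Fin N) ℂ (Finsupp.equivFunOnFinite.symm p) := by
    simp only [coe_basisMonomials]
    rw [monomial_eq, Finsupp.prod_fintype _ _ (by simp)]
    simp
  rw [this, tensorFunctional, Module.Basis.constr_basis]
  simp

/-- The strictly decreasing sequence `ν_i + N - i`. -/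
def beads (ν : YoungDiagram) (N : ℕ) (i : Fin N) : ℕ := ν.rowLen i + (N - 1 - i)

theorem beads_strictAnti (ν : YoungDiagram) (N : ℕ) : StrictAnti (beads ν N) := by
  intro i j hij
  have := ν.rowLen_anti i j hij.le
  have : (i : ℕ) < j := hij
  simp only [beads]
  omega

/-- A strictly decreasing sequence is determined by its range, which permuting the indices does not
change. -/
theorem eq_of_strictAnti_of_comp_eq {N : ℕ} {f g : Fin N → ℕ} (hf : StrictAnti f)
    (hg : StrictAnti g) {σ τ : Equiv.Perm (Fin N)} (h : f ∘ σ = g ∘ τ) : f = g := by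
  have h1 : Set.range (OrderDual.toDual ∘ f) = Set.range (OrderDual.toDual ∘ g) := by
    rw [← σ.surjective.range_comp (OrderDual.toDual ∘ f),
      ← τ.surjective.range_comp (OrderDual.toDual ∘ g), Function.comp_assoc, h,
      Function.comp_assoc]
  have h2 := (StrictMono.range_inj (f := OrderDual.toDual ∘ f) (g := OrderDual.toDual ∘ g)
    (fun i j h => hf h) (fun i j h => hg h)).1 h1
  exact h2

theorem beads_inj {μ ν : YoungDiagram} {N : ℕ} (hμ : μ.colLen 0 ≤ N) (hν : ν.colLen 0 ≤ N)
    (h : beads μ N = beads ν N) : μ = ν := by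
  refine eq_of_rowLen_eq fun i => ?_
  by_cases hi : i < N
  · have := congrFun h ⟨i, hi⟩
    simpa [beads] using this
  · rw [colLen_zero_le_iff] at hμ hν
    have h1 := μ.rowLen_anti N i (by omega)
    have h2 := ν.rowLen_anti N i (by omega)
    omega

theorem alternant_eq_sum (φ : ℕ → Polynomial ℂ) (ν : YoungDiagram) (N : ℕ) :
    alternant φ ν N = ∑ σ : Equiv.Perm (Fin N), C ((Equiv.Perm.sign σ : ℤ) : ℂ) *
      ∏ j, Polynomial.aeval (X j) (φ (beads ν N (σ j))) := by
  rw [alternant, Matrix.det_apply']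
  refine Finset.sum_congr rfl fun σ _ => ?_
  simp [beads]

/-- In the double sum over permutations, a nonzero term needs equal bead sequences after
permutation, which forces `μ = ν` and `σ = τ`. The `N!` diagonal terms have sign `1` and the same
product. -/
theorem tensorFunctional_alternant_mul {P : ℕ → Polynomial ℂ} {ψ : Polynomial ℂ →ₗ[ℂ] ℂ}
    {h : ℕ → ℂ} (hψ : ∀ n m, ψ (P n * P m) = if n = m then h n else 0) {N : ℕ}
    {μ ν : YoungDiagram} (hμ : μ.colLen 0 ≤ N) (hν : ν.colLen 0 ≤ N) :
    tensorFunctional ψ N (alternant P μ N * alternant P ν N) =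
      if μ = ν then N.factorial * ∏ i, h (beads ν N i) else 0 := by
  have key : ∀ σ τ : Equiv.Perm (Fin N), ∏ j, ψ (P (beads μ N (σ j)) * P (beads ν N (τ j))) =
      if μ = ν ∧ σ = τ then ∏ i, h (beads ν N i) else 0 := by
    intro σ τ
    simp only [hψ]
    split_ifs with hc
    · obtain ⟨rfl, rfl⟩ := hc
      simp only [if_true]
      exact Equiv.prod_comp σ fun i => h (beads μ N i)
    · by_contra h0
      rw [← ne_eq, Finset.prod_ne_zero_iff] at h0
      have h1 : beads μ N ∘ σ = beads ν N ∘ τ := by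
        ext j
        by_contra hj
        exact h0 j (Finset.mem_univ j) (if_neg hj)
      have h2 := beads_inj hμ hν (eq_of_strictAnti_of_comp_eq (beads_strictAnti μ N)
        (beads_strictAnti ν N) h1)
      subst h2
      refine hc ⟨rfl, Equiv.ext fun j => (beads_strictAnti μ N).injective (congrFun h1 j)⟩
  have expand : tensorFunctional ψ N (alternant P μ N * alternant P ν N) =
      ∑ σ : Equiv.Perm (Fin N), ∑ τ : Equiv.Perm (Fin N),
        (((Equiv.Perm.sign σ : ℤ) : ℂ) * ((Equiv.Perm.sign τ : ℤ) : ℂ)) *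
          ∏ j, ψ (P (beads μ N (σ j)) * P (beads ν N (τ j))) := by
    rw [alternant_eq_sum, alternant_eq_sum, Finset.sum_mul_sum, map_sum]
    refine Finset.sum_congr rfl fun σ _ => ?_
    rw [map_sum]
    refine Finset.sum_congr rfl fun τ _ => ?_
    rw [mul_mul_mul_comm, ← C_mul, ← Finset.prod_mul_distrib, ← smul_eq_C_mul, map_smul,
      smul_eq_mul, ← tensorFunctional_prod]
    simp only [map_mul]
  rw [expand]
  simp only [key]
  split_ifs with hc
  · have : ∀ σ : Equiv.Perm (Fin N), ((Equiv.Perm.sign σ : ℤ) : ℂ) *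
        ((Equiv.Perm.sign σ : ℤ) : ℂ) = 1 := fun σ => by
      rw [← Int.cast_mul, ← Units.val_mul, Int.units_mul_self]; simp
    simp [hc, this, Fintype.card_perm]
  · simp [hc]

/-! ### The Schur basis -/

theorem rowLen_bot (i : ℕ) : (⊥ : YoungDiagram).rowLen i = 0 := by
  by_contra h
  exact YoungDiagram.notMem_bot (i, 0) (YoungDiagram.mem_iff_lt_rowLen.2 (Nat.pos_of_ne_zero h))

theorem colLen_bot (N : ℕ) : (⊥ : YoungDiagram).colLen 0 ≤ N :=
  (colLen_zero_le_iff _ _).2 (rowLen_bot N)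

theorem alternant_bot {φ : ℕ → Polynomial ℂ} (hd : ∀ n, (φ n).natDegree = n)
    (hm : ∀ n, (φ n).Monic) (N : ℕ) : alternant φ ⊥ N = vdm N := by
  have h1 := Matrix.det_eval_matrixOfPolynomials_eq_det_vandermonde
    (fun i : Fin N => (X i.rev : MvPolynomial (Fin N) ℂ)) (fun j => (φ j).map C)
    (fun j => by rw [Polynomial.natDegree_map_eq_of_injective (C_injective _ _), hd])
    (fun j => (hm j).map C)
  -- After transposing, reversing rows and columns together turns the decreasing degrees `N-1-i`
  -- into increasing ones and keeps the determinant.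
  have h2 : alternant φ ⊥ N = (Matrix.of fun i j : Fin N =>
      ((φ j).map C).eval (X i.rev : MvPolynomial (Fin N) ℂ)).det := by
    rw [alternant, ← Matrix.det_transpose, ← Matrix.det_submatrix_equiv_self Fin.revPerm]
    congr 1
    ext1 i j
    have : N - 1 - (N - (j + 1)) = j := by omega
    simp [rowLen_bot, Polynomial.aeval_def, Polynomial.eval_map, algebraMap_eq, this]
  rw [h2, ← h1, Matrix.det_vandermonde, vdm, Finset.prod_sigma', Finset.prod_sigma']
  refine Finset.prod_nbij' (fun p => ⟨p.2.rev, p.1.rev⟩) (fun p => ⟨p.2.rev, p.1.rev⟩)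
    ?_ ?_ ?_ ?_ ?_ <;> simp

theorem multivariate_bot {φ : ℕ → Polynomial ℂ} (hd : ∀ n, (φ n).natDegree = n)
    (hm : ∀ n, (φ n).Monic) (N : ℕ) : multivariate φ ⊥ N = 1 := by
  refine mul_left_cancel₀ (vdm_ne_zero N) ?_
  rw [vdm_mul_multivariate _ (colLen_bot N), alternant_bot hd hm, mul_one]

theorem sum_beads {ν : YoungDiagram} {N : ℕ} (h : ν.colLen 0 ≤ N) :
    ∑ i, beads ν N i = ν.card + ∑ i : Fin N, (N - 1 - i) := by
  simp only [beads]
  rw [Finset.sum_add_distrib]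
  congr 1
  rw [Fin.sum_univ_eq_sum_range fun i => ν.rowLen i]
  have h1 : ∀ c ∈ ν.cells, c.1 ∈ Finset.range N := fun c hc => by
    have h2 : (c.1, 0) ∈ ν := ν.up_left_mem le_rfl (Nat.zero_le _) hc
    rw [ν.mem_iff_lt_colLen] at h2
    simp; omega
  rw [YoungDiagram.card, Finset.card_eq_sum_card_fiberwise h1]
  refine Finset.sum_congr rfl fun i _ => ?_
  rw [ν.rowLen_eq_card]
  rfl

/-- The exponent `(ν_1 + N - 1, …, ν_N)`. -/
noncomputable def beadExponent (ν : YoungDiagram) (N : ℕ) : Fin N →₀ ℕ :=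
  Finsupp.equivFunOnFinite.symm (beads ν N)

theorem coeff_alternant_X_pow {μ ν : YoungDiagram} {N : ℕ} (hμ : μ.colLen 0 ≤ N)
    (hν : ν.colLen 0 ≤ N) : coeff (beadExponent ν N)
      (alternant (fun n => Polynomial.X ^ n) μ N) = if μ = ν then 1 else 0 := by
  have h1 : ∀ σ : Equiv.Perm (Fin N), coeff (beadExponent ν N)
      (C ((Equiv.Perm.sign σ : ℤ) : ℂ) * ∏ j, Polynomial.aeval (X j : MvPolynomial (Fin N) ℂ)
        ((Polynomial.X : Polynomial ℂ) ^ beads μ N (σ j))) =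
      if μ = ν ∧ σ = 1 then 1 else 0 := fun σ => by
    have h2 : ∏ j, Polynomial.aeval (X j : MvPolynomial (Fin N) ℂ)
        ((Polynomial.X : Polynomial ℂ) ^ beads μ N (σ j)) =
        monomial (Finsupp.equivFunOnFinite.symm (beads μ N ∘ σ)) 1 := by
      rw [monomial_eq, Finsupp.prod_fintype _ _ (by simp)]
      simp
    rw [h2, coeff_C_mul, coeff_monomial, beadExponent]
    simp only [EmbeddingLike.apply_eq_iff_eq]
    by_cases hc : μ = ν ∧ σ = 1
    · obtain ⟨rfl, rfl⟩ := hc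
      simp
    · rw [if_neg hc, if_neg, mul_zero]
      intro h3
      have h4 := beads_inj hμ hν (eq_of_strictAnti_of_comp_eq (beads_strictAnti μ N)
        (beads_strictAnti ν N) (σ := σ) (τ := 1) h3)
      subst h4
      exact hc ⟨rfl, Equiv.ext fun j => (beads_strictAnti μ N).injective (congrFun h3 j)⟩
  rw [alternant_eq_sum, coeff_sum]
  simp only [h1]
  split_ifs with hc <;> simp [hc]

theorem coeff_vdm_mul_multivariate {μ ν : YoungDiagram} {N : ℕ} (hν : ν.colLen 0 ≤ N) :
    coeff (beadExponent ν N) (vdm N * multivariate (fun n => Polynomial.X ^ n) μ N) =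
      if μ = ν then 1 else 0 := by
  by_cases hμ : μ.colLen 0 ≤ N
  · rw [vdm_mul_multivariate _ hμ, coeff_alternant_X_pow hμ hν]
  · have : μ ≠ ν := by rintro rfl; exact hμ hν
    simp [multivariate, hμ, this]

theorem strictAnti_add_le {N : ℕ} {l : Fin N → ℕ} (hl : StrictAnti l) (d : ℕ) :
    ∀ i j : Fin N, (j : ℕ) = i + d → l j + d ≤ l i := by
  induction d with
  | zero =>
    intro i j h
    rw [Fin.ext h, add_zero]
  | succ d ih =>
    intro i j h
    have h1 := ih i ⟨i + d, by omega⟩ rfl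
    have h2 : l j < l ⟨i + d, by omega⟩ := hl (by rw [Fin.lt_def]; simp only; omega)
    omega

/-- Strict decrease gives `l_i ≥ N-1-i`, and makes the differences a weakly decreasing list of row
lengths. -/
theorem exists_beads_eq {N : ℕ} {l : Fin N → ℕ} (hl : StrictAnti l) :
    ∃ ν : YoungDiagram, ν.colLen 0 ≤ N ∧ beads ν N = l := by
  have hmono : ∀ i j : Fin N, i ≤ j → l j - (N - 1 - j) ≤ l i - (N - 1 - i) := fun i j hij => by
    have : (i : ℕ) ≤ j := hij
    have := strictAnti_add_le hl (j - i) i j (by omega)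
    omega
  let w := List.ofFn fun i : Fin N => l i - (N - 1 - i)
  have hw : w.SortedGE := List.sortedGE_ofFn_iff.2 fun i j hij => hmono i j hij
  have hlen : w.length = N := by simp [w]
  have hrow : ∀ i : Fin N, (YoungDiagram.ofRowLens w hw).rowLen i = l i - (N - 1 - i) := fun i => by
    refine eq_of_forall_lt_iff fun k => ?_
    rw [← YoungDiagram.mem_iff_lt_rowLen, YoungDiagram.mem_ofRowLens]
    simp [w]
  refine ⟨YoungDiagram.ofRowLens w hw, ?_, ?_⟩
  · rw [colLen_zero_le_iff]
    by_contra h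
    have h1 := YoungDiagram.mem_iff_lt_rowLen.2 (Nat.pos_of_ne_zero h)
    rw [YoungDiagram.mem_ofRowLens] at h1
    obtain ⟨h2, -⟩ := h1
    simp only at h2
    omega
  · ext i
    rw [beads, hrow]
    have := strictAnti_add_le hl (N - 1 - i) i ⟨N - 1, by have := i.2; omega⟩
      (by simp only; omega)
    omega

/-- An exponent with a repeated entry is fixed by a transposition, so its coefficient equals its own
negative. One with distinct entries sorts, up to sign, to a bead exponent. -/
theorem eq_zero_of_antisymmetric {N : ℕ} {g : MvPolynomial (Fin N) ℂ}
    (hg : ∀ σ : Equiv.Perm (Fin N), rename σ g = (Equiv.Perm.sign σ : ℤ) * g)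
    (h : ∀ ν : YoungDiagram, ν.colLen 0 ≤ N → coeff (beadExponent ν N) g = 0) : g = 0 := by
  have hperm : ∀ (σ : Equiv.Perm (Fin N)) (m : Fin N →₀ ℕ),
      coeff m g = (Equiv.Perm.sign σ : ℤ) * coeff (Finsupp.mapDomain σ m) g := fun σ m => by
    rw [← coeff_rename_mapDomain σ σ.injective g, hg]
    have : (((Equiv.Perm.sign σ : ℤ) : MvPolynomial (Fin N) ℂ)) =
        C ((Equiv.Perm.sign σ : ℤ) : ℂ) := by simp
    rw [this, coeff_C_mul]
  ext m
  rw [coeff_zero]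
  by_cases hm : Function.Injective m
  · let f : Fin N → ℕᵒᵈ := fun i => OrderDual.toDual (m i)
    have h1 : Monotone (f ∘ Tuple.sort f) := Tuple.monotone_sort f
    have h2 : StrictAnti (m ∘ Tuple.sort f) := by
      refine Antitone.strictAnti_of_injective (fun i j hij => h1 hij) ?_
      exact hm.comp (Tuple.sort f).injective
    obtain ⟨ν, hν, hl⟩ := exists_beads_eq h2
    have h3 : Finsupp.mapDomain ((Tuple.sort f)⁻¹ : Equiv.Perm (Fin N)) m = beadExponent ν N := by
      ext i
      rw [← Finsupp.equivMapDomain_eq_mapDomain]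
      simp [beadExponent, hl]
      rfl
    rw [hperm (Tuple.sort f)⁻¹ m, h3, h ν hν, mul_zero]
  · rw [Function.not_injective_iff] at hm
    obtain ⟨i, j, hij, hne⟩ := hm
    have h1 : Finsupp.mapDomain (Equiv.swap i j) m = m := by
      ext k
      rw [← Finsupp.equivMapDomain_eq_mapDomain]
      simp only [Finsupp.equivMapDomain_apply, Equiv.symm_swap]
      rw [Equiv.swap_apply_def]
      split_ifs with h1 h2
      · rw [h1, hij]
      · rw [h2, hij]
      · rfl
    have h2 := hperm (Equiv.swap i j) m
    rw [h1, Equiv.Perm.sign_swap hne] at h2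
    push_cast at h2
    have h3 : (2 : ℂ) * coeff m g = 0 := by linear_combination h2
    exact (mul_eq_zero.1 h3).resolve_left two_ne_zero

theorem colLen_le_card (ν : YoungDiagram) (j : ℕ) : ν.colLen j ≤ ν.card := by
  rw [ν.colLen_eq_card]
  exact Finset.card_filter_le _ _

theorem rowLen_le_card (ν : YoungDiagram) (i : ℕ) : ν.rowLen i ≤ ν.card := by
  rw [ν.rowLen_eq_card]
  exact Finset.card_filter_le _ _

theorem finite_card_le (d : ℕ) : {μ : YoungDiagram | μ.card ≤ d}.Finite := by
  refine Set.Finite.of_finite_image (f := YoungDiagram.cells)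
    (((Finset.range d ×ˢ Finset.range d).powerset.finite_toSet).subset ?_)
    fun a _ b _ h => YoungDiagram.ext h
  rintro _ ⟨μ, hμ, rfl⟩
  simp only [Set.mem_ofPred_eq] at hμ
  rw [Finset.mem_coe, Finset.mem_powerset]
  rintro ⟨i, j⟩ hij
  have h1 := μ.mem_iff_lt_rowLen.1 hij
  have h2 := μ.mem_iff_lt_colLen.1 hij
  have h3 := rowLen_le_card μ i
  have h4 := colLen_le_card μ j
  simp
  omega

/-- The diagrams with at most `d` boxes. -/
noncomputable def diagramsUpTo (d : ℕ) : Finset YoungDiagram := (finite_card_le d).toFinset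

theorem mem_diagramsUpTo {d : ℕ} {μ : YoungDiagram} : μ ∈ diagramsUpTo d ↔ μ.card ≤ d := by
  simp [diagramsUpTo]

/-- The coefficient of `S_{μ|N}` in the Schur expansion of a symmetric polynomial. -/
noncomputable def schurCoeff (μ : YoungDiagram) (N : ℕ) : MvPolynomial (Fin N) ℂ →ₗ[ℂ] ℂ :=
  lcoeff ℂ (beadExponent μ N) ∘ₗ LinearMap.mulLeft ℂ (vdm N)

theorem schurCoeff_multivariate {μ ν : YoungDiagram} {N : ℕ} (hν : ν.colLen 0 ≤ N) :
    schurCoeff ν N (multivariate (fun n => Polynomial.X ^ n) μ N) = if μ = ν then 1 else 0 :=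
  coeff_vdm_mul_multivariate hν

/-- The bead exponent has degree `|ν| + deg V_N`, which exceeds the degree of `V_N f`. -/
theorem schurCoeff_eq_zero {ν : YoungDiagram} {N d : ℕ} (hν : ν.colLen 0 ≤ N) (h : d < ν.card)
    {f : MvPolynomial (Fin N) ℂ} (hf : f.totalDegree ≤ d) : schurCoeff ν N f = 0 := by
  change coeff (beadExponent ν N) (vdm N * f) = 0
  refine coeff_eq_zero_of_totalDegree_lt ?_
  have h1 := (totalDegree_mul (vdm N) f).trans (add_le_add (vdm_totalDegree N).le hf)
  have h2 : ∑ i ∈ (beadExponent ν N).support, beadExponent ν N i = ∑ i, beads ν N i := by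
    refine Finset.sum_subset (Finset.subset_univ _) fun i _ hi => ?_
    simpa using hi
  rw [h2, sum_beads hν]
  omega

/-- Multiplied by `V_N`, the difference of the two sides is antisymmetric with no bead coefficients,
hence zero. -/
theorem eq_sum_schurCoeff {N d : ℕ} {f : MvPolynomial (Fin N) ℂ} (hs : f.IsSymmetric)
    (hf : f.totalDegree ≤ d) : f = ∑ μ ∈ diagramsUpTo d,
      schurCoeff μ N f • multivariate (fun n => Polynomial.X ^ n) μ N := by
  set g := f - ∑ μ ∈ diagramsUpTo d,
      schurCoeff μ N f • multivariate (fun n => Polynomial.X ^ n) μ N with hgdef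
  have hg : g.IsSymmetric := hs.sub <| by
    refine Subalgebra.sum_mem (symmetricSubalgebra (Fin N) ℂ) fun μ _ => ?_
    exact Subalgebra.smul_mem _ (multivariate_isSymmetric _ μ N) _
  have h0 : vdm N * g = 0 := by
    refine eq_zero_of_antisymmetric (fun σ => ?_) fun ν hν => ?_
    · rw [map_mul, vdm_rename, hg σ, mul_assoc]
    · change schurCoeff ν N g = 0
      rw [hgdef, map_sub, map_sum]
      simp only [map_smul, schurCoeff_multivariate hν, smul_eq_mul, mul_ite, mul_one, mul_zero,
        Finset.sum_ite_eq', mem_diagramsUpTo]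
      split_ifs with h
      · simp
      · rw [sub_zero]
        exact schurCoeff_eq_zero hν (not_le.1 h) hf
  rw [← sub_eq_zero]
  exact (mul_eq_zero.1 h0).resolve_left (vdm_ne_zero N)

theorem Sym.eq_zero_of_le (f : Sym) {N M : ℕ} (h : N ≤ M) (hM : f.1 M = 0) : f.1 N = 0 := by
  induction M, h using Nat.le_induction with
  | base => exact hM
  | succ M _ ih => exact ih (by rw [← f.2.2.1 M, hM, map_zero])

theorem Sym.schurCoeff_succ {f : Sym} {d : ℕ} (hf : ∀ N, (f.1 N).totalDegree ≤ d)
    {μ : YoungDiagram} (hμ : μ.card ≤ d) {N : ℕ} (hN : d ≤ N) :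
    schurCoeff μ (N + 1) (f.1 (N + 1)) = schurCoeff μ N (f.1 N) := by
  have hμ' : μ.colLen 0 ≤ N := ((colLen_le_card μ 0).trans hμ).trans hN
  have h1 := congrArg (killLast N) (eq_sum_schurCoeff (f.2.1 (N + 1)) (hf (N + 1)))
  rw [f.2.2.1, map_sum] at h1
  rw [h1, map_sum]
  simp [killLast_schur, schurCoeff_multivariate hμ', mem_diagramsUpTo, hμ]

theorem Sym.schurCoeff_eq {f : Sym} {d : ℕ} (hf : ∀ N, (f.1 N).totalDegree ≤ d)
    {μ : YoungDiagram} (hμ : μ.card ≤ d) {N : ℕ} (hN : d ≤ N) :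
    schurCoeff μ N (f.1 N) = schurCoeff μ d (f.1 d) := by
  induction N, hN using Nat.le_induction with
  | base => rfl
  | succ N hN ih => rw [Sym.schurCoeff_succ hf hμ hN, ih]

/-- Once `M ≥ d`, the Schur coefficients no longer depend on the number of variables. Equality is
checked with at least `d` variables and descends to fewer by compatibility. -/
theorem Sym.eq_sum_schur {f : Sym} {d : ℕ} (hf : ∀ N, (f.1 N).totalDegree ≤ d)
    {M : ℕ} (hM : d ≤ M) :
    f = ∑ μ ∈ diagramsUpTo d, schurCoeff μ M (f.1 M) • schur μ := by
  have hval : ∀ (c : YoungDiagram → ℂ) N, (∑ μ ∈ diagramsUpTo d, c μ • schur μ : Sym).1 N =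
      ∑ μ ∈ diagramsUpTo d, c μ • multivariate (fun n => Polynomial.X ^ n) μ N := fun c N => by
    rw [AddSubmonoidClass.coe_finsetSum, Finset.sum_apply]
    rfl
  rw [← sub_eq_zero]
  refine Subtype.ext (funext fun N => ?_)
  refine Sym.eq_zero_of_le _ (le_max_left N d) ?_
  have h1 := eq_sum_schurCoeff (f.2.1 (max N d)) (hf (max N d))
  rw [AddSubgroupClass.coe_sub, Pi.sub_apply, hval, sub_eq_zero]
  conv_lhs => rw [h1]
  refine Finset.sum_congr rfl fun μ hμ => ?_
  rw [mem_diagramsUpTo] at hμ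
  rw [Sym.schurCoeff_eq hf hμ (le_max_right N d), Sym.schurCoeff_eq hf hμ hM]

theorem Sym.eq_zero_of_apply_eq_zero {f : Sym} {d : ℕ} (hf : ∀ N, (f.1 N).totalDegree ≤ d)
    {M : ℕ} (hM : d ≤ M) (h : f.1 M = 0) : f = 0 := by
  rw [Sym.eq_sum_schur hf hM]
  simp [h]

theorem linearIndependent_schur : LinearIndependent ℂ schur := by
  rw [linearIndependent_iff']
  intro s c hc ν hν
  have h1 := congrArg (fun f : Sym => schurCoeff ν (ν.colLen 0) (f.1 (ν.colLen 0))) hc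
  simp only [AddSubmonoidClass.coe_finsetSum, Finset.sum_apply, map_sum] at h1
  have h2 : ∀ μ, schurCoeff ν (ν.colLen 0) ((c μ • schur μ : Sym).1 (ν.colLen 0)) =
      if μ = ν then c μ else 0 := fun μ => by
    have h3 : (c μ • schur μ : Sym).1 (ν.colLen 0) =
      c μ • multivariate (fun n => Polynomial.X ^ n) μ (ν.colLen 0) := rfl
    rw [h3, map_smul, schurCoeff_multivariate le_rfl]
    simp
  simp only [h2, Finset.sum_ite_eq', hν, if_true] at h1
  rw [h1]
  exact map_zero _

/-- The basis of Schur functions. -/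
noncomputable def schurBasis : Module.Basis YoungDiagram ℂ Sym :=
  Module.Basis.mk linearIndependent_schur fun f _ => by
    obtain ⟨d, hd⟩ := f.2.2.2
    rw [Sym.eq_sum_schur hd le_rfl]
    exact Submodule.sum_mem _ fun μ _ => Submodule.smul_mem _ _ (Submodule.subset_span ⟨μ, rfl⟩)

theorem schurBasis_apply (ν : YoungDiagram) : schurBasis ν = schur ν := by
  simp [schurBasis]

/-! ### Leading forms -/

section LeadingForms

variable {σ τ : Type*}

/-- Polynomials all of whose monomials have degree smaller than `d`. -/
noncomputable def degreeLT (τ : Type*) (d : ℕ) : Submodule ℂ (MvPolynomial τ ℂ) :=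
  restrictSupport ℂ {m | m.degree < d}

theorem mem_degreeLT {d : ℕ} {p : MvPolynomial τ ℂ} :
    p ∈ degreeLT τ d ↔ ∀ m, coeff m p ≠ 0 → m.degree < d := by
  simp only [degreeLT, mem_restrictSupport_iff, Set.subset_def, Finset.mem_coe, mem_support_iff]
  rfl

theorem mem_degreeLT_succ {d : ℕ} {p : MvPolynomial τ ℂ} :
    p ∈ degreeLT τ (d + 1) ↔ p.totalDegree ≤ d := by
  rw [mem_degreeLT, totalDegree, Finset.sup_le_iff]
  simp only [mem_support_iff, Nat.lt_succ_iff]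
  rfl

theorem degreeLT_zero {p : MvPolynomial τ ℂ} (h : p ∈ degreeLT τ 0) : p = 0 := by
  ext m
  by_contra hm
  simpa using mem_degreeLT.1 h m hm

theorem degreeLT_mono {a b : ℕ} (h : a ≤ b) : degreeLT τ a ≤ degreeLT τ b :=
  restrictSupport_mono _ fun _ hm => lt_of_lt_of_le hm h

/-- Degree `< a` times degree `≤ b`: the asymmetric form avoids truncated subtraction. -/
theorem mul_mem_degreeLT {a b : ℕ} {p q : MvPolynomial τ ℂ} (hp : p ∈ degreeLT τ a)
    (hq : q ∈ degreeLT τ (b + 1)) : p * q ∈ degreeLT τ (a + b) := by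
  classical
  have h1 := Submodule.mul_mem_mul hp hq
  rw [degreeLT, degreeLT, ← restrictSupport_add] at h1
  refine restrictSupport_mono _ ?_ h1
  rintro _ ⟨m, hm, n, hn, rfl⟩
  simp only [Set.mem_ofPred_eq, map_add] at hm hn ⊢
  omega

theorem mem_degreeLT_of_isHomogeneous {d : ℕ} {p : MvPolynomial τ ℂ} (hp : p.IsHomogeneous d) :
    p ∈ degreeLT τ (d + 1) := mem_degreeLT_succ.2 hp.totalDegree_le

/-- `p` has degree at most `d`, and agrees with `q` up to terms of degree less than `d`. -/
structure LeadingAgree (d : ℕ) (p q : MvPolynomial τ ℂ) : Prop where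
  sub_mem : p - q ∈ degreeLT τ d
  right_mem : q ∈ degreeLT τ (d + 1)

theorem LeadingAgree.left_mem {d : ℕ} {p q : MvPolynomial τ ℂ} (h : LeadingAgree d p q) :
    p ∈ degreeLT τ (d + 1) := by
  have := (degreeLT τ (d + 1)).add_mem (degreeLT_mono (Nat.le_succ d) h.sub_mem) h.right_mem
  simpa using this

theorem LeadingAgree.mul {d d' : ℕ} {p q p' q' : MvPolynomial τ ℂ} (h : LeadingAgree d p q)
    (h' : LeadingAgree d' p' q') : LeadingAgree (d + d') (p * p') (q * q') := by
  constructor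
  · have e : p * p' - q * q' = (p - q) * p' + (p' - q') * q := by ring
    rw [e]
    refine Submodule.add_mem _ (mul_mem_degreeLT h.sub_mem h'.left_mem) ?_
    rw [add_comm d]
    exact mul_mem_degreeLT h'.sub_mem h.right_mem
  · have := mul_mem_degreeLT h.right_mem h'.right_mem
    rwa [show d + 1 + d' = d + d' + 1 by ring] at this

theorem LeadingAgree.one : LeadingAgree 0 (1 : MvPolynomial τ ℂ) 1 :=
  ⟨by simp, mem_degreeLT_succ.2 (by simp)⟩

theorem LeadingAgree.pow {d : ℕ} {p q : MvPolynomial τ ℂ} (h : LeadingAgree d p q) (n : ℕ) :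
    LeadingAgree (n * d) (p ^ n) (q ^ n) := by
  induction n with
  | zero => simpa using LeadingAgree.one
  | succ n ih =>
    rw [pow_succ, pow_succ, Nat.succ_mul]
    exact ih.mul h

theorem LeadingAgree.prod {ι : Type*} (s : Finset ι) {d : ι → ℕ} {p q : ι → MvPolynomial τ ℂ}
    (h : ∀ i, LeadingAgree (d i) (p i) (q i)) :
    LeadingAgree (∑ i ∈ s, d i) (∏ i ∈ s, p i) (∏ i ∈ s, q i) := by
  classical
  induction s using Finset.induction_on with
  | empty => simpa using LeadingAgree.one
  | insert a s ha ih =>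
    rw [Finset.sum_insert ha, Finset.prod_insert ha, Finset.prod_insert ha]
    exact (h a).mul ih

theorem LeadingAgree.sum {ι : Type*} (s : Finset ι) {d : ℕ} {p q : ι → MvPolynomial τ ℂ}
    (h : ∀ i ∈ s, LeadingAgree d (p i) (q i)) :
    LeadingAgree d (∑ i ∈ s, p i) (∑ i ∈ s, q i) := by
  constructor
  · rw [← Finset.sum_sub_distrib]
    exact Submodule.sum_mem _ fun i hi => (h i hi).sub_mem
  · exact Submodule.sum_mem _ fun i hi => (h i hi).right_mem

theorem LeadingAgree.smul {d : ℕ} {p q : MvPolynomial τ ℂ} (h : LeadingAgree d p q) (c : ℂ) :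
    LeadingAgree d (c • p) (c • q) := by
  constructor
  · rw [← smul_sub]
    exact Submodule.smul_mem _ _ h.sub_mem
  · exact Submodule.smul_mem _ _ h.right_mem

theorem algHom_apply_eq_sum (α : MvPolynomial σ ℂ →ₐ[ℂ] MvPolynomial τ ℂ) (Q : MvPolynomial σ ℂ) :
    α Q = ∑ m ∈ Q.support, coeff m Q • ∏ i ∈ m.support, α (X i) ^ m i := by
  conv_lhs => rw [Q.as_sum, map_sum]
  refine Finset.sum_congr rfl fun m _ => ?_
  rw [monomial_eq, ← smul_eq_C_mul, map_smul, Finsupp.prod, map_prod]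
  simp only [map_pow]

theorem LeadingAgree.of_lt {d d' : ℕ} {p q : MvPolynomial τ ℂ} (h : LeadingAgree d p q)
    (hd : d < d') : LeadingAgree d' p q :=
  ⟨degreeLT_mono hd.le h.sub_mem, degreeLT_mono (by omega) h.right_mem⟩

theorem LeadingAgree.trans {d : ℕ} {p q r : MvPolynomial τ ℂ} (h : LeadingAgree d p q)
    (h' : LeadingAgree d q r) : LeadingAgree d p r :=
  ⟨by simpa using Submodule.add_mem _ h.sub_mem h'.sub_mem, h'.right_mem⟩

/-- Generators are weighted by the degrees of their images. Monomials of weight `d` agree in their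
leading forms, and lighter ones lie below degree `d` on both sides. -/
theorem LeadingAgree.algHom {w : σ → ℕ} {α β : MvPolynomial σ ℂ →ₐ[ℂ] MvPolynomial τ ℂ}
    (h : ∀ i, LeadingAgree (w i) (α (X i)) (β (X i))) {d : ℕ} {Q : MvPolynomial σ ℂ}
    (hQ : ∀ m, coeff m Q ≠ 0 → Finsupp.weight w m ≤ d) : LeadingAgree d (α Q) (β Q) := by
  rw [algHom_apply_eq_sum, algHom_apply_eq_sum]
  refine LeadingAgree.sum _ fun m hm => LeadingAgree.smul ?_ _
  have h1 := hQ m (mem_support_iff.1 hm)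
  have h2 := LeadingAgree.prod m.support fun i => (h i).pow (m i)
  rw [Finsupp.weight_apply, Finsupp.sum] at h1
  rcases h1.eq_or_lt with h3 | h3
  · rw [← h3]
    exact h2
  · exact h2.of_lt h3

theorem isHomogeneous_algHom {w : σ → ℕ} {α : MvPolynomial σ ℂ →ₐ[ℂ] MvPolynomial τ ℂ}
    (h : ∀ i, (α (X i)).IsHomogeneous (w i)) {d : ℕ} {Q : MvPolynomial σ ℂ}
    (hQ : Q.IsWeightedHomogeneous w d) : (α Q).IsHomogeneous d := by
  rw [algHom_apply_eq_sum]
  refine IsHomogeneous.sum _ _ _ fun m hm => ?_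
  rw [smul_eq_C_mul]
  refine IsHomogeneous.C_mul ?_ _
  have h1 := hQ (mem_support_iff.1 hm)
  rw [Finsupp.weight_apply, Finsupp.sum] at h1
  rw [← h1]
  refine IsHomogeneous.prod _ _ _ fun i _ => ?_
  rw [smul_eq_mul, mul_comm]
  exact (h i).pow (m i)

theorem homogeneousComponent_algHom {w : σ → ℕ} {α : MvPolynomial σ ℂ →ₐ[ℂ] MvPolynomial τ ℂ}
    (h : ∀ i, (α (X i)).IsHomogeneous (w i)) (d : ℕ) (Q : MvPolynomial σ ℂ) :
    homogeneousComponent d (α Q) = α (weightedHomogeneousComponent w d Q) := by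
  induction Q using MvPolynomial.induction_on' with
  | monomial m c =>
    have h1 := isWeightedHomogeneous_monomial w m c rfl
    rw [weightedHomogeneousComponent_of_mem h1,
      homogeneousComponent_of_mem (isHomogeneous_algHom h h1)]
    split_ifs <;> simp
  | add p q hp hq => simp [map_add, hp, hq]

theorem sub_homogeneousComponent_mem {d : ℕ} {p : MvPolynomial τ ℂ} (h : p ∈ degreeLT τ (d + 1)) :
    LeadingAgree d p (homogeneousComponent d p) := by
  refine ⟨mem_degreeLT.2 fun m hm => ?_, mem_degreeLT_of_isHomogeneous
    (homogeneousComponent_isHomogeneous d p)⟩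
  classical
  rw [coeff_sub, coeff_homogeneousComponent] at hm
  by_cases hd : m.degree = d
  · simp [hd] at hm
  · rw [if_neg hd, sub_zero] at hm
    have := mem_degreeLT.1 h m hm
    omega

theorem LeadingAgree.homogeneousComponent_eq {d : ℕ} {p q : MvPolynomial τ ℂ}
    (h : LeadingAgree d p q) : homogeneousComponent d p = homogeneousComponent d q := by
  rw [← sub_eq_zero, ← map_sub]
  ext m
  classical
  rw [coeff_homogeneousComponent, coeff_zero]
  split_ifs with hd
  · by_contra hm
    have := mem_degreeLT.1 h.sub_mem m hm
    omega
  · rfl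

end LeadingForms

/-! ### Power sums -/

/-- The kernels of the iterates stabilize, say at `n`. If `f` kills `x = f^n y`, then `y` lies in
the kernel of `f^(n+1)`, hence in that of `f^n`, so `x = 0`. -/
theorem injective_of_surjective_ringHom {R : Type*} [CommRing R] [IsNoetherianRing R] (f : R →+* R)
    (hf : Function.Surjective f) : Function.Injective f := by
  let g : ℕ →o Ideal R := ⟨fun n => RingHom.ker (f ^ n), monotone_nat_of_le_succ fun n x hx => by
    rw [RingHom.mem_ker] at hx ⊢
    rw [pow_succ', RingHom.mul_def, RingHom.comp_apply, hx, map_zero]⟩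
  obtain ⟨n, hn⟩ := monotone_stabilizes_iff_noetherian.2 ‹IsNoetherianRing R› g
  rw [injective_iff_map_eq_zero]
  intro x hx
  have hsurj : Function.Surjective (f ^ n : R →+* R) := by
    rw [RingHom.coe_pow]
    exact hf.iterate n
  obtain ⟨y, rfl⟩ := hsurj x
  have h1 : y ∈ g (n + 1) := by
    change (f ^ (n + 1)) y = 0
    rw [pow_succ', RingHom.mul_def, RingHom.comp_apply, hx]
  rw [← hn (n + 1) (Nat.le_succ n)] at h1
  exact h1

/-- Newton's identities express `k e_k` through lower `e_j` and `p_1, …, p_k`; division by `k` is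
possible over `ℂ`. -/
theorem esymm_mem_range_psum (N : ℕ) : ∀ k ≤ N, esymm (Fin N) ℂ k ∈
    (aeval fun i : Fin N => psum (Fin N) ℂ (i + 1) :
      MvPolynomial (Fin N) ℂ →ₐ[ℂ] MvPolynomial (Fin N) ℂ).range := by
  intro k
  induction k using Nat.strong_induction_on with
  | _ k ih =>
    intro hk
    rcases Nat.eq_zero_or_pos k with rfl | hpos
    · simp
    set S := (aeval fun i : Fin N => psum (Fin N) ℂ (i + 1) :
      MvPolynomial (Fin N) ℂ →ₐ[ℂ] MvPolynomial (Fin N) ℂ).range with hS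
    have h1 : (k : MvPolynomial (Fin N) ℂ) * esymm (Fin N) ℂ k ∈ S := by
      rw [mul_esymm_eq_sum]
      refine S.mul_mem (S.pow_mem (S.neg_mem S.one_mem) _) (S.sum_mem fun a ha => ?_)
      obtain ⟨h2, h3⟩ := Finset.mem_filter.1 ha
      rw [Finset.HasAntidiagonal.mem_antidiagonal] at h2
      refine S.mul_mem (S.mul_mem (S.pow_mem (S.neg_mem S.one_mem) _) (ih _ h3 (by omega))) ?_
      refine ⟨X ⟨a.2 - 1, by omega⟩, ?_⟩
      have : a.2 - 1 + 1 = a.2 := by omega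
      simp [this]
    have h2 := S.smul_mem h1 ((k : ℂ)⁻¹)
    have h3 : (k : ℂ) ≠ 0 := by exact_mod_cast hpos.ne'
    have e : (k : MvPolynomial (Fin N) ℂ) = C (k : ℂ) := by simp
    rwa [e, ← smul_eq_C_mul, smul_smul, inv_mul_cancel₀ h3, one_smul] at h2

theorem exists_aeval_psum_eq {N : ℕ} {f : MvPolynomial (Fin N) ℂ} (hf : f.IsSymmetric) :
    ∃ Q : MvPolynomial (Fin N) ℂ, aeval (fun i : Fin N => psum (Fin N) ℂ (i + 1)) Q = f := by
  obtain ⟨P, hP⟩ := (esymmAlgHom_fin_bijective ℂ N).2 ⟨f, hf⟩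
  have h1 : f = aeval (fun i : Fin N => esymm (Fin N) ℂ (i + 1)) P := by
    rw [← esymmAlgHom_apply, hP]
  have h2 : f ∈ (aeval fun i : Fin N => psum (Fin N) ℂ (i + 1) :
      MvPolynomial (Fin N) ℂ →ₐ[ℂ] MvPolynomial (Fin N) ℂ).range := by
    rw [h1, algHom_apply_eq_sum]
    refine Subalgebra.sum_mem _ fun m _ => Subalgebra.smul_mem _ (Subalgebra.prod_mem _
      fun i _ => Subalgebra.pow_mem _ ?_ _) _
    rw [aeval_X]
    exact esymm_mem_range_psum N _ i.2
  exact h2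

/-- Writing the `p_k` as polynomials in the free generators `e_k` defines an endomorphism `θ` of a
Noetherian ring. It is surjective because the `p_k` also generate, hence injective. -/
theorem aeval_psum_injective (N : ℕ) : Function.Injective
    (aeval fun i : Fin N => psum (Fin N) ℂ (i + 1) :
      MvPolynomial (Fin N) ℂ →ₐ[ℂ] MvPolynomial (Fin N) ℂ) := by
  have hinj : Function.Injective (aeval fun i : Fin N => esymm (Fin N) ℂ (i + 1) :
      MvPolynomial (Fin N) ℂ →ₐ[ℂ] MvPolynomial (Fin N) ℂ) := by
    intro P P' h
    refine (esymmAlgHom_fin_bijective ℂ N).1 (Subtype.ext ?_)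
    rw [esymmAlgHom_apply, esymmAlgHom_apply, h]
  have hsurj : ∀ f : MvPolynomial (Fin N) ℂ, f.IsSymmetric →
      ∃ P, aeval (fun i : Fin N => esymm (Fin N) ℂ (i + 1)) P = f := fun f hf => by
    obtain ⟨P, hP⟩ := (esymmAlgHom_fin_bijective ℂ N).2 ⟨f, hf⟩
    exact ⟨P, by rw [← esymmAlgHom_apply, hP]⟩
  choose p hp using fun i : Fin N => hsurj _ (psum_isSymmetric (Fin N) ℂ (i + 1))
  let θ : MvPolynomial (Fin N) ℂ →ₐ[ℂ] MvPolynomial (Fin N) ℂ := aeval p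
  have hcomp : (aeval fun i : Fin N => psum (Fin N) ℂ (i + 1) :
      MvPolynomial (Fin N) ℂ →ₐ[ℂ] MvPolynomial (Fin N) ℂ) =
      (aeval fun i : Fin N => esymm (Fin N) ℂ (i + 1)).comp θ := by
    ext1 i
    rw [AlgHom.comp_apply, aeval_X, aeval_X, hp]
  have hθ : Function.Surjective θ := fun P => by
    have hs : (aeval (fun i : Fin N => esymm (Fin N) ℂ (i + 1)) P).IsSymmetric := by
      rw [← esymmAlgHom_apply]
      exact (esymmAlgHom (Fin N) ℂ N P).2
    obtain ⟨Q, hQ⟩ := exists_aeval_psum_eq hs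
    exact ⟨Q, hinj (by rw [← hQ, hcomp]; rfl)⟩
  rw [hcomp]
  exact hinj.comp (injective_of_surjective_ringHom θ.toRingHom hθ)

/-! ### Polynomial expressions in power sums -/

theorem aeval_powerSum_apply (P : MvPolynomial ℕ ℂ) (N : ℕ) :
    (aeval powerSum P : Sym).1 N = aeval (fun k => psum (Fin N) ℂ (k + 1)) P := by
  have : ((Pi.evalAlgHom ℂ (fun N => MvPolynomial (Fin N) ℂ) N).comp Sym.val).comp
      (aeval powerSum) = aeval (fun k => psum (Fin N) ℂ (k + 1)) := by
    ext1 k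
    rw [AlgHom.comp_apply, aeval_X, aeval_X]
    rfl
  exact DFunLike.congr_fun this P

theorem aeval_shiftedPowerSum_apply (P : MvPolynomial ℕ ℂ) (N : ℕ) :
    aeval shiftedPowerSum P N = aeval (fun k => shiftedPowerSum k N) P := by
  have : (Pi.evalAlgHom ℂ (fun N => MvPolynomial (Fin N) ℂ) N).comp
      (aeval shiftedPowerSum) = aeval (fun k => shiftedPowerSum k N) := by
    ext1 k
    rw [AlgHom.comp_apply, aeval_X, aeval_X]
    rfl
  exact DFunLike.congr_fun this P

/-- A polynomial involves finitely many variables, so independence of the first `N` generators in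
`N` variables, for every `N`, suffices. -/
theorem eq_zero_of_injective_truncations {f : ∀ N : ℕ, ℕ → MvPolynomial (Fin N) ℂ}
    (hf : ∀ N, Function.Injective (aeval (fun i : Fin N => f N i) :
      MvPolynomial (Fin N) ℂ →ₐ[ℂ] MvPolynomial (Fin N) ℂ)) {P : MvPolynomial ℕ ℂ}
    (hP : ∀ N, aeval (f N) P = 0) : P = 0 := by
  obtain ⟨N, hN⟩ : ∃ N, ∀ k ∈ P.vars, k < N :=
    ⟨P.vars.sup id + 1, fun k hk => Nat.lt_succ_of_le (Finset.le_sup (f := id) hk)⟩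
  obtain ⟨Q, rfl⟩ := exists_rename_eq_of_vars_subset_range P (Fin.val : Fin N → ℕ)
    Fin.val_injective fun k hk => ⟨⟨k, hN k hk⟩, rfl⟩
  have h1 := hP N
  rw [aeval_rename] at h1
  have h2 : Q = 0 := (injective_iff_map_eq_zero _).1 (hf N) Q h1
  rw [h2, map_zero]

theorem aeval_powerSum_injective :
    Function.Injective (aeval powerSum : MvPolynomial ℕ ℂ →ₐ[ℂ] Sym) := by
  rw [injective_iff_map_eq_zero]
  intro P hP
  refine eq_zero_of_injective_truncations (f := fun N k => psum (Fin N) ℂ (k + 1))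
    aeval_psum_injective fun N => ?_
  rw [← aeval_powerSum_apply, hP]
  rfl

theorem isHomogeneous_psum (N k : ℕ) : (psum (Fin N) ℂ k).IsHomogeneous k := by
  refine IsHomogeneous.sum _ _ _ fun i _ => ?_
  simpa using (isHomogeneous_X ℂ i).pow k

theorem homogeneousComponent_aeval_psum (N d : ℕ) (Q : MvPolynomial ℕ ℂ) :
    homogeneousComponent d (aeval (fun k => psum (Fin N) ℂ (k + 1)) Q) =
      aeval (fun k => psum (Fin N) ℂ (k + 1)) (weightedHomogeneousComponent (· + 1) d Q) :=
  homogeneousComponent_algHom (fun k => by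
    rw [aeval_X]; exact isHomogeneous_psum N (k + 1)) d Q

theorem aeval_powerSum_surjective :
    Function.Surjective (aeval powerSum : MvPolynomial ℕ ℂ →ₐ[ℂ] Sym) := by
  intro f
  obtain ⟨d, hd⟩ := f.2.2.2
  obtain ⟨Q₀, hQ₀⟩ := exists_aeval_psum_eq (f.2.1 d)
  set Q₁ : MvPolynomial ℕ ℂ := rename Fin.val Q₀ with hQ₁
  have h1 : aeval (fun k => psum (Fin d) ℂ (k + 1)) Q₁ = f.1 d := by
    rw [hQ₁, aeval_rename]
    exact hQ₀
  -- Discarding weights above `d` bounds the degree for every `N` while leaving the value at `N = d`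
  -- unchanged; equality with `d` variables then determines the element of `Sym`.
  set Q := ∑ n ∈ Finset.range (d + 1), weightedHomogeneousComponent (· + 1) n Q₁ with hQ
  have h2 : ∀ N, (aeval powerSum Q : Sym).1 N = ∑ n ∈ Finset.range (d + 1),
      homogeneousComponent n (aeval (fun k => psum (Fin N) ℂ (k + 1)) Q₁) := fun N => by
    rw [aeval_powerSum_apply, hQ, map_sum]
    simp only [homogeneousComponent_aeval_psum]
  refine ⟨Q, ?_⟩
  rw [← sub_eq_zero]
  refine Sym.eq_zero_of_apply_eq_zero (d := d) (fun N => ?_) le_rfl ?_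
  · refine (totalDegree_sub _ _).trans (max_le ?_ (hd N))
    rw [h2]
    refine totalDegree_finsetSum_le fun n hn => ?_
    have := Finset.mem_range.1 hn
    exact (homogeneousComponent_isHomogeneous n _).totalDegree_le.trans (by omega)
  · change (aeval powerSum Q : Sym).1 d - f.1 d = 0
    rw [h2, h1, sub_eq_zero]
    conv_rhs => rw [← sum_homogeneousComponent (f.1 d)]
    symm
    refine Finset.sum_subset (Finset.range_mono (Nat.succ_le_succ (hd d))) fun n _ hn => ?_
    rw [Finset.mem_range, not_lt] at hn
    exact homogeneousComponent_eq_zero _ _ hn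

theorem exists_isWeightedHomogeneous_aeval_powerSum {f : Sym} {d : ℕ}
    (hf : ∀ N, (f.1 N).IsHomogeneous d) : ∃ Q : MvPolynomial ℕ ℂ,
      Q.IsWeightedHomogeneous (· + 1) d ∧ aeval powerSum Q = f := by
  obtain ⟨Q, rfl⟩ := aeval_powerSum_surjective f
  refine ⟨weightedHomogeneousComponent (· + 1) d Q,
    weightedHomogeneousComponent_isWeightedHomogeneous _ _, Subtype.ext (funext fun N => ?_)⟩
  rw [aeval_powerSum_apply, ← homogeneousComponent_aeval_psum, ← aeval_powerSum_apply]
  exact homogeneousComponent_eq_self (hf N)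

/-! ### Translations of the variables and shifted symmetric functions -/

/-- Translation of the variables. -/
noncomputable def translate {σ : Type*} (a : σ → ℂ) : MvPolynomial σ ℂ →ₐ[ℂ] MvPolynomial σ ℂ :=
  aeval fun i => X i + C (a i)

theorem translate_X {σ : Type*} (a : σ → ℂ) (i : σ) : translate a (X i) = X i + C (a i) := by
  simp [translate]

theorem translate_translate {σ : Type*} (a b : σ → ℂ) (p : MvPolynomial σ ℂ) :
    translate a (translate b p) = translate (a + b) p := by
  have : (translate a).comp (translate b) = translate (a + b) := by
    ext1 i
    rw [AlgHom.comp_apply, translate_X, translate_X, map_add, translate_X, ← algebraMap_eq,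
      AlgHom.commutes]
    simp [algebraMap_eq, add_assoc]
  exact DFunLike.congr_fun this p

theorem translate_zero {σ : Type*} (p : MvPolynomial σ ℂ) : translate 0 p = p := by
  have : translate (0 : σ → ℂ) = AlgHom.id ℂ _ := by
    ext1 i
    simp [translate_X]
  rw [this]
  rfl

theorem translate_neg_translate {σ : Type*} (a : σ → ℂ) (p : MvPolynomial σ ℂ) :
    translate (-a) (translate a p) = p := by
  rw [translate_translate, neg_add_cancel, translate_zero]

theorem translate_injective {σ : Type*} (a : σ → ℂ) : Function.Injective (translate a) :=
  Function.LeftInverse.injective (translate_neg_translate a)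

theorem leadingAgree_X_add_C {σ : Type*} (i : σ) (c : ℂ) :
    LeadingAgree 1 (X i + C c : MvPolynomial σ ℂ) (X i) := by
  refine ⟨?_, mem_degreeLT_of_isHomogeneous (isHomogeneous_X ℂ i)⟩
  rw [add_sub_cancel_left]
  exact mem_degreeLT_succ.2 (by simp)

theorem leadingAgree_translate {σ : Type*} (a : σ → ℂ) {d : ℕ} {p : MvPolynomial σ ℂ}
    (hp : p ∈ degreeLT σ (d + 1)) : LeadingAgree d (translate a p) p := by
  refine LeadingAgree.algHom (w := 1) (β := AlgHom.id ℂ _) (fun i => ?_) fun m hm => ?_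
  · rw [translate_X]
    exact leadingAgree_X_add_C i (a i)
  · have h1 := mem_degreeLT.1 hp m hm
    rw [Finsupp.degree_eq_weight_one] at h1
    exact Nat.lt_succ_iff.1 h1

/-- The substitution `x_i = y_i + N - i`. -/
noncomputable def staircase (N : ℕ) (i : Fin N) : ℂ := ((N - 1 - i : ℕ) : ℂ)

theorem staircase_eq (N : ℕ) (i : Fin N) : staircase N i = N - 1 - (i : ℕ) := by
  have : (N : ℂ) = ((N - 1 - i : ℕ) : ℂ) + 1 + (i : ℕ) := by
    have : N = (N - 1 - i) + 1 + i := by omega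
    exact_mod_cast this
  rw [staircase, this]
  ring

theorem shiftedSchur_eq (ν : YoungDiagram) (N : ℕ) : shiftedSchur ν N =
    translate (staircase N) (multivariate (fun n => descPochhammer ℂ n) ν N) := rfl

theorem shiftedPowerSum_eq (k N : ℕ) : shiftedPowerSum k N =
    translate (fun i : Fin N => -((i : ℕ) + 1 : ℂ) + 1 / 2) (psum (Fin N) ℂ (k + 1)) -
      C (∑ i : Fin N, (-((i : ℕ) + 1 : ℂ) + 1 / 2) ^ (k + 1)) := by
  rw [shiftedPowerSum, Finset.sum_sub_distrib, psum, map_sum, map_sum C]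
  simp only [map_pow, translate_X]

theorem leadingAgree_shiftedPowerSum (k N : ℕ) :
    LeadingAgree (k + 1) (shiftedPowerSum k N) (psum (Fin N) ℂ (k + 1)) := by
  have h1 := leadingAgree_translate (fun i : Fin N => -((i : ℕ) + 1 : ℂ) + 1 / 2)
    (mem_degreeLT_of_isHomogeneous (isHomogeneous_psum N (k + 1)))
  refine ⟨?_, h1.right_mem⟩
  rw [shiftedPowerSum_eq, sub_right_comm]
  exact Submodule.sub_mem _ h1.sub_mem (mem_degreeLT_succ.2 (by rw [totalDegree_C]; omega))

/-- The subtracted constants make the last summand vanish when the last variable is `0`. -/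
theorem killLast_shiftedPowerSum (k N : ℕ) :
    killLast N (shiftedPowerSum k (N + 1)) = shiftedPowerSum k N := by
  rw [shiftedPowerSum, Fin.sum_univ_castSucc, map_add, map_sum]
  simp [killLast, shiftedPowerSum, algebraMap_eq]

/-- Shifted symmetric polynomials. -/
noncomputable def shiftedSymmetric (N : ℕ) : Subalgebra ℂ (MvPolynomial (Fin N) ℂ) :=
  (symmetricSubalgebra (Fin N) ℂ).map (translate (staircase N))

/-- Counting from `i = 1`, `y_i - i + 1/2 = x_i + (1/2 - N)` with `x_i = y_i + N - i`: a shift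
independent of `i`, hence symmetric in the `x_i`. -/
theorem shiftedPowerSum_mem (k N : ℕ) : shiftedPowerSum k N ∈ shiftedSymmetric N := by
  have h1 : translate (fun i : Fin N => -((i : ℕ) + 1 : ℂ) + 1 / 2) (psum (Fin N) ℂ (k + 1)) =
      translate (staircase N) (translate (fun _ => 1 / 2 - N) (psum (Fin N) ℂ (k + 1))) := by
    rw [translate_translate]
    congr 2
    ext i
    simp only [Pi.add_apply, staircase_eq]
    ring
  rw [shiftedPowerSum_eq, h1]
  refine Subalgebra.sub_mem _ ⟨_, ?_, rfl⟩ (Subalgebra.algebraMap_mem _ _)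
  intro σ
  simp only [psum, map_sum, map_pow, translate_X, map_add, rename_X, rename_C]
  exact Equiv.sum_comp σ fun i => (X i + C (1 / 2 - N : ℂ)) ^ (k + 1)

/-- Translating the generators, substituting power sums and translating the variables are each
injective, and their composite is the substitution of shifted power sums. -/
theorem aeval_shiftedPowerSum_truncated_injective (N : ℕ) : Function.Injective
    (aeval fun i : Fin N => shiftedPowerSum i N :
      MvPolynomial (Fin N) ℂ →ₐ[ℂ] MvPolynomial (Fin N) ℂ) := by
  let α : MvPolynomial (Fin N) ℂ →ₐ[ℂ] MvPolynomial (Fin N) ℂ :=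
    translate fun i : Fin N => -((i : ℕ) + 1 : ℂ) + 1 / 2
  let β : MvPolynomial (Fin N) ℂ →ₐ[ℂ] MvPolynomial (Fin N) ℂ :=
    aeval fun i : Fin N => psum (Fin N) ℂ (i + 1)
  let γ : MvPolynomial (Fin N) ℂ →ₐ[ℂ] MvPolynomial (Fin N) ℂ :=
    translate fun k : Fin N => -∑ i : Fin N, (-((i : ℕ) + 1 : ℂ) + 1 / 2) ^ ((k : ℕ) + 1)
  have h1 : ∀ k : Fin N, shiftedPowerSum k N = (α.comp (β.comp γ)) (X k) := fun k => by
    have h2 : γ (X k) = X k + C (-∑ i : Fin N, (-((i : ℕ) + 1 : ℂ) + 1 / 2) ^ ((k : ℕ) + 1)) :=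
      translate_X _ k
    have h3 : β (X k) = psum (Fin N) ℂ (k + 1) := aeval_X _ k
    rw [AlgHom.comp_apply, AlgHom.comp_apply, h2, map_add, h3, map_add, algHom_C, algebraMap_eq,
      algHom_C, algebraMap_eq, C_neg, ← sub_eq_add_neg]
    exact shiftedPowerSum_eq k N
  have h2 : (aeval fun i : Fin N => shiftedPowerSum i N :
      MvPolynomial (Fin N) ℂ →ₐ[ℂ] MvPolynomial (Fin N) ℂ) = α.comp (β.comp γ) := by
    simp only [h1]
    exact (aeval_unique _).symm
  have hα : Function.Injective α := translate_injective _
  have hβ : Function.Injective β := aeval_psum_injective N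
  have hγ : Function.Injective γ := translate_injective _
  rw [h2, AlgHom.coe_comp, AlgHom.coe_comp]
  exact hα.comp (hβ.comp hγ)

theorem aeval_shiftedPowerSum_injective : Function.Injective
    (aeval shiftedPowerSum : MvPolynomial ℕ ℂ →ₐ[ℂ] ∀ N : ℕ, MvPolynomial (Fin N) ℂ) := by
  rw [injective_iff_map_eq_zero]
  intro P hP
  refine eq_zero_of_injective_truncations (f := fun N k => shiftedPowerSum k N)
    aeval_shiftedPowerSum_truncated_injective fun N => ?_
  rw [← aeval_shiftedPowerSum_apply, hP]
  rfl

theorem killLast_aeval_shiftedPowerSum (P : MvPolynomial ℕ ℂ) (N : ℕ) :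
    killLast N (aeval shiftedPowerSum P (N + 1)) = aeval shiftedPowerSum P N := by
  rw [aeval_shiftedPowerSum_apply, aeval_shiftedPowerSum_apply]
  have : (killLast N).comp (aeval fun k => shiftedPowerSum k (N + 1)) =
      aeval fun k => shiftedPowerSum k N := by
    ext1 k
    simp [killLast_shiftedPowerSum]
  exact DFunLike.congr_fun this P

theorem aeval_shiftedPowerSum_mem (P : MvPolynomial ℕ ℂ) (N : ℕ) :
    aeval shiftedPowerSum P N ∈ shiftedSymmetric N := by
  rw [aeval_shiftedPowerSum_apply, algHom_apply_eq_sum]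
  refine Subalgebra.sum_mem _ fun m _ => Subalgebra.smul_mem _ (Subalgebra.prod_mem _
      fun i _ => Subalgebra.pow_mem _ ?_ _) _
  rw [aeval_X]
  exact shiftedPowerSum_mem i N

theorem isHomogeneous_killLast_X {N : ℕ} (i : Fin (N + 1)) :
    (killLast N (X i)).IsHomogeneous 1 := by
  cases i using Fin.lastCases with
  | last => simpa [killLast] using isHomogeneous_zero _ _ _
  | cast i => simpa [killLast] using isHomogeneous_X ℂ i

/-- Translation does not change the degree `d` component, so it equals that of an honest symmetric
polynomial. -/
theorem isSymmetric_homogeneousComponent {G : ∀ N : ℕ, MvPolynomial (Fin N) ℂ} {d : ℕ}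
    (hs : ∀ N, G N ∈ shiftedSymmetric N) (hd : ∀ N, G N ∈ degreeLT (Fin N) (d + 1)) (N : ℕ) :
    (homogeneousComponent d (G N)).IsSymmetric := by
  obtain ⟨H, hH, hHG⟩ := hs N
  have hH' : H.IsSymmetric := hH
  change translate (staircase N) H = G N at hHG
  have h1 : H = translate (-staircase N) (G N) := by rw [← hHG, translate_neg_translate]
  have h2 := leadingAgree_translate (-staircase N) (hd N)
  rw [← h1] at h2
  rw [← h2.homogeneousComponent_eq]
  intro σ
  rw [rename_homogeneousComponent, hH']

/-- Every compatible family of shifted symmetric polynomials of bounded degree is a polynomial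
expression in the shifted power sums. -/
theorem exists_aeval_shiftedPowerSum_eq (D : ℕ) : ∀ G : ∀ N : ℕ, MvPolynomial (Fin N) ℂ,
    (∀ N, G N ∈ shiftedSymmetric N) → (∀ N, killLast N (G (N + 1)) = G N) →
    (∀ N, G N ∈ degreeLT (Fin N) D) → ∃ Q : MvPolynomial ℕ ℂ, aeval shiftedPowerSum Q = G ∧
      ∀ N, (aeval powerSum Q : Sym).1 N - G N ∈ degreeLT (Fin N) (D - 1) := by
  induction D with
  | zero =>
    intro G _ _ hd
    have hG : G = 0 := funext fun N => degreeLT_zero (hd N)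
    refine ⟨0, by rw [map_zero, hG], fun N => ?_⟩
    rw [map_zero, hG]
    exact (degreeLT (Fin N) _).sub_mem (Submodule.zero_mem _) (Submodule.zero_mem _)
  | succ d ih =>
    intro G hs hk hd
    -- The top components form an element of `Sym`. Writing it in the `p_k` and substituting `p*_k`
    -- matches `G` in top degree; the remainder is handled by induction.
    let g : Sym := ⟨fun N => homogeneousComponent d (G N),
      isSymmetric_homogeneousComponent hs hd, fun N => by
        change killLast N (homogeneousComponent d (G (N + 1))) = homogeneousComponent d (G N)
        rw [← hk N]
        exact (homogeneousComponent_algHom (w := 1) isHomogeneous_killLast_X d (G (N + 1))).symm,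
      d, fun N => (homogeneousComponent_isHomogeneous d (G N)).totalDegree_le⟩
    obtain ⟨Q₁, hQ₁, hg⟩ := exists_isWeightedHomogeneous_aeval_powerSum (f := g) (d := d)
      fun N => homogeneousComponent_isHomogeneous d (G N)
    have h1 : ∀ N, LeadingAgree d (aeval shiftedPowerSum Q₁ N) (g.1 N) := fun N => by
      rw [← hg, aeval_powerSum_apply, aeval_shiftedPowerSum_apply]
      refine LeadingAgree.algHom (w := (· + 1)) (fun k => ?_) fun m hm => (hQ₁ hm).le
      rw [aeval_X, aeval_X]
      exact leadingAgree_shiftedPowerSum k N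
    have h2 : ∀ N, LeadingAgree d (G N) (g.1 N) := fun N => sub_homogeneousComponent_mem (hd N)
    have h3 : ∀ N, G N - aeval shiftedPowerSum Q₁ N ∈ degreeLT (Fin N) d := fun N => by
      have := Submodule.sub_mem _ (h2 N).sub_mem (h1 N).sub_mem
      rwa [sub_sub_sub_cancel_right] at this
    obtain ⟨Q₂, hQ₂, hQ₂'⟩ := ih (fun N => G N - aeval shiftedPowerSum Q₁ N)
      (fun N => Subalgebra.sub_mem _ (hs N) (aeval_shiftedPowerSum_mem Q₁ N))
      (fun N => by rw [map_sub, hk, killLast_aeval_shiftedPowerSum]) h3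
    refine ⟨Q₁ + Q₂, ?_, fun N => ?_⟩
    · rw [map_add, hQ₂]
      ext1 N
      simp
    · rw [map_add, hg]
      have h4 := Submodule.add_mem _ (degreeLT_mono (Nat.sub_le d 1) (hQ₂' N)) (h3 N)
      have h5 := Submodule.sub_mem _ h4 (h2 N).sub_mem
      have e : (g + aeval powerSum Q₂ : Sym).1 N - G N = (aeval powerSum Q₂ : Sym).1 N -
          (G N - aeval shiftedPowerSum Q₁ N) + (G N - aeval shiftedPowerSum Q₁ N) -
          (G N - g.1 N) := by
        change g.1 N + (aeval powerSum Q₂ : Sym).1 N - G N = _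
        ring
      rw [e]
      exact h5

/-! ### Stability and leading terms of the shifted Schur polynomials -/

theorem algHom_aeval_X {σ τ : Type*} (α : MvPolynomial σ ℂ →ₐ[ℂ] MvPolynomial τ ℂ) (i : σ)
    (p : Polynomial ℂ) : α (Polynomial.aeval (X i) p) = Polynomial.aeval (α (X i)) p :=
  (Polynomial.aeval_algHom_apply α (X i) p).symm

theorem aeval_zero_descPochhammer {A : Type*} [CommRing A] [Algebra ℂ A] (n : ℕ) :
    Polynomial.aeval (0 : A) (descPochhammer ℂ n) = if n = 0 then 1 else 0 := by
  split_ifs with h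
  · simp [h]
  · rw [← map_zero (algebraMap ℂ A), Polynomial.aeval_algebraMap_apply,
      Polynomial.coe_aeval_eq_eval, descPochhammer_ne_zero_eval_zero ℂ h, map_zero]

theorem aeval_add_one_descPochhammer_succ {A : Type*} [CommRing A] [Algebra ℂ A] (x : A) (n : ℕ) :
    Polynomial.aeval (x + 1) (descPochhammer ℂ (n + 1)) =
      (x + 1) * Polynomial.aeval x (descPochhammer ℂ n) := by
  rw [descPochhammer_succ_left, map_mul, Polynomial.aeval_X, Polynomial.aeval_comp]
  simp

/-- Setting the last variable to `0` leaves in its column only the last row, and only when that row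
of `ν` is empty. Shifting the other variables by `1` then takes a factor `x_j + 1` out of each
column. -/
theorem translate_one_killLast_alternant (ν : YoungDiagram) (N : ℕ) :
    translate 1 (killLast N (alternant (fun n => descPochhammer ℂ n) ν (N + 1))) =
      if ν.colLen 0 ≤ N then
        (∏ i, (X i + 1)) * alternant (fun n => descPochhammer ℂ n) ν N else 0 := by
  obtain ⟨κ, hκ⟩ : ∃ κ, κ = (translate 1).comp (killLast N) := ⟨_, rfl⟩
  have hc : ∀ j : Fin N, κ (X j.castSucc) = X j + 1 := fun j => by
    simp [hκ, killLast, translate_X]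
  have hl : κ (X (Fin.last N)) = 0 := by
    simp [hκ, killLast]
  rw [← AlgHom.comp_apply, ← hκ]
  unfold alternant
  rw [AlgHom.map_det, Matrix.det_succ_column _ (Fin.last N), Fin.sum_univ_castSucc,
    Finset.sum_eq_zero, zero_add]
  · simp only [AlgHom.mapMatrix_apply, Matrix.map_apply, Matrix.of_apply, algHom_aeval_X,
      hl, aeval_zero_descPochhammer, colLen_zero_le_iff]
    have h1 : (-1 : MvPolynomial (Fin N) ℂ) ^ (((Fin.last N : Fin (N + 1)) : ℕ) +
        ((Fin.last N : Fin (N + 1)) : ℕ)) = 1 := Even.neg_one_pow ⟨N, rfl⟩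
    have h2 : ν.rowLen (Fin.last N) + (N + 1 - 1 - (Fin.last N : Fin (N + 1))) = ν.rowLen N := by
      simp
    rw [h1, one_mul, h2]
    split_ifs with h3
    · rw [one_mul, ← Matrix.det_mul_row]
      congr 1
      ext1 i j
      simp only [Matrix.submatrix_apply, Matrix.map_apply, Matrix.of_apply, Fin.succAbove_last,
        algHom_aeval_X, hc]
      have : ν.rowLen i + (N - i) = ν.rowLen i + (N - 1 - i) + 1 := by omega
      simp only [Fin.val_castSucc, Nat.add_sub_cancel]
      rw [this, aeval_add_one_descPochhammer_succ]
    · rw [zero_mul]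
  · intro i _
    have h1 : ν.rowLen i + (N - i) ≠ 0 := by omega
    simp only [AlgHom.mapMatrix_apply, Matrix.map_apply, Matrix.of_apply, algHom_aeval_X,
      hl, aeval_zero_descPochhammer, Fin.val_castSucc, Nat.add_sub_cancel]
    rw [if_neg h1, mul_zero, zero_mul]

theorem translate_one_killLast_vdm (N : ℕ) :
    translate 1 (killLast N (vdm (N + 1))) = vdm N * ∏ i, (X i + 1) := by
  rw [killLast_vdm, map_mul, map_prod, vdm, map_prod]
  congr 1
  · refine Finset.prod_congr rfl fun i _ => ?_
    rw [map_prod]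
    refine Finset.prod_congr rfl fun j _ => ?_
    simp [translate_X]
  · simp [translate_X]

theorem translate_one_killLast_multivariate (ν : YoungDiagram) (N : ℕ) :
    translate 1 (killLast N (multivariate (fun n => descPochhammer ℂ n) ν (N + 1))) =
      multivariate (fun n => descPochhammer ℂ n) ν N := by
  have hP : (∏ i, (X i + 1) : MvPolynomial (Fin N) ℂ) ≠ 0 := by
    refine Finset.prod_ne_zero_iff.2 fun i _ h => ?_
    have := congrArg (eval 0) h
    simp at this
  by_cases h : ν.colLen 0 ≤ N + 1
  · have h1 := congrArg (fun p => translate 1 (killLast N p))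
      (vdm_mul_multivariate (fun n => descPochhammer ℂ n) h)
    simp only [map_mul] at h1
    rw [translate_one_killLast_vdm, translate_one_killLast_alternant] at h1
    split_ifs at h1 with h'
    · rw [← vdm_mul_multivariate _ h', mul_comm (vdm N), mul_assoc] at h1
      exact mul_left_cancel₀ (vdm_ne_zero N) (mul_left_cancel₀ hP h1)
    · have h2 : multivariate (fun n => descPochhammer ℂ n) ν N = 0 := by simp [multivariate, h']
      rw [h2]
      exact (mul_eq_zero.1 h1).resolve_left (mul_ne_zero (vdm_ne_zero N) hP)
  · have h' : ¬ ν.colLen 0 ≤ N := by omega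
    simp [multivariate, h, h']

/-- Passing from `N+1` to `N` variables lowers the staircase by one, which accounts for the shift by
`1` in the factorial version. -/
theorem killLast_shiftedSchur (ν : YoungDiagram) (N : ℕ) :
    killLast N (shiftedSchur ν (N + 1)) = shiftedSchur ν N := by
  have h1 : (killLast N).comp (translate (staircase (N + 1))) =
      (translate (staircase N)).comp ((translate 1).comp (killLast N)) := by
    refine algHom_ext fun i => ?_
    rw [AlgHom.comp_apply, AlgHom.comp_apply, AlgHom.comp_apply, translate_X, map_add, algHom_C,
      algebraMap_eq]
    cases i using Fin.lastCases with
    | last => simp [killLast, staircase]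
    | cast i =>
      have h2 : killLast N (X i.castSucc) = X i := by simp [killLast]
      rw [h2, translate_X, map_add, translate_X, algHom_C, algebraMap_eq, add_assoc, ← C_add,
        staircase_eq, staircase_eq]
      rw [Fin.val_castSucc, Pi.one_apply]
      push_cast
      congr 2
      ring
  rw [shiftedSchur_eq, shiftedSchur_eq]
  have h2 := DFunLike.congr_fun h1 (multivariate (fun n => descPochhammer ℂ n) ν (N + 1))
  rw [AlgHom.comp_apply, AlgHom.comp_apply, AlgHom.comp_apply,
    translate_one_killLast_multivariate] at h2
  exact h2

theorem leadingAgree_aeval_X {φ : ℕ → Polynomial ℂ} (hd : ∀ n, (φ n).natDegree = n)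
    (hm : ∀ n, (φ n).Monic) {σ : Type*} (j : σ) (n : ℕ) :
    LeadingAgree n (Polynomial.aeval (X j : MvPolynomial σ ℂ) (φ n)) (X j ^ n) := by
  have h1 : (X j ^ n : MvPolynomial σ ℂ).IsHomogeneous n := by
    simpa using (isHomogeneous_X ℂ j).pow n
  refine ⟨?_, mem_degreeLT_of_isHomogeneous h1⟩
  have h2 : Polynomial.aeval (X j : MvPolynomial σ ℂ) (φ n) - X j ^ n =
      ∑ k ∈ Finset.range n, (φ n).coeff k • X j ^ k := by
    rw [Polynomial.aeval_eq_sum_range, hd, Finset.sum_range_succ]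
    have := (hm n).coeff_natDegree
    rw [hd] at this
    rw [this, one_smul, add_sub_cancel_right]
  rw [h2]
  refine Submodule.sum_mem _ fun k hk => Submodule.smul_mem _ _ ?_
  have h3 : (X j ^ k : MvPolynomial σ ℂ).IsHomogeneous k := by
    simpa using (isHomogeneous_X ℂ j).pow k
  exact degreeLT_mono (Finset.mem_range.1 hk) (mem_degreeLT_of_isHomogeneous h3)

theorem leadingAgree_alternant {φ : ℕ → Polynomial ℂ} (hd : ∀ n, (φ n).natDegree = n)
    (hm : ∀ n, (φ n).Monic) (ν : YoungDiagram) (N : ℕ) :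
    LeadingAgree (∑ i, beads ν N i) (alternant φ ν N)
      (alternant (fun n => Polynomial.X ^ n) ν N) := by
  rw [alternant_eq_sum, alternant_eq_sum]
  refine LeadingAgree.sum _ fun σ _ => ?_
  rw [← smul_eq_C_mul, ← smul_eq_C_mul]
  refine LeadingAgree.smul ?_ _
  rw [← Equiv.sum_comp σ]
  refine LeadingAgree.prod _ fun j => ?_
  rw [map_pow, Polynomial.aeval_X]
  exact leadingAgree_aeval_X hd hm j _

/-- Total degree is additive over a domain, so the degree of `V_N` can be cancelled. -/
theorem mem_degreeLT_of_vdm_mul {N d : ℕ} {p : MvPolynomial (Fin N) ℂ}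
    (h : vdm N * p ∈ degreeLT (Fin N) (d + ∑ i : Fin N, (N - 1 - i))) :
    p ∈ degreeLT (Fin N) d := by
  by_cases hp : p = 0
  · rw [hp]
    exact Submodule.zero_mem _
  have h0 : vdm N * p ≠ 0 := mul_ne_zero (vdm_ne_zero N) hp
  obtain ⟨e, he⟩ : ∃ e, d + ∑ i : Fin N, (N - 1 - i : ℕ) = e + 1 := by
    refine Nat.exists_eq_succ_of_ne_zero fun h1 => h0 ?_
    rw [h1] at h
    exact degreeLT_zero h
  rw [he, mem_degreeLT_succ, totalDegree_mul_of_isDomain (vdm_ne_zero N) hp,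
    vdm_totalDegree] at h
  exact degreeLT_mono (by omega) (mem_degreeLT_succ.2 le_rfl)

theorem leadingAgree_multivariate {φ : ℕ → Polynomial ℂ} (hd : ∀ n, (φ n).natDegree = n)
    (hm : ∀ n, (φ n).Monic) (ν : YoungDiagram) (N : ℕ) :
    LeadingAgree ν.card (multivariate φ ν N) (multivariate (fun n => Polynomial.X ^ n) ν N) := by
  refine ⟨?_, mem_degreeLT_succ.2 (schur_totalDegree_le ν N)⟩
  by_cases h : ν.colLen 0 ≤ N
  · refine mem_degreeLT_of_vdm_mul ?_
    rw [mul_sub, vdm_mul_multivariate _ h, vdm_mul_multivariate _ h, ← sum_beads h]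
    exact (leadingAgree_alternant hd hm ν N).sub_mem
  · simp [multivariate, h]

theorem leadingAgree_shiftedSchur (ν : YoungDiagram) (N : ℕ) :
    LeadingAgree ν.card (shiftedSchur ν N) ((schur ν).1 N) := by
  have h := leadingAgree_multivariate (fun n => descPochhammer_natDegree ℂ n)
    (fun n => monic_descPochhammer ℂ n) ν N
  rw [shiftedSchur_eq]
  exact (leadingAgree_translate _ h.left_mem).trans h

/-! ### The Frobenius–Schur functions -/

/-- Generation by the `p*_k` makes the `epsilon` choice meaningful, and their independence
identifies its witness with the `Q` whose degree is controlled. So `FS_ν` has leading term `S_ν`. -/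
theorem exists_corresponds (ν : YoungDiagram) : ∃ Q : MvPolynomial ℕ ℂ,
    aeval shiftedPowerSum Q = shiftedSchur ν ∧ aeval powerSum Q = frobeniusSchur ν ∧
    ∀ N, (frobeniusSchur ν).1 N - (schur ν).1 N ∈ degreeLT (Fin N) ν.card := by
  obtain ⟨Q, hQ, hQ'⟩ := exists_aeval_shiftedPowerSum_eq (ν.card + 1) (shiftedSchur ν)
    (fun N => ⟨_, multivariate_isSymmetric (fun n => descPochhammer ℂ n) ν N, rfl⟩)
    (killLast_shiftedSchur ν) (fun N => (leadingAgree_shiftedSchur ν N).left_mem)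
  have h1 : Corresponds (shiftedSchur ν) (frobeniusSchur ν) :=
    Classical.epsilon_spec (p := fun F => Corresponds (shiftedSchur ν) F) ⟨_, Q, hQ, rfl⟩
  obtain ⟨P, hP, hP'⟩ := h1
  have hPQ : P = Q := aeval_shiftedPowerSum_injective (hP.trans hQ.symm)
  subst hPQ
  refine ⟨P, hQ, hP', fun N => ?_⟩
  rw [← hP']
  have h2 := Submodule.add_mem _ (hQ' N) (leadingAgree_shiftedSchur ν N).sub_mem
  rwa [sub_add_sub_cancel] at h2

theorem mem_span_schur {f : Sym} {d : ℕ} (hf : ∀ N, f.1 N ∈ degreeLT (Fin N) d) :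
    f ∈ Submodule.span ℂ (schurBasis '' {μ | μ.card < d}) := by
  cases d with
  | zero =>
    have : f = 0 := Subtype.ext (funext fun N => degreeLT_zero (hf N))
    rw [this]
    exact Submodule.zero_mem _
  | succ d =>
    rw [Sym.eq_sum_schur (fun N => mem_degreeLT_succ.1 (hf N)) le_rfl]
    refine Submodule.sum_mem _ fun μ hμ => Submodule.smul_mem _ _ (Submodule.subset_span ?_)
    rw [mem_diagramsUpTo] at hμ
    exact ⟨μ, Nat.lt_succ_of_le hμ, schurBasis_apply μ⟩

/-- Spanning is by induction along the filtration by number of boxes. For independence, `B ν ↦ K ν`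
is `id + n` with `n` lowering the filtration; a kernel element satisfies `f = -n f`, so it descends
to filtration zero. -/
theorem exists_basis_of_unitriangular {M : Type*} [AddCommGroup M] [Module ℂ M]
    (B : Module.Basis YoungDiagram ℂ M) {K : YoungDiagram → M}
    (hK : ∀ ν, K ν - B ν ∈ Submodule.span ℂ (B '' {μ | μ.card < ν.card})) :
    ∃ B' : Module.Basis YoungDiagram ℂ M, ⇑B' = K := by
  set F : ℕ → Submodule ℂ M := fun d => Submodule.span ℂ (B '' {μ | μ.card < d}) with hF
  have hmono : ∀ {a b : ℕ}, a ≤ b → F a ≤ F b := fun h =>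
    Submodule.span_mono (Set.image_mono fun μ (hμ : μ.card < _) => lt_of_lt_of_le hμ h)
  have hspan : ⊤ ≤ Submodule.span ℂ (Set.range K) := by
    have h1 : ∀ d, F d ≤ Submodule.span ℂ (Set.range K) := by
      intro d
      induction d with
      | zero => simp [hF]
      | succ d ih =>
        refine Submodule.span_le.2 ?_
        rintro _ ⟨μ, hμ, rfl⟩
        have h2 := ih (hmono (Nat.lt_succ_iff.1 hμ) (hK μ))
        have h3 := Submodule.sub_mem _ (Submodule.subset_span ⟨μ, rfl⟩ :
          K μ ∈ Submodule.span ℂ (Set.range K)) h2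
        rwa [sub_sub_cancel] at h3
    rw [← B.span_eq]
    refine Submodule.span_le.2 ?_
    rintro _ ⟨μ, rfl⟩
    exact h1 (μ.card + 1) (Submodule.subset_span ⟨μ, Nat.lt_succ_self _, rfl⟩)
  set n : M →ₗ[ℂ] M := B.constr ℂ fun ν => K ν - B ν with hn
  have hlow : ∀ d, ∀ f ∈ F (d + 1), n f ∈ F d := by
    intro d f hf
    have h1 : F (d + 1) ≤ (F d).comap n := by
      refine Submodule.span_le.2 ?_
      rintro _ ⟨μ, hμ, rfl⟩
      change n (B μ) ∈ F d
      rw [hn, Module.Basis.constr_basis]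
      exact hmono (Nat.lt_succ_iff.1 hμ) (hK μ)
    exact h1 hf
  have hker : LinearMap.ker (LinearMap.id + n) = ⊥ := by
    rw [Submodule.eq_bot_iff]
    intro f hf
    have hf' : f = -n f := by
      rw [LinearMap.mem_ker, LinearMap.add_apply, LinearMap.id_apply] at hf
      exact eq_neg_of_add_eq_zero_left hf
    have h0 : ∃ D, f ∈ F D := by
      have h1 := B.linearCombination_repr f
      rw [Finsupp.linearCombination_apply, Finsupp.sum] at h1
      have h2 : ∑ μ ∈ (B.repr f).support, B.repr f μ • B μ ∈
          F ((B.repr f).support.sup YoungDiagram.card + 1) :=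
        Submodule.sum_mem _ fun μ hμ => Submodule.smul_mem _ _ (Submodule.subset_span
          ⟨μ, Nat.lt_succ_of_le (Finset.le_sup (f := YoungDiagram.card) hμ), rfl⟩)
      rw [h1] at h2
      exact ⟨_, h2⟩
    obtain ⟨D, hD⟩ := h0
    induction D with
    | zero => simpa [hF] using hD
    | succ D ih =>
      refine ih ?_
      rw [hf']
      exact Submodule.neg_mem _ (hlow D f hD)
  have hli : LinearIndependent ℂ K := by
    have h1 := B.linearIndependent.map' _ hker
    have h2 : ⇑(LinearMap.id + n : M →ₗ[ℂ] M) ∘ B = K := by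
      ext ν
      simp [hn]
    rwa [h2] at h1
  exact ⟨Module.Basis.mk hli hspan, Module.Basis.coe_mk _ _⟩

theorem exists_basis_frobeniusSchur :
    ∃ B : Module.Basis YoungDiagram ℂ Sym, ⇑B = frobeniusSchur := by
  refine exists_basis_of_unitriangular schurBasis fun ν => mem_span_schur fun N => ?_
  obtain ⟨-, -, -, h⟩ := exists_corresponds ν
  rw [schurBasis_apply]
  exact h N

/-- Send `p_k` back to `p*_k`, restrict to `N` variables, and undo the staircase translation: `FS_ν`
goes to `S*_ν` and then to the factorial Schur polynomial. -/
theorem exists_algHom_frobeniusSchur (N : ℕ) : ∃ ρ : Sym →ₐ[ℂ] MvPolynomial (Fin N) ℂ,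
    ∀ ν, ρ (frobeniusSchur ν) = multivariate (fun n => descPochhammer ℂ n) ν N := by
  let e : MvPolynomial ℕ ℂ ≃ₐ[ℂ] Sym := AlgEquiv.ofBijective (aeval powerSum)
    ⟨aeval_powerSum_injective, aeval_powerSum_surjective⟩
  refine ⟨(translate (-staircase N)).comp ((aeval fun k => shiftedPowerSum k N).comp
    e.symm.toAlgHom), fun ν => ?_⟩
  obtain ⟨Q, h1, h2, -⟩ := exists_corresponds ν
  have h3 : e.symm (frobeniusSchur ν) = Q := by
    rw [← h2]
    exact e.symm_apply_apply Q
  rw [AlgHom.comp_apply, AlgHom.comp_apply]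
  change translate _ (aeval _ (e.symm (frobeniusSchur ν))) = _
  rw [h3, ← aeval_shiftedPowerSum_apply, h1, shiftedSchur_eq, translate_neg_translate]

/-! ### Polynomial dependence on the parameters -/

/-- Polynomial functions of two complex variables. -/
def IsPolynomialFun (f : ℂ → ℂ → ℂ) : Prop :=
  ∃ P : MvPolynomial (Fin 2) ℂ, ∀ z z', f z z' = eval ![z, z'] P

theorem IsPolynomialFun.const (c : ℂ) : IsPolynomialFun fun _ _ => c := ⟨C c, by simp⟩

theorem IsPolynomialFun.fst : IsPolynomialFun fun z _ => z := ⟨X 0, by simp⟩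

theorem IsPolynomialFun.snd : IsPolynomialFun fun _ z' => z' := ⟨X 1, by simp⟩

theorem IsPolynomialFun.add {f g : ℂ → ℂ → ℂ} (hf : IsPolynomialFun f) (hg : IsPolynomialFun g) :
    IsPolynomialFun fun z z' => f z z' + g z z' := by
  obtain ⟨P, hP⟩ := hf
  obtain ⟨Q, hQ⟩ := hg
  exact ⟨P + Q, fun z z' => by simp only [map_add, hP, hQ]⟩

theorem IsPolynomialFun.mul {f g : ℂ → ℂ → ℂ} (hf : IsPolynomialFun f) (hg : IsPolynomialFun g) :
    IsPolynomialFun fun z z' => f z z' * g z z' := by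
  obtain ⟨P, hP⟩ := hf
  obtain ⟨Q, hQ⟩ := hg
  exact ⟨P * Q, fun z z' => by simp only [map_mul, hP, hQ]⟩

theorem IsPolynomialFun.sum {ι : Type*} (s : Finset ι) {f : ι → ℂ → ℂ → ℂ}
    (hf : ∀ i ∈ s, IsPolynomialFun (f i)) : IsPolynomialFun fun z z' => ∑ i ∈ s, f i z z' := by
  classical
  induction s using Finset.induction_on with
  | empty => simpa using IsPolynomialFun.const 0
  | insert a s ha ih =>
    simp only [Finset.sum_insert ha]
    exact (hf a (Finset.mem_insert_self a s)).add
      (ih fun i hi => hf i (Finset.mem_insert_of_mem hi))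

theorem IsPolynomialFun.prod {ι : Type*} (s : Finset ι) {f : ι → ℂ → ℂ → ℂ}
    (hf : ∀ i ∈ s, IsPolynomialFun (f i)) : IsPolynomialFun fun z z' => ∏ i ∈ s, f i z z' := by
  classical
  induction s using Finset.induction_on with
  | empty => simpa using IsPolynomialFun.const 1
  | insert a s ha ih =>
    simp only [Finset.prod_insert ha]
    exact (hf a (Finset.mem_insert_self a s)).mul
      (ih fun i hi => hf i (Finset.mem_insert_of_mem hi))

theorem IsPolynomialFun.eq_of_eqOn {f g : ℂ → ℂ → ℂ} (hf : IsPolynomialFun f)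
    (hg : IsPolynomialFun g) {s t : Set ℂ} (hs : s.Infinite) (ht : t.Infinite)
    (h : ∀ z ∈ s, ∀ z' ∈ t, f z z' = g z z') (z z' : ℂ) : f z z' = g z z' := by
  obtain ⟨P, hP⟩ := hf
  obtain ⟨Q, hQ⟩ := hg
  have : P = Q := by
    refine funext_set ![s, t] (fun i => ?_) fun x hx => ?_
    · fin_cases i
      · exact hs
      · exact ht
    · have h0 := hx 0 trivial
      have h1 := hx 1 trivial
      have hx' : x = ![x 0, x 1] := by
        ext i
        fin_cases i <;> rfl
      have h2 := h (x 0) h0 (x 1) h1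
      rwa [hP, hQ, ← hx'] at h2
  rw [hP, hQ, this]

theorem isPolynomialFun_skewPoch_mul (ν μ : YoungDiagram) :
    IsPolynomialFun fun z z' => skewPoch z ν μ * skewPoch z' ν μ :=
  (IsPolynomialFun.prod _ fun _ _ => IsPolynomialFun.fst.add (.const _)).mul
    (IsPolynomialFun.prod _ fun _ _ => IsPolynomialFun.snd.add (.const _))

theorem isPolynomialFun_expansionCoeff (t : ℂ) (ν μ : YoungDiagram) :
    IsPolynomialFun fun z z' => expansionCoeff z z' t ν μ :=
  (IsPolynomialFun.const _).mul (isPolynomialFun_skewPoch_mul ν μ)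

/-! ### Formal orthogonality -/

/-- The element with the Laguerre–Meixner expansion coefficients in a given basis. -/
noncomputable def expansion (B : YoungDiagram → Sym) (z z' t : ℂ) (ν : YoungDiagram) : Sym :=
  ∑ μ ∈ subdiagrams ν, expansionCoeff z z' t ν μ • B μ

theorem card_lt_of_mem_subdiagrams {μ ν : YoungDiagram} (h : μ ∈ subdiagrams ν) (hne : μ ≠ ν) :
    μ.card < ν.card :=
  Finset.card_lt_card (YoungDiagram.cells_ssubset_iff.2 (lt_of_le_of_ne (mem_subdiagrams.1 h) hne))

theorem expansion_eq (B : YoungDiagram → Sym) (z z' t : ℂ) (ν : YoungDiagram) :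
    expansion B z z' t ν =
      B ν + ∑ μ ∈ (subdiagrams ν).erase ν, expansionCoeff z z' t ν μ • B μ := by
  rw [expansion, ← Finset.add_sum_erase _ _ (mem_subdiagrams.2 le_rfl), expansionCoeff_self,
    one_smul]

theorem existsUnique_momentFunctional (B : Module.Basis YoungDiagram ℂ Sym) (z z' t : ℂ) :
    ∃! χ : Sym →ₗ[ℂ] ℂ, IsMomentFunctional (expansion B z z' t) χ := by
  obtain ⟨K, hK⟩ := exists_basis_of_unitriangular B (K := expansion B z z' t) fun ν => by
    rw [expansion_eq, add_sub_cancel_left]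
    refine Submodule.sum_mem _ fun μ hμ => Submodule.smul_mem _ _ (Submodule.subset_span ?_)
    obtain ⟨h1, h2⟩ := Finset.mem_erase.1 hμ
    exact ⟨μ, card_lt_of_mem_subdiagrams h2 h1, rfl⟩
  refine ⟨K.constr ℂ fun ν => if ν = ⊥ then 1 else 0, fun ν => ?_, fun χ hχ => K.ext fun ν => ?_⟩
  · rw [← hK, Module.Basis.constr_basis]
  · rw [Module.Basis.constr_basis, hK, hχ ν]

/-- The defining equation at `ν` is unitriangular, so `χ (B ν)` is found recursively from smaller
diagrams with polynomial coefficients. -/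
theorem isPolynomialFun_moment {B : Module.Basis YoungDiagram ℂ Sym} {t : ℂ}
    {χ : ℂ → ℂ → Sym →ₗ[ℂ] ℂ} (hχ : ∀ z z', IsMomentFunctional (expansion B z z' t) (χ z z'))
    (n : ℕ) : ∀ ν : YoungDiagram, ν.card = n → IsPolynomialFun fun z z' => χ z z' (B ν) := by
  induction n using Nat.strong_induction_on with
  | _ n ih =>
    intro ν hν
    have h1 : ∀ z z', χ z z' (B ν) = (if ν = ⊥ then 1 else 0) + -1 *
        ∑ μ ∈ (subdiagrams ν).erase ν, expansionCoeff z z' t ν μ * χ z z' (B μ) := fun z z' => by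
      have h2 := hχ z z' ν
      rw [expansion_eq, map_add, map_sum] at h2
      simp only [map_smul, smul_eq_mul] at h2
      rw [← h2]
      ring
    simp only [h1]
    refine (IsPolynomialFun.const _).add ((IsPolynomialFun.const _).mul
      (IsPolynomialFun.sum _ fun μ hμ => (isPolynomialFun_expansionCoeff t ν μ).mul ?_))
    obtain ⟨h3, h4⟩ := Finset.mem_erase.1 hμ
    exact ih μ.card (hν ▸ card_lt_of_mem_subdiagrams h4 h3) μ rfl

theorem isPolynomialFun_moment_mul {B : Module.Basis YoungDiagram ℂ Sym} {t : ℂ}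
    {χ : ℂ → ℂ → Sym →ₗ[ℂ] ℂ} (hχ : ∀ z z', IsMomentFunctional (expansion B z z' t) (χ z z'))
    (μ ν : YoungDiagram) : IsPolynomialFun fun z z' =>
      χ z z' (expansion B z z' t μ * expansion B z z' t ν) := by
  have h1 : ∀ f : Sym, IsPolynomialFun fun z z' => χ z z' f := fun f => by
    have h2 : ∀ z z', χ z z' f = ∑ l ∈ (B.repr f).support, B.repr f l * χ z z' (B l) :=
      fun z z' => by
        conv_lhs => rw [← B.linearCombination_repr f, Finsupp.linearCombination_apply,
          Finsupp.sum, map_sum]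
        simp only [map_smul, smul_eq_mul]
    simp only [h2]
    exact IsPolynomialFun.sum _ fun l _ =>
      (IsPolynomialFun.const _).mul (isPolynomialFun_moment hχ _ l rfl)
  have h3 : ∀ z z', χ z z' (expansion B z z' t μ * expansion B z z' t ν) =
      ∑ a ∈ subdiagrams μ, ∑ b ∈ subdiagrams ν,
        (expansionCoeff z z' t μ a * expansionCoeff z z' t ν b) * χ z z' (B a * B b) :=
    fun z z' => by
      rw [expansion, expansion, Finset.sum_mul_sum, map_sum]
      refine Finset.sum_congr rfl fun a _ => ?_
      rw [map_sum]
      refine Finset.sum_congr rfl fun b _ => ?_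
      rw [smul_mul_smul_comm, map_smul, smul_eq_mul]
  simp only [h3]
  exact IsPolynomialFun.sum _ fun a _ => IsPolynomialFun.sum _ fun b _ =>
    ((isPolynomialFun_expansionCoeff t μ a).mul (isPolynomialFun_expansionCoeff t ν b)).mul
      (h1 _)

/-- Without corners the row lengths never drop, yet they are eventually zero. -/
theorem exists_mem_cornerRows {ν : YoungDiagram} (h : ν ≠ ⊥) : ∃ i, i ∈ cornerRows ν := by
  by_contra! hc
  simp only [mem_cornerRows, not_lt] at hc
  have h1 : ∀ i, ν.rowLen 0 ≤ ν.rowLen i := fun i => by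
    induction i with
    | zero => exact le_rfl
    | succ i ih => exact ih.trans (hc i)
  have h2 := h1 (ν.colLen 0)
  rw [(colLen_zero_le_iff ν _).1 le_rfl] at h2
  refine h (eq_of_rowLen_eq fun i => ?_)
  have := ν.rowLen_anti 0 i (Nat.zero_le i)
  rw [rowLen_bot]
  omega

/-- The squared norm of the univariate orthogonal polynomial of degree `n`. -/
noncomputable def normSq (b κ : ℂ) (n : ℕ) : ℂ :=
  n.factorial * (ascPochhammer ℂ n).eval b * κ ^ n

theorem normSq_succ (b κ : ℂ) (n : ℕ) :
    normSq b κ (n + 1) = κ * ((n + 1) * (b + n)) * normSq b κ n := by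
  rw [normSq, normSq, ascPochhammer_succ_eval, Nat.factorial_succ, pow_succ]
  push_cast
  ring

/-- Removing a corner lowers one bead from `n+1` to `n`. The ratio of norms `κ(n+1)(b+n)` is `κ`
times the content factors of that box at `N` and `N+b-1`. -/
theorem prod_normSq_beads (b κ : ℂ) (N n : ℕ) : ∀ ν : YoungDiagram, ν.card = n →
    ν.colLen 0 ≤ N → ∏ i, normSq b κ (beads ν N i) =
      κ ^ n * (poch N ν * poch (N + b - 1) ν) * ∏ i, normSq b κ (beads ⊥ N i) := by
  induction n with
  | zero =>
    intro ν hn _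
    have : ν = ⊥ := YoungDiagram.ext (Finset.card_eq_zero.1 hn)
    subst this
    simp [poch, skewPoch_self]
  | succ n ih =>
    intro ν hn hN
    have hne : ν ≠ ⊥ := by
      rintro rfl
      simp [YoungDiagram.card] at hn
    obtain ⟨i, hi⟩ := exists_mem_cornerRows hne
    have hc := card_removeCorner hi
    have hi' := mem_cornerRows.1 hi
    have hiN : i < N := by
      by_contra! h
      have h1 := ν.rowLen_anti N i h
      rw [(colLen_zero_le_iff ν N).1 hN] at h1
      omega
    have hbot : ⊥ ≤ removeCorner ν i := bot_le
    have h1 : ∀ x, poch x ν = (x + (ν.rowLen i - 1 - i)) * poch x (removeCorner ν i) :=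
      skewPoch_removeCorner hi hbot
    have h2 := ih _ (by omega) (colLen_le_of_le (removeCorner_le hi) hN)
    have h3 : ∏ j, normSq b κ (beads ν N j) =
        κ * ((N + (ν.rowLen i - 1 - i)) * (N + b - 1 + (ν.rowLen i - 1 - i))) *
          ∏ j, normSq b κ (beads (removeCorner ν i) N j) := by
      rw [← Finset.mul_prod_erase _ _ (Finset.mem_univ (⟨i, hiN⟩ : Fin N)),
        ← Finset.mul_prod_erase _ (fun j => normSq b κ (beads (removeCorner ν i) N j))
          (Finset.mem_univ (⟨i, hiN⟩ : Fin N)), ← mul_assoc]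
      congr 1
      · obtain ⟨r, hr⟩ : ∃ r, ν.rowLen i = r + 1 := Nat.exists_eq_succ_of_ne_zero (by omega)
        have e1 : beads (removeCorner ν i) N ⟨i, hiN⟩ = r + (N - 1 - i) := by
          simp [beads, rowLen_removeCorner hi, hr]
        have e2 : beads ν N ⟨i, hiN⟩ = r + (N - 1 - i) + 1 := by
          simp only [beads, hr]
          omega
        have hNc : (N : ℂ) = ((N - 1 - i : ℕ) : ℂ) + 1 + i := by
          have : N = (N - 1 - i) + 1 + i := by omega
          exact_mod_cast this
        rw [e1, e2, normSq_succ, hr, hNc]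
        push_cast
        ring
      · refine Finset.prod_congr rfl fun j hj => ?_
        have hji : (j : ℕ) ≠ i := fun h => Finset.ne_of_mem_erase hj (Fin.ext h)
        simp [beads, rowLen_removeCorner hi, hji]
    rw [h3, h2, h1, h1]
    ring

section Orthogonality

variable {φ : ℕ → Polynomial ℂ} {B : Module.Basis YoungDiagram ℂ Sym}
  {ρ : ∀ N, Sym →ₐ[ℂ] MvPolynomial (Fin N) ℂ} {s t : ℂ}

theorem algHom_expansion (hρ : ∀ N ν, ρ N (B ν) = multivariate φ ν N) (b t : ℂ) (N : ℕ)
    (ν : YoungDiagram) :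
    ρ N (expansion B N (N + b - 1) t ν) = multivariate (lowered φ b t) ν N := by
  rw [expansion, map_sum, ← sum_expansionCoeff_smul_multivariate]
  refine Finset.sum_congr rfl fun μ _ => ?_
  rw [map_smul, hρ]

/-- At these parameters the moment functional is concrete: specialize to `N` variables, pair with
`V_N²` under the tensor power of `ψ`, and divide by the norm `Z` of the empty diagram. Uniqueness
transfers the determinantal orthogonality to `χ`; `hb` and `hst` make `Z` invertible. -/
theorem moment_mul_of_natCast (hd : ∀ n, (φ n).natDegree = n) (hm : ∀ n, (φ n).Monic)
    (hρ : ∀ N ν, ρ N (B ν) = multivariate φ ν N) (hst : s * t ≠ 0) {b : ℂ}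
    (hb : ∀ n : ℕ, (ascPochhammer ℂ n).eval b ≠ 0)
    (hψ : ∃ (ψ : Polynomial ℂ →ₗ[ℂ] ℂ) (q : ℕ → Polynomial ℂ),
      (∀ n, (q n).natDegree = n) ∧ (∀ n, (q n).Monic) ∧
      ∀ m k, ψ (φ m * q k) = s ^ k * t ^ m * (ascPochhammer ℂ (m + k)).eval b)
    {N : ℕ} {χ : Sym →ₗ[ℂ] ℂ} (hχ : IsMomentFunctional (expansion B N (N + b - 1) t) χ)
    (μ ν : YoungDiagram) :
    χ (expansion B N (N + b - 1) t μ * expansion B N (N + b - 1) t ν) =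
      if μ = ν then (s * t) ^ ν.card * (poch N ν * poch (N + b - 1) ν) else 0 := by
  obtain ⟨ψ, q, hq, hq', hψ⟩ := hψ
  have horth : ∀ n m, ψ (lowered φ b t n * lowered φ b t m) =
      if n = m then normSq b (s * t) n else 0 :=
    functional_lowered_mul_lowered hd hm hq hq' hψ
  have hP := fun n => (lowered_natDegree_monic hd hm b t n).1
  have hP' := fun n => (lowered_natDegree_monic hd hm b t n).2
  set P := lowered φ b t with hPdef
  set Z : ℂ := N.factorial * ∏ i, normSq b (s * t) (beads ⊥ N i) with hZ
  have hprod : ∏ i, normSq b (s * t) (beads ⊥ N i) ≠ 0 :=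
    Finset.prod_ne_zero_iff.2 fun i _ => mul_ne_zero (mul_ne_zero
      (by exact_mod_cast Nat.factorial_ne_zero _) (hb _)) (pow_ne_zero _ hst)
  have hfac : (N.factorial : ℂ) ≠ 0 := by exact_mod_cast Nat.factorial_ne_zero _
  have hZ0 : Z ≠ 0 := mul_ne_zero hfac hprod
  let χ' : Sym →ₗ[ℂ] ℂ := Z⁻¹ • (tensorFunctional ψ N ∘ₗ LinearMap.mulLeft ℂ (vdm N * vdm N) ∘ₗ
    (ρ N).toLinearMap)
  have hχ' : ∀ f, χ' f = Z⁻¹ * tensorFunctional ψ N (vdm N * vdm N * ρ N f) := fun f => rfl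
  have hpair : ∀ μ ν, tensorFunctional ψ N ((vdm N * multivariate P μ N) *
      (vdm N * multivariate P ν N)) = if μ = ν ∧ ν.colLen 0 ≤ N then
        N.factorial * ∏ i, normSq b (s * t) (beads ν N i) else 0 := fun μ ν => by
    by_cases hμ : μ.colLen 0 ≤ N
    · by_cases hν : ν.colLen 0 ≤ N
      · rw [vdm_mul_multivariate _ hμ, vdm_mul_multivariate _ hν,
          tensorFunctional_alternant_mul horth hμ hν]
        simp [hν]
      · simp [multivariate, hν]
    · have : ¬ (μ = ν ∧ ν.colLen 0 ≤ N) := by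
        rintro ⟨rfl, h⟩
        exact hμ h
      rw [if_neg this]
      simp [multivariate, hμ]
  have hmom : IsMomentFunctional (expansion B N (N + b - 1) t) χ' := fun ν => by
    have h1 := hpair ν ⊥
    rw [multivariate_bot hP hP', mul_one] at h1
    rw [hχ', algHom_expansion hρ, ← hPdef,
      show vdm N * vdm N * multivariate P ν N = vdm N * multivariate P ν N * vdm N by ring, h1]
    simp only [colLen_bot, and_true]
    split_ifs
    · exact inv_mul_cancel₀ hZ0
    · exact mul_zero _
  have huniq : χ = χ' := (existsUnique_momentFunctional B N (N + b - 1) t).unique hχ hmom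
  rw [huniq, hχ', map_mul (ρ N), algHom_expansion hρ, algHom_expansion hρ, ← hPdef,
    show vdm N * vdm N * (multivariate P μ N * multivariate P ν N) =
      (vdm N * multivariate P μ N) * (vdm N * multivariate P ν N) by ring, hpair]
  by_cases hμν : μ = ν
  · by_cases hν : ν.colLen 0 ≤ N
    · rw [if_pos ⟨hμν, hν⟩, if_pos hμν, prod_normSq_beads b (s * t) N _ ν rfl hν, hZ]
      field_simp
    -- With more than `N` rows the specialization is `0`, and so is the predicted norm.
    · have h0 : poch N ν = 0 := skewPoch_eq_zero_of_colLen (colLen_bot N) hν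
      simp [hν, h0]
  · simp [hμν]

/-- At `t = 0` the expansion is the basis itself, and specialization to zero variables is a
multiplicative moment functional. -/
theorem moment_mul_of_zero (hd : ∀ n, (φ n).natDegree = n) (hm : ∀ n, (φ n).Monic)
    (hρ : ∀ N ν, ρ N (B ν) = multivariate φ ν N) {z z' : ℂ} {χ : Sym →ₗ[ℂ] ℂ}
    (hχ : IsMomentFunctional (expansion B z z' 0) χ) (μ ν : YoungDiagram) :
    χ (expansion B z z' 0 μ * expansion B z z' 0 ν) =
      if μ = ν then 0 ^ ν.card * (poch z ν * poch z' ν) else 0 := by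
  have hexp : ∀ ν, expansion B z z' 0 ν = B ν := fun ν => by
    rw [expansion_eq, Finset.sum_eq_zero, add_zero]
    intro l hl
    obtain ⟨h1, h2⟩ := Finset.mem_erase.1 hl
    have h3 := card_skewCells (mem_subdiagrams.1 h2)
    have h4 := card_lt_of_mem_subdiagrams h2 h1
    have h5 : (skewCells ν l).card ≠ 0 := by omega
    rw [expansionCoeff, neg_zero, zero_pow h5, zero_mul, zero_mul, zero_smul]
  let χ' : Sym →ₐ[ℂ] ℂ := (aeval (0 : Fin 0 → ℂ)).comp (ρ 0)
  have hB : ∀ ν, χ' (B ν) = if ν = ⊥ then 1 else 0 := fun ν => by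
    change aeval (0 : Fin 0 → ℂ) (ρ 0 (B ν)) = _
    rw [hρ]
    split_ifs with h
    · rw [h, multivariate_bot hd hm, map_one]
    · rw [multivariate, if_neg, map_zero]
      intro h1
      refine h (eq_of_rowLen_eq fun i => ?_)
      have h2 := ν.rowLen_anti 0 i (Nat.zero_le i)
      rw [(colLen_zero_le_iff ν 0).1 h1] at h2
      rw [rowLen_bot]
      omega
  have huniq : χ = χ'.toLinearMap :=
    (existsUnique_momentFunctional B z z' 0).unique hχ fun ν => by
      rw [hexp]
      exact hB ν
  rw [huniq, AlgHom.toLinearMap_apply, map_mul, hexp, hexp, hB, hB]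
  by_cases hμν : μ = ν
  · subst hμν
    by_cases h : μ = ⊥
    · subst h
      simp [poch, skewPoch_self, YoungDiagram.card]
    · have h1 : μ.card ≠ 0 := fun h1 => h (YoungDiagram.ext (Finset.card_eq_zero.1 h1))
      simp [h, h1]
  · have : ¬ (μ = ⊥ ∧ ν = ⊥) := fun h => hμν (h.1.trans h.2.symm)
    rw [if_neg hμν]
    by_cases h : μ = ⊥
    · have h1 : ν ≠ ⊥ := fun h1 => this ⟨h, h1⟩
      simp [h1]
    · simp [h]

theorem ascPochhammer_eval_half_ne_zero (n N k : ℕ) :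
    (ascPochhammer ℂ k).eval ((n : ℂ) + 1 / 2 - N + 1) ≠ 0 := by
  rw [ne_eq, ascPochhammer_eval_eq_zero_iff]
  rintro ⟨j, -, hj⟩
  -- A zero would make a half-integer an integer; doubling turns this into a parity contradiction.
  have h1 : ((2 * j + 2 * n + 3 : ℤ) : ℂ) = ((2 * N : ℤ) : ℂ) := by
    push_cast
    linear_combination 2 * hj
  have h2 : (2 * j + 2 * n + 3 : ℤ) = 2 * N := by exact_mod_cast h1
  omega

/-- Formal orthogonality of the Laguerre–Meixner expansions in a basis whose specializations are
multivariate polynomials built from univariate ones. -/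
theorem moment_mul (hd : ∀ n, (φ n).natDegree = n) (hm : ∀ n, (φ n).Monic)
    (hρ : ∀ N ν, ρ N (B ν) = multivariate φ ν N) (hs : s ≠ 0)
    (hψ : ∀ b, ∃ (ψ : Polynomial ℂ →ₗ[ℂ] ℂ) (q : ℕ → Polynomial ℂ),
      (∀ n, (q n).natDegree = n) ∧ (∀ n, (q n).Monic) ∧
      ∀ m k, ψ (φ m * q k) = s ^ k * t ^ m * (ascPochhammer ℂ (m + k)).eval b)
    {z z' : ℂ} {χ : Sym →ₗ[ℂ] ℂ} (hχ : IsMomentFunctional (expansion B z z' t) χ)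
    (μ ν : YoungDiagram) :
    χ (expansion B z z' t μ * expansion B z z' t ν) =
      if μ = ν then (s * t) ^ ν.card * (poch z ν * poch z' ν) else 0 := by
  by_cases ht : t = 0
  · subst ht
    rw [mul_zero]
    exact moment_mul_of_zero hd hm hρ hχ μ ν
  choose X hX hX' using existsUnique_momentFunctional B (t := t)
  rw [hX' z z' χ hχ]
  have hright : IsPolynomialFun fun z z' =>
      if μ = ν then (s * t) ^ ν.card * (poch z ν * poch z' ν) else 0 := by
    split_ifs
    · exact (IsPolynomialFun.const _).mul (isPolynomialFun_skewPoch_mul ν ⊥)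
    · exact IsPolynomialFun.const 0
  -- Half-integers for `z'` keep `b = z' - N + 1` away from the non-positive integers for every `N`,
  -- so one product set of parameters suffices.
  refine (isPolynomialFun_moment_mul hX μ ν).eq_of_eqOn hright
    (Set.infinite_range_of_injective (f := fun N : ℕ => (N : ℂ)) Nat.cast_injective)
    (Set.infinite_range_of_injective (f := fun n : ℕ => (n : ℂ) + 1 / 2) fun a b h => by
      simpa using h) ?_ z z'
  rintro _ ⟨N, rfl⟩ _ ⟨n, rfl⟩
  have e : (n : ℂ) + 1 / 2 = N + (n + 1 / 2 - N + 1) - 1 := by ring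
  have h1 := hX N (n + 1 / 2)
  simp only
  rw [e] at h1 ⊢
  exact moment_mul_of_natCast hd hm hρ (mul_ne_zero hs ht)
    (ascPochhammer_eval_half_ne_zero n N) (hψ _) h1 μ ν

end Orthogonality

/-! ### The two families as expansions, and the main theorem -/

theorem laguerre_eq (z z' : ℂ) : laguerre z z' = expansion schurBasis z z' 1 := by
  ext1 ν
  rw [laguerre, expansion]
  simp only [schurBasis_apply, expansionCoeff]

theorem meixner_eq {B : YoungDiagram → Sym} (hB : B = frobeniusSchur) (z z' ξ : ℂ) :
    meixner z z' ξ = expansion B z z' (ξ / (1 - ξ)) := by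
  ext1 ν
  rw [meixner, expansion, hB]
  refine Finset.sum_congr rfl fun μ _ => ?_
  rw [expansionCoeff, neg_pow (ξ / (1 - ξ))]

end SymFun

theorem theorem2 (z z' : ℂ) :
    ((∃! φ : SymFun.Sym →ₗ[ℂ] ℂ, SymFun.IsMomentFunctional (SymFun.laguerre z z') φ) ∧
      ∀ φ : SymFun.Sym →ₗ[ℂ] ℂ, SymFun.IsMomentFunctional (SymFun.laguerre z z') φ →
        ∀ μ ν : YoungDiagram,
          φ (SymFun.laguerre z z' μ * SymFun.laguerre z z' ν) =
            if μ = ν then SymFun.poch z ν * SymFun.poch z' ν else 0) ∧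
    (∀ ξ : ℂ, ξ ≠ 1 →
      (∃! φ : SymFun.Sym →ₗ[ℂ] ℂ, SymFun.IsMomentFunctional (SymFun.meixner z z' ξ) φ) ∧
      ∀ φ : SymFun.Sym →ₗ[ℂ] ℂ, SymFun.IsMomentFunctional (SymFun.meixner z z' ξ) φ →
        ∀ μ ν : YoungDiagram,
          φ (SymFun.meixner z z' ξ μ * SymFun.meixner z z' ξ ν) =
            if μ = ν then
              ξ ^ ν.card / (1 - ξ) ^ (2 * ν.card) * (SymFun.poch z ν * SymFun.poch z' ν)
            else 0) := by
  refine ⟨?_, fun ξ hξ => ?_⟩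
  · rw [SymFun.laguerre_eq]
    refine ⟨SymFun.existsUnique_momentFunctional _ _ _ _, fun χ hχ μ ν => ?_⟩
    have h := SymFun.moment_mul (φ := fun n => Polynomial.X ^ n)
      (ρ := fun N => (Pi.evalAlgHom ℂ (fun N => MvPolynomial (Fin N) ℂ) N).comp SymFun.Sym.val)
      (fun n => Polynomial.natDegree_X_pow n) (fun n => Polynomial.monic_X_pow n)
      (fun N ν => by rw [SymFun.schurBasis_apply]; rfl) one_ne_zero
      SymFun.exists_functional_X_pow hχ μ ν
    simpa using h
  · obtain ⟨B, hB⟩ := SymFun.exists_basis_frobeniusSchur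
    rw [SymFun.meixner_eq hB]
    refine ⟨SymFun.existsUnique_momentFunctional _ _ _ _, fun χ hχ μ ν => ?_⟩
    choose ρ hρ using SymFun.exists_algHom_frobeniusSchur
    have h1 : 1 - ξ ≠ 0 := sub_ne_zero.2 hξ.symm
    -- Here `s = 1 + t`, so `s` is nonzero and `s t = ξ/(1-ξ)²`, the base of the norm.
    have h2 : 1 + ξ / (1 - ξ) = 1 / (1 - ξ) := by
      field_simp
      ring
    have h := SymFun.moment_mul (φ := fun n => descPochhammer ℂ n) (ρ := ρ)
      (fun n => descPochhammer_natDegree ℂ n) (fun n => monic_descPochhammer ℂ n)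
      (fun N ν => by rw [hB]; exact hρ N ν) (s := 1 + ξ / (1 - ξ))
      (by rw [h2]; exact one_div_ne_zero h1)
      (fun b => SymFun.exists_functional_descPochhammer b (ξ / (1 - ξ))) hχ μ ν
    rw [h, h2]
    congr 2
    rw [pow_mul', sq, ← mul_pow, ← div_pow]
    congr 1
    field_simp
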